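/- Let $F$ be a field. An \emph{alternative quadrialgebra} is an $F$-vector space $A$ with four bilinear operations $\nearrow,\searrow,\swarrow,\nwarrow$ such that, for all $x,y,z\in A$, \begin{align*} &(x,y,z)_r+(y,x,z)_m=0,\quad (x,y,z)_r+(x,z,y)_r=0,\quad (x,y,z)_n+(y,x,z)_w=0,\\ &(x,y,z)_n+(x,z,y)_{ne}=0,\quad (x,y,z)_{ne}+(y,x,z)_e=0,\quad (x,y,z)_w+(x,z,y)_{sw}=0,\\ &(x,y,z)_{sw}+(y,x,z)_s=0,\quad (x,y,z)_m+(x,z,y)_\ell=0,\quad (x,y,z)_\ell+(y,x,z)_\ell=0, \end{align*} where $x\succ y=x\nearrow y+x\searrow y$, $x\prec y=x\nwarrow y+x\swarrow y$, $x\vee y=x\searrow y+x\swarrow y$, $x\wedge y=x\nearrow y+x\nwarrow y$, $x*y=x\succ y+x\prec y$ and \begin{align*} (x,y,z)_r&=(x\nwarrow y)\nwarrow z-x\nwarrow(y*z), & (x,y,z)_\ell&=(x*y)\searrow z-x\searrow(y\searrow z),\\ (x,y,z)_{ne}&=(x\wedge y)\nearrow z-x\nearrow(y\succ z), & (x,y,z)_{sw}&=(x\prec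 y)\swarrow z-x\swarrow(y\vee z),\\ (x,y,z)_n&=(x\nearrow y)\nwarrow z-x\nearrow(y\prec z), & (x,y,z)_w&=(x\swarrow y)\nwarrow z-x\swarrow(y\wedge z),\\ (x,y,z)_s&=(x\succ y)\swarrow z-x\searrow(y\swarrow z), & (x,y,z)_e&=(x\vee y)\nearrow z-x\searrow(y\nearrow z),\\ (x,y,z)_m&=(x\searrow y)\nwarrow z-x\searrow(y\nwarrow z). \end{align*} An \emph{M-dendriform algebra} is an $F$-vector space with two bilinear operations $\blacktriangleleft,\blacktriangleright$ such that $MD_i(x,y,z,t)=0$ for all $x,y,z,t$ and $i=1,\dots,4$, where \begin{align*} MD_1(x,y,z,t) &= ((x\blacktriangleleft y)\blacktriangleleft z)\blacktriangleleft t-((y\blacktriangleright x)\blacktriangleleft z)\blacktriangleleft t-(z\blacktriangleright (x\blacktriangleleft y))\blacktriangleleft t+(z\blacktriangleright (y\blacktriangleright x))\blacktriangleleft t\\ &\quad -x\blacktriangleleft (y\blacktriangleright (z\blacktriangleright t))-x\blacktriangleleft (y\blacktriangleleft (z\blacktriangleright t))-x\blacktriangleleft (y\blacktriangleright (z\blacktriangleleft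 t))-x\blacktriangleleft (y\blacktriangleleft (z\blacktriangleleft t))\\ &\quad +z\blacktriangleright (x\blacktriangleleft (y\blacktriangleright t))+z\blacktriangleright (x\blacktriangleleft (y\blacktriangleleft t))+(y\blacktriangleright z)\blacktriangleright (x\blacktriangleleft t)+(y\blacktriangleleft z)\blacktriangleright (x\blacktriangleleft t)\\ &\quad -(z\blacktriangleright y)\blacktriangleright (x\blacktriangleleft t)-(z\blacktriangleleft y)\blacktriangleright (x\blacktriangleleft t)-y\blacktriangleright ((z\blacktriangleright x)\blacktriangleleft t)+y\blacktriangleright ((x\blacktriangleleft z)\blacktriangleleft t)\\ MD_2(x,y,z,t) &= ((x\blacktriangleright y)\blacktriangleleft z)\blacktriangleleft t-((y\blacktriangleleft x)\blacktriangleleft z)\blacktriangleleft t-(z\blacktriangleright (x\blacktriangleright y))\blacktriangleleft t+(z\blacktriangleright (y\blacktriangleleft x))\blacktriangleleft t\\ &\quad -x\blacktriangleright (y\blacktriangleleft (z\blacktriangleright t))-x\blacktriangleright (y\blacktriangleleft (z\blacktriangleleft t))+z\blacktriangleright (x\blacktriangleright (y\blacktriangleleft t))+(y\blacktriangleleft z)\blacktriangleleft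 (x\blacktriangleright t)\\ &\quad +(y\blacktriangleleft z)\blacktriangleleft (x\blacktriangleleft t)-(z\blacktriangleright y)\blacktriangleleft (x\blacktriangleright t)-(z\blacktriangleright y)\blacktriangleleft (x\blacktriangleleft t)-y\blacktriangleleft ((z\blacktriangleright x)\blacktriangleright t)\\ &\quad -y\blacktriangleleft ((z\blacktriangleright x)\blacktriangleleft t)-y\blacktriangleleft ((z\blacktriangleleft x)\blacktriangleright t)-y\blacktriangleleft ((z\blacktriangleleft x)\blacktriangleleft t)+y\blacktriangleleft ((x\blacktriangleright z)\blacktriangleright t)\\ &\quad +y\blacktriangleleft ((x\blacktriangleright z)\blacktriangleleft t)+y\blacktriangleleft ((x\blacktriangleleft z)\blacktriangleright t)+y\blacktriangleleft ((x\blacktriangleleft z)\blacktriangleleft t)\\ MD_3(x,y,z,t) &= ((x\blacktriangleright y)\blacktriangleright z)\blacktriangleleft t+((x\blacktriangleleft y)\blacktriangleright z)\blacktriangleleft t-((y\blacktriangleright x)\blacktriangleright z)\blacktriangleleft t-((y\blacktriangleleft x)\blacktriangleright z)\blacktriangleleft t\\ &\quad -(z\blacktriangleleft (x\blacktriangleright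 y))\blacktriangleleft t-(z\blacktriangleleft (x\blacktriangleleft y))\blacktriangleleft t+(z\blacktriangleleft (y\blacktriangleright x))\blacktriangleleft t+(z\blacktriangleleft (y\blacktriangleleft x))\blacktriangleleft t\\ &\quad -x\blacktriangleright (y\blacktriangleright (z\blacktriangleleft t))+z\blacktriangleleft (x\blacktriangleright (y\blacktriangleright t))+z\blacktriangleleft (x\blacktriangleleft (y\blacktriangleright t))+z\blacktriangleleft (x\blacktriangleright (y\blacktriangleleft t))\\ &\quad +z\blacktriangleleft (x\blacktriangleleft (y\blacktriangleleft t))+(y\blacktriangleright z)\blacktriangleleft (x\blacktriangleright t)+(y\blacktriangleright z)\blacktriangleleft (x\blacktriangleleft t)-(z\blacktriangleleft y)\blacktriangleleft (x\blacktriangleright t)\\ &\quad -(z\blacktriangleleft y)\blacktriangleleft (x\blacktriangleleft t)-y\blacktriangleright ((z\blacktriangleleft x)\blacktriangleleft t)+y\blacktriangleright ((x\blacktriangleright z)\blacktriangleleft t)\\ MD_4(x,y,z,t) &= ((x\blacktriangleright y)\blacktriangleright z)\blacktriangleright t+((x\blacktriangleright y)\blacktriangleleft z)\blacktriangleright t+((x\blacktriangleleft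 y)\blacktriangleright z)\blacktriangleright t+((x\blacktriangleleft y)\blacktriangleleft z)\blacktriangleright t\\ &\quad -((y\blacktriangleright x)\blacktriangleright z)\blacktriangleright t-((y\blacktriangleright x)\blacktriangleleft z)\blacktriangleright t-((y\blacktriangleleft x)\blacktriangleright z)\blacktriangleright t-((y\blacktriangleleft x)\blacktriangleleft z)\blacktriangleright t\\ &\quad -(z\blacktriangleright (x\blacktriangleright y))\blacktriangleright t-(z\blacktriangleleft (x\blacktriangleright y))\blacktriangleright t-(z\blacktriangleright (x\blacktriangleleft y))\blacktriangleright t-(z\blacktriangleleft (x\blacktriangleleft y))\blacktriangleright t\\ &\quad +(z\blacktriangleright (y\blacktriangleright x))\blacktriangleright t+(z\blacktriangleleft (y\blacktriangleright x))\blacktriangleright t+(z\blacktriangleright (y\blacktriangleleft x))\blacktriangleright t+(z\blacktriangleleft (y\blacktriangleleft x))\blacktriangleright t\\ &\quad -x\blacktriangleright (y\blacktriangleright (z\blacktriangleright t))+z\blacktriangleright (x\blacktriangleright (y\blacktriangleright t))+(y\blacktriangleright z)\blacktriangleright (x\blacktriangleright t)+(y\blacktriangleleft z)\blacktriangleright (x\blacktriangleright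 t)\\ &\quad -(z\blacktriangleright y)\blacktriangleright (x\blacktriangleright t)-(z\blacktriangleleft y)\blacktriangleright (x\blacktriangleright t)-y\blacktriangleright ((z\blacktriangleright x)\blacktriangleright t)-y\blacktriangleright ((z\blacktriangleleft x)\blacktriangleright t)\\ &\quad +y\blacktriangleright ((x\blacktriangleright z)\blacktriangleright t)+y\blacktriangleright ((x\blacktriangleleft z)\blacktriangleright t) \end{align*} \textbf{Proposition.} (1) If $A$ is an alternative quadrialgebra over a field $F$, then $A$ with the operations \[ x\blacktriangleleft y=x\nearrow y-y\swarrow x,\qquad x\blacktriangleright y=x\searrow y-y\nwarrow x \] is an M-dendriform algebra. (2) Let $F$ have characteristic zero, let $X$ be a set, and let $f$ be an element of the free nonassociative $F$-algebra $F\{\blacktriangleleft,\blacktriangleright;X\}$ with two bilinear operations, homogeneous of degree $4$. If $f$ is an identity of the operations $\blacktriangleleft,\blacktriangleright$ of (1) in the free alternative quadrialgebra on $X$ (that is, $f$ vanishes under every substitution of elements of that algebra for the variables), then $f$ is a consequence of $MD_1,\dots,MD_4$: it lies in the ideal of $F\{\blacktriangleleft,\blacktriangleright;X\}$ generated by all $MD_i(p,q,r,s)$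 with $p,q,r,s\in F\{\blacktriangleleft,\blacktriangleright;X\}$. (3) Let $F$ and $X$ be as in (2). If $f\in F\{\blacktriangleleft,\blacktriangleright;X\}$ is homogeneous of degree $3$ and is an identity of the operations $\blacktriangleleft,\blacktriangleright$ in the free alternative quadrialgebra on $X$, then $f=0$. -/

import Mathlib

/-- A family of bilinear operations on the `K`-module `A`, indexed by `Ω`. -/
abbrev BilinearOps (K Ω A : Type*) [CommSemiring K] [AddCommMonoid A] [Module K A] :=
  Ω → A →ₗ[K] A →ₗ[K] A

/-- The four operation symbols `↗`, `↘`, `↙`, `↖` of a quadrialgebra. -/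
inductive QuadOp
  | ne | se | sw | nw

/-- The two operation symbols `◀` (`left`) and `▶` (`right`) of an M-dendriform algebra. -/
inductive MDOp
  | left | right

section Identities

variable {K A : Type*} [Field K] [AddCommGroup A] [Module K A]

namespace Quad

/-- `x ≻ y = x ↗ y + x ↘ y` -/
def succ (μ : BilinearOps K QuadOp A) (x y : A) : A := μ .ne x y + μ .se x y
/-- `x ≺ y = x ↖ y + x ↙ y` -/
def prec (μ : BilinearOps K QuadOp A) (x y : A) : A := μ .nw x y + μ .sw x y
/-- `x ∨ y = x ↘ y + x ↙ y` -/
def vee (μ : BilinearOps K QuadOp A) (x y : A) : A := μ .se x y + μ .sw x y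
/-- `x ∧ y = x ↗ y + x ↖ y` -/
def wedge (μ : BilinearOps K QuadOp A) (x y : A) : A := μ .ne x y + μ .nw x y
/-- `x * y = x ↘ y + x ↗ y + x ↖ y + x ↙ y` -/
def star (μ : BilinearOps K QuadOp A) (x y : A) : A :=
  μ .se x y + μ .ne x y + μ .nw x y + μ .sw x y

/-- Right associator `(x ↖ y) ↖ z - x ↖ (y * z)`. -/
def assocR (μ : BilinearOps K QuadOp A) (x y z : A) : A :=
  μ .nw (μ .nw x y) z - μ .nw x (star μ y z)
/-- Left associator `(x * y) ↘ z - x ↘ (y ↘ z)`. -/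
def assocL (μ : BilinearOps K QuadOp A) (x y z : A) : A :=
  μ .se (star μ x y) z - μ .se x (μ .se y z)
/-- North-east associator `(x ∧ y) ↗ z - x ↗ (y ≻ z)`. -/
def assocNE (μ : BilinearOps K QuadOp A) (x y z : A) : A :=
  μ .ne (wedge μ x y) z - μ .ne x (succ μ y z)
/-- South-west associator `(x ≺ y) ↙ z - x ↙ (y ∨ z)`. -/
def assocSW (μ : BilinearOps K QuadOp A) (x y z : A) : A :=
  μ .sw (prec μ x y) z - μ .sw x (vee μ y z)
/-- North associator `(x ↗ y) ↖ z - x ↗ (y ≺ z)`. -/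
def assocN (μ : BilinearOps K QuadOp A) (x y z : A) : A :=
  μ .nw (μ .ne x y) z - μ .ne x (prec μ y z)
/-- West associator `(x ↙ y) ↖ z - x ↙ (y ∧ z)`. -/
def assocW (μ : BilinearOps K QuadOp A) (x y z : A) : A :=
  μ .nw (μ .sw x y) z - μ .sw x (wedge μ y z)
/-- South associator `(x ≻ y) ↙ z - x ↘ (y ↙ z)`. -/
def assocS (μ : BilinearOps K QuadOp A) (x y z : A) : A :=
  μ .sw (succ μ x y) z - μ .se x (μ .sw y z)
/-- East associator `(x ∨ y) ↗ z - x ↘ (y ↗ z)`. -/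
def assocE (μ : BilinearOps K QuadOp A) (x y z : A) : A :=
  μ .ne (vee μ x y) z - μ .se x (μ .ne y z)
/-- Middle associator `(x ↘ y) ↖ z - x ↘ (y ↖ z)`. -/
def assocM (μ : BilinearOps K QuadOp A) (x y z : A) : A :=
  μ .nw (μ .se x y) z - μ .se x (μ .nw y z)

end Quad

open Quad in
/-- The left-hand sides of the nine defining identities of alternative quadrialgebras. -/
def altQuadRel (μ : BilinearOps K QuadOp A) (i : Fin 9) (x y z : A) : A :=
  match i with
  | 0 => assocR μ x y z + assocM μ y x z
  | 1 => assocR μ x y z + assocR μ x z y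
  | 2 => assocN μ x y z + assocW μ y x z
  | 3 => assocN μ x y z + assocNE μ x z y
  | 4 => assocNE μ x y z + assocE μ y x z
  | 5 => assocW μ x y z + assocSW μ x z y
  | 6 => assocSW μ x y z + assocS μ y x z
  | 7 => assocM μ x y z + assocL μ x z y
  | 8 => assocL μ x y z + assocL μ y x z

/-- `(A, ↗, ↘, ↙, ↖)` is an alternative quadrialgebra. -/
def IsAlternativeQuadrialgebra (μ : BilinearOps K QuadOp A) : Prop :=
  ∀ (i : Fin 9) (x y z : A), altQuadRel μ i x y z = 0

/-- The polynomial `MD1(x, y, z, t)`, with `L a b` for `a ◀ b` and `R a b` for `a ▶ b`. -/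
def md1 (μ : BilinearOps K MDOp A) (x y z t : A) : A :=
  let L := fun a b : A => μ .left a b
  let R := fun a b : A => μ .right a b
  L (L (L x y) z) t - L (L (R y x) z) t - L (R z (L x y)) t + L (R z (R y x)) t
    - L x (R y (R z t)) - L x (L y (R z t)) - L x (R y (L z t)) - L x (L y (L z t))
    + R z (L x (R y t)) + R z (L x (L y t)) + R (R y z) (L x t) + R (L y z) (L x t)
    - R (R z y) (L x t) - R (L z y) (L x t) - R y (L (R z x) t) + R y (L (L x z) t)

/-- The polynomial `MD2(x, y, z, t)`, with `L a b` for `a ◀ b` and `R a b` for `a ▶ b`. -/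
def md2 (μ : BilinearOps K MDOp A) (x y z t : A) : A :=
  let L := fun a b : A => μ .left a b
  let R := fun a b : A => μ .right a b
  L (L (R x y) z) t - L (L (L y x) z) t - L (R z (R x y)) t + L (R z (L y x)) t
    - R x (L y (R z t)) - R x (L y (L z t)) + R z (R x (L y t)) + L (L y z) (R x t)
    + L (L y z) (L x t) - L (R z y) (R x t) - L (R z y) (L x t) - L y (R (R z x) t)
    - L y (L (R z x) t) - L y (R (L z x) t) - L y (L (L z x) t) + L y (R (R x z) t)
    + L y (L (R x z) t) + L y (R (L x z) t) + L y (L (L x z) t)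

/-- The polynomial `MD3(x, y, z, t)`, with `L a b` for `a ◀ b` and `R a b` for `a ▶ b`. -/
def md3 (μ : BilinearOps K MDOp A) (x y z t : A) : A :=
  let L := fun a b : A => μ .left a b
  let R := fun a b : A => μ .right a b
  L (R (R x y) z) t + L (R (L x y) z) t - L (R (R y x) z) t - L (R (L y x) z) t
    - L (L z (R x y)) t - L (L z (L x y)) t + L (L z (R y x)) t + L (L z (L y x)) t
    - R x (R y (L z t)) + L z (R x (R y t)) + L z (L x (R y t)) + L z (R x (L y t))
    + L z (L x (L y t)) + L (R y z) (R x t) + L (R y z) (L x t) - L (L z y) (R x t)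
    - L (L z y) (L x t) - R y (L (L z x) t) + R y (L (R x z) t)

/-- The polynomial `MD4(x, y, z, t)`, with `L a b` for `a ◀ b` and `R a b` for `a ▶ b`. -/
def md4 (μ : BilinearOps K MDOp A) (x y z t : A) : A :=
  let L := fun a b : A => μ .left a b
  let R := fun a b : A => μ .right a b
  R (R (R x y) z) t + R (L (R x y) z) t + R (R (L x y) z) t + R (L (L x y) z) t
    - R (R (R y x) z) t - R (L (R y x) z) t - R (R (L y x) z) t - R (L (L y x) z) t
    - R (R z (R x y)) t - R (L z (R x y)) t - R (R z (L x y)) t - R (L z (L x y)) t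
    + R (R z (R y x)) t + R (L z (R y x)) t + R (R z (L y x)) t + R (L z (L y x)) t
    - R x (R y (R z t)) + R z (R x (R y t)) + R (R y z) (R x t) + R (L y z) (R x t)
    - R (R z y) (R x t) - R (L z y) (R x t) - R y (R (R z x) t) - R y (R (L z x) t)
    + R y (R (R x z) t) + R y (R (L x z) t)

/-- The family `MD1, …, MD4`. -/
def mdRel (μ : BilinearOps K MDOp A) (i : Fin 4) (x y z t : A) : A :=
  match i with
  | 0 => md1 μ x y z t
  | 1 => md2 μ x y z t
  | 2 => md3 μ x y z t
  | 3 => md4 μ x y z t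

/-- `(A, ◀, ▶)` is an M-dendriform algebra. -/
def IsMDendriform (μ : BilinearOps K MDOp A) : Prop :=
  ∀ (i : Fin 4) (x y z t : A), mdRel μ i x y z t = 0

/-- The operations `x ◀ y = x ↗ y - y ↙ x` and `x ▶ y = x ↘ y - y ↖ x`. -/
def quadToMD (μ : BilinearOps K QuadOp A) : BilinearOps K MDOp A
  | .left => μ .ne - (μ .sw).flip
  | .right => μ .se - (μ .nw).flip

end Identities

section FreeAlgebras

/-- Nonassociative monomials in the variables `X` with binary operation symbols `Ω`. -/
inductive OpMonomial (Ω X : Type*)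
  | var (x : X) : OpMonomial Ω X
  | app (ω : Ω) (a b : OpMonomial Ω X) : OpMonomial Ω X

/-- The degree of a monomial: the number of occurrences of variables in it. -/
def OpMonomial.degree {Ω X : Type*} : OpMonomial Ω X → ℕ
  | .var _ => 1
  | .app _ a b => a.degree + b.degree

/-- Value of a monomial in an algebra, given values of the variables. -/
def OpMonomial.eval {K Ω X A : Type*} [Field K] [AddCommGroup A] [Module K A]
    (μ : BilinearOps K Ω A) (v : X → A) : OpMonomial Ω X → A
  | .var x => v x
  | .app ω a b => μ ω (a.eval μ v) (b.eval μ v)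

variable (K Ω X : Type*) [Field K]

/-- The free algebra with the bilinear operations `Ω` on the set `X`: the vector space with
basis the monomials. Its elements are the nonassociative polynomials. -/
abbrev FreeOpAlgebra := OpMonomial Ω X →₀ K

/-- The operations of the free algebra: the bilinear extension of the formal composition
`(a, b) ↦ app ω a b` of monomials. -/
noncomputable def freeOps : BilinearOps K Ω (FreeOpAlgebra K Ω X) := fun ω =>
  Finsupp.linearCombination K fun a => Finsupp.lmapDomain K K (OpMonomial.app ω a)

variable {K Ω X}

/-- Substitution of elements of an algebra for the variables of a polynomial. -/
noncomputable def polyEval {A : Type*} [AddCommGroup A] [Module K A]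
    (μ : BilinearOps K Ω A) (v : X → A) : FreeOpAlgebra K Ω X →ₗ[K] A :=
  Finsupp.linearCombination K (OpMonomial.eval μ v)

/-- `f` is a polynomial identity of the algebra `(A, μ)`. -/
def IsIdentityOf {A : Type*} [AddCommGroup A] [Module K A] (f : FreeOpAlgebra K Ω X)
    (μ : BilinearOps K Ω A) : Prop :=
  ∀ v : X → A, polyEval μ v f = 0

/-- All monomials of `f` have degree `d`. -/
def IsHomogeneousOfDegree (f : FreeOpAlgebra K Ω X) (d : ℕ) : Prop :=
  ∀ m ∈ f.support, m.degree = d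

/-- A two-sided ideal for all operations. -/
def IsOpIdeal {A : Type*} [AddCommGroup A] [Module K A] (μ : BilinearOps K Ω A)
    (I : Submodule K A) : Prop :=
  ∀ ω a b, (a ∈ I ∨ b ∈ I) → μ ω a b ∈ I

/-- The ideal generated by a set: the smallest ideal containing it. -/
def opIdealSpan {A : Type*} [AddCommGroup A] [Module K A] (μ : BilinearOps K Ω A)
    (S : Set A) : Submodule K A :=
  sInf {I | S ⊆ I ∧ IsOpIdeal μ I}

theorem isOpIdeal_opIdealSpan {A : Type*} [AddCommGroup A] [Module K A]
    (μ : BilinearOps K Ω A) (S : Set A) : IsOpIdeal μ (opIdealSpan μ S) := by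
  intro ω a b h
  simp only [opIdealSpan, Submodule.mem_sInf] at h ⊢
  intro I hI
  exact hI.2 ω a b (h.imp (fun h => h I hI) (fun h => h I hI))

/-- The operations induced on the quotient by an ideal. -/
def quotientOps {A : Type*} [AddCommGroup A] [Module K A] (μ : BilinearOps K Ω A)
    (I : Submodule K A) (hI : IsOpIdeal μ I) : BilinearOps K Ω (A ⧸ I) := fun ω =>
  I.liftQ
    (LinearMap.flip (I.liftQ (LinearMap.flip ((μ ω).compr₂ I.mkQ)) (by
      intro b hb
      ext a
      simpa using hI ω a b (Or.inr hb))))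
    (by
      intro a ha
      ext b
      exact (Submodule.Quotient.mk_eq_zero I).2 (hI ω a b (Or.inl ha)))

theorem quotientOps_mk {A : Type*} [AddCommGroup A] [Module K A] (μ : BilinearOps K Ω A)
    (I : Submodule K A) (hI : IsOpIdeal μ I) (ω : Ω) (a b : A) :
    quotientOps μ I hI ω (I.mkQ a) (I.mkQ b) = I.mkQ (μ ω a b) := rfl

variable (K X)

/-- The ideal of the free algebra with four operations generated by all values of the defining
identities of alternative quadrialgebras. -/
noncomputable def altQuadIdeal : Submodule K (FreeOpAlgebra K QuadOp X) :=
  opIdealSpan (freeOps K QuadOp X)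
    {p | ∃ i x y z, p = altQuadRel (freeOps K QuadOp X) i x y z}

/-- The free alternative quadrialgebra on the set `X`. -/
abbrev FreeAltQuad := FreeOpAlgebra K QuadOp X ⧸ altQuadIdeal K X

/-- The four operations of the free alternative quadrialgebra. -/
noncomputable def freeAltQuadOps : BilinearOps K QuadOp (FreeAltQuad K X) :=
  quotientOps (freeOps K QuadOp X) (altQuadIdeal K X) (isOpIdeal_opIdealSpan _ _)

/-- The consequences of `MD1, …, MD4` among the polynomials in two operations: the smallest ideal
that contains all `MDi(x, y, z, t)`, where `x, y, z, t` are arbitrary polynomials. -/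
noncomputable def mdConsequences : Submodule K (FreeOpAlgebra K MDOp X) :=
  opIdealSpan (freeOps K MDOp X)
    {p | ∃ i x y z t, p = mdRel (freeOps K MDOp X) i x y z t}

end FreeAlgebras

/-! A quadrialgebra splits a product by two independent races between its factors. In `↗` and `↘`
the right factor wins the first race, in `↖` and `↙` the left one; in `↘` and `↙` the right factor
wins the second race, in `↗` and `↖` the left one. The nine associators correspond to the nine
choices of a first and a second winner among three arguments. The defining relations say that this
family alternates when the arguments are permuted and carry the winners with them. In `◀` and `▶`
the right factor always wins the first race, and the symbol tells who wins the second.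

The commutator of an alternative algebra satisfies Sagle's (Malcev) identity (yz)(xt) = ((yx)z)t +
((xz)t)y + ((zt)y)x + ((ty)x)z. The polynomial MD_j is this identity split so that t wins the first
race and the j-th variable the second. Hence (1): a derivation of Sagle's identity from
alternativity is split in the same way (`md1_quadToMD` to `md4_quadToMD`).

For (2) and (3), identities are tested in explicit quadrialgebras
(`isAlternativeQuadrialgebra_octonionWeight`). Their basis consists of finite sets of labels.
Disjoint sets multiply to their union, with the sign of a product of octonion units, and the
greatest label for an order `σ` or `τ` decides the first or second race. Let `σ` be the natural
order of four labels. In the value of a monomial, the coefficient at the full set then involves only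
the 15 labelled trees in which every right factor has the greatest label, and `τ` dictates the
operations at their nodes. So for each `τ` an identity gives linear relations between 15 of its
coefficients, one for each choice of octonion units.

Ten such relations force the 15 coefficients to be the pairwise differences of six numbers with sum
zero, a potential (`exists_isPotential`). The six numbers are the multiplicities of the six
instances of Sagle's identity in four letters. A coefficient depends on `τ` only through the winners
at the nodes of its tree. Comparing orders therefore shows that a potential depends only on the
greatest label of `τ` (`potential_family_eq_basePotential`). The four resulting functions are the
coefficients in an expression of f as a combination of MD_1, ..., MD_4 at variables
(`sum_shapes_eq_mdRel`). In degree 3 there are three trees and three independent relations, so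
nothing survives. -/

/-! ### Part (1): the M-dendriform identities in an alternative quadrialgebra. -/

section AlternativeQuadrialgebras

open Quad

variable {K A : Type*} [Field K] [AddCommGroup A] [Module K A]

/-- The six associators whose two winners differ form a cycle under adjacent transpositions of the
arguments. Five of its edges are defining relations. This is the sixth, obtained as their
alternating sum. -/
theorem assocS_add_assocE {μ : BilinearOps K QuadOp A} (h : IsAlternativeQuadrialgebra μ)
    (x y z : A) : assocS μ x y z + assocE μ x z y = 0 := by
  have h6 := h 6 y x z
  have h5 := h 5 y z x
  have h2 := h 2 z y x
  have h3 := h 3 z y x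
  have h4 := h 4 z x y
  simp only [altQuadRel] at h2 h3 h4 h5 h6
  linear_combination (norm := module) h6 - h5 + h2 - h3 + h4

-- The combination is a derivation of Sagle's identity for alternative algebras, split so that t
-- wins the first race and x the second. A relation inside a product with t becomes a sum over all
-- first winners among its three arguments, hence the groups of three equal coefficients. The proofs
-- for MD_2, MD_3 and MD_4 have the same sequence of coefficients, apart from the sizes of such
-- groups.
set_option maxHeartbeats 0 in
theorem md1_quadToMD {μ : BilinearOps K QuadOp A} (h : IsAlternativeQuadrialgebra μ)
    (x y z t : A) : md1 (quadToMD μ) x y z t = 0 := by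
  have hs := assocS_add_assocE h
  linear_combination (norm := skip) (3 : ℤ) • h 2 x (prec μ t y) z +
    (4 : ℤ) • (congrArg ((μ .ne).flip t) (h 0 x z y)) +
    (4 : ℤ) • (congrArg ((μ .ne).flip t) (h 2 x z y)) +
    (4 : ℤ) • (congrArg ((μ .ne).flip t) (h 4 x z y)) +
    (-3 : ℤ) • (congrArg ((μ .ne).flip t) (h 5 z x y)) +
    (-3 : ℤ) • (congrArg ((μ .ne).flip t) (h 7 z x y)) +
    (-3 : ℤ) • (congrArg ((μ .ne).flip t) (hs z y x)) +
    (1 : ℤ) • (congrArg ((μ .ne).flip t) (h 1 x y z)) +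
    (1 : ℤ) • (congrArg ((μ .ne).flip t) (h 3 x y z)) +
    (1 : ℤ) • (congrArg ((μ .ne).flip t) (h 3 x z y)) +
    (4 : ℤ) • (congrArg ((μ .sw).flip x) (h 2 y t z)) +
    (4 : ℤ) • (congrArg ((μ .sw).flip x) (h 0 t y z)) +
    (4 : ℤ) • (congrArg ((μ .sw).flip x) (h 6 t y z)) + (-4 : ℤ) • h 5 (prec μ t y) x z +
    (2 : ℤ) • h 8 y z (μ .ne x t) + (-2 : ℤ) • (congrArg (μ .se y) (hs z t x)) +
    (1 : ℤ) • (congrArg (μ .se y) (h 6 t z x)) + (-2 : ℤ) • (congrArg (μ .se z) (hs y t x)) +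
    (-2 : ℤ) • hs z t (vee μ y x) + (1 : ℤ) • h 4 x z (prec μ t y) +
    (-1 : ℤ) • (congrArg ((μ .ne).flip t) (h 5 y x z)) +
    (-1 : ℤ) • (congrArg ((μ .ne).flip t) (h 7 y x z)) +
    (-1 : ℤ) • (congrArg ((μ .ne).flip t) (hs y z x)) +
    (-1 : ℤ) • (congrArg (μ .ne x) (h 2 z t y)) + (-1 : ℤ) • (congrArg (μ .ne x) (h 0 t z y)) +
    (-1 : ℤ) • (congrArg (μ .ne x) (h 6 t z y)) + (2 : ℤ) • h 5 t x (Quad.star μ y z) +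
    (-1 : ℤ) • h 2 x t (Quad.star μ y z) + (1 : ℤ) • (congrArg (μ .ne x) (h 2 y t z)) +
    (1 : ℤ) • (congrArg (μ .ne x) (h 0 t y z)) + (1 : ℤ) • (congrArg (μ .ne x) (h 6 t y z)) +
    (3 : ℤ) • h 4 x (Quad.star μ z y) t + (-2 : ℤ) • (congrArg (μ .ne x) (h 3 y t z)) +
    (-2 : ℤ) • (congrArg (μ .ne x) (hs y t z)) + (-2 : ℤ) • (congrArg (μ .ne x) (h 7 y t z)) +
    (3 : ℤ) • (congrArg (μ .ne x) (h 4 y z t)) + (3 : ℤ) • (congrArg (μ .ne x) (h 4 z y t)) +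
    (3 : ℤ) • (congrArg (μ .ne x) (h 8 y z t)) + (-3 : ℤ) • (congrArg (μ .sw t) (h 0 x y z)) +
    (-3 : ℤ) • (congrArg (μ .sw t) (h 2 x y z)) + (-3 : ℤ) • (congrArg (μ .sw t) (h 4 x y z)) +
    (2 : ℤ) • (congrArg (μ .sw t) (h 1 x y z)) + (2 : ℤ) • (congrArg (μ .sw t) (h 3 x y z)) +
    (2 : ℤ) • (congrArg (μ .sw t) (h 3 x z y)) + (-1 : ℤ) • (congrArg (μ .sw t) (h 0 x z y)) +
    (-1 : ℤ) • (congrArg (μ .sw t) (h 2 x z y)) + (-1 : ℤ) • (congrArg (μ .sw t) (h 4 x z y)) +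
    (-2 : ℤ) • h 5 t (vee μ z x) y + (-4 : ℤ) • h 3 x (succ μ y t) z +
    (-3 : ℤ) • h 3 (wedge μ x z) t y + (4 : ℤ) • (congrArg (μ .sw t) (h 5 y x z)) +
    (4 : ℤ) • (congrArg (μ .sw t) (h 7 y x z)) + (4 : ℤ) • (congrArg (μ .sw t) (hs y z x)) +
    (-2 : ℤ) • h 6 t y (vee μ z x) + (-1 : ℤ) • h 5 t (wedge μ x z) y +
    (2 : ℤ) • h 2 (wedge μ x z) t y + (-1 : ℤ) • h 4 (vee μ z x) y t +
    (3 : ℤ) • h 2 x (succ μ y t) z + (-2 : ℤ) • h 5 (succ μ y t) x z +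
    (-1 : ℤ) • h 4 x z (succ μ y t) + (1 : ℤ) • h 2 (vee μ z x) t y +
    (1 : ℤ) • (congrArg (μ .se z) (h 6 t y x)) + (-1 : ℤ) • h 2 x t (Quad.star μ z y) +
    (-2 : ℤ) • h 3 x (prec μ t y) z + (2 : ℤ) • h 6 t (Quad.star μ y z) x +
    (-2 : ℤ) • (congrArg ((μ .sw).flip x) (h 3 y t z)) +
    (-2 : ℤ) • (congrArg ((μ .sw).flip x) (hs y t z)) +
    (-2 : ℤ) • (congrArg ((μ .sw).flip x) (h 7 y t z)) +
    (2 : ℤ) • (congrArg (μ .ne x) (h 3 z t y)) + (2 : ℤ) • (congrArg (μ .ne x) (hs z t y)) +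
    (2 : ℤ) • (congrArg (μ .ne x) (h 7 z t y)) + (-2 : ℤ) • h 4 (wedge μ x z) y t +
    (-1 : ℤ) • h 6 (succ μ z t) y x + (1 : ℤ) • h 8 y z (μ .sw t x) +
    (2 : ℤ) • h 3 x t (Quad.star μ z y) + (1 : ℤ) • h 4 x (Quad.star μ y z) t +
    (1 : ℤ) • h 6 t z (vee μ y x) + (1 : ℤ) • h 6 (prec μ t z) y x +
    (1 : ℤ) • hs y t (wedge μ x z)
  simp only [md1, quadToMD, altQuadRel, assocR, assocL, assocNE, assocSW, assocN, assocW,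
    assocS, assocE, assocM, succ, prec, vee, wedge, Quad.star, map_add, map_sub, map_zero,
    LinearMap.add_apply, LinearMap.sub_apply, LinearMap.flip_apply]
  abel

set_option maxHeartbeats 0 in
theorem md2_quadToMD {μ : BilinearOps K QuadOp A} (h : IsAlternativeQuadrialgebra μ)
    (x y z t : A) : md2 (quadToMD μ) x y z t = 0 := by
  have hs := assocS_add_assocE h
  linear_combination (norm := skip) (3 : ℤ) • h 0 (μ .sw t y) x z +
    (4 : ℤ) • (congrArg ((μ .ne).flip t) (h 6 x z y)) +
    (4 : ℤ) • (congrArg ((μ .ne).flip t) (h 6 z x y)) +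
    (4 : ℤ) • (congrArg ((μ .ne).flip t) (h 8 x z y)) +
    (-3 : ℤ) • (congrArg ((μ .ne).flip t) (h 5 z y x)) +
    (-3 : ℤ) • (congrArg ((μ .ne).flip t) (hs z x y)) +
    (-3 : ℤ) • (congrArg ((μ .ne).flip t) (h 7 z y x)) +
    (1 : ℤ) • (congrArg ((μ .ne).flip t) (h 5 x y z)) +
    (1 : ℤ) • (congrArg ((μ .ne).flip t) (h 7 x y z)) +
    (1 : ℤ) • (congrArg ((μ .ne).flip t) (hs x z y)) +
    (4 : ℤ) • (congrArg ((μ .nw).flip x) (h 2 y t z)) + (-4 : ℤ) • h 1 (μ .sw t y) x z +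
    (2 : ℤ) • h 4 y z (succ μ x t) + (-2 : ℤ) • (congrArg (μ .ne y) (h 3 z t x)) +
    (-2 : ℤ) • (congrArg (μ .ne y) (hs z t x)) + (-2 : ℤ) • (congrArg (μ .ne y) (h 7 z t x)) +
    (1 : ℤ) • (congrArg (μ .ne y) (h 2 z t x)) + (1 : ℤ) • (congrArg (μ .ne y) (h 0 t z x)) +
    (1 : ℤ) • (congrArg (μ .ne y) (h 6 t z x)) + (-2 : ℤ) • (congrArg (μ .se z) (h 3 y t x)) +
    (-2 : ℤ) • hs z t (wedge μ y x) + (1 : ℤ) • h 8 x z (μ .sw t y) +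
    (-1 : ℤ) • (congrArg ((μ .ne).flip t) (h 1 y x z)) +
    (-1 : ℤ) • (congrArg ((μ .ne).flip t) (h 3 y x z)) +
    (-1 : ℤ) • (congrArg ((μ .ne).flip t) (h 3 y z x)) +
    (-1 : ℤ) • (congrArg (μ .se x) (h 6 t z y)) + (2 : ℤ) • h 5 t (wedge μ y z) x +
    (-1 : ℤ) • h 6 t x (wedge μ y z) + (1 : ℤ) • (congrArg (μ .se x) (h 2 y t z)) +
    (3 : ℤ) • h 4 (vee μ z y) x t + (-2 : ℤ) • (congrArg (μ .se x) (h 3 y t z)) +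
    (3 : ℤ) • (congrArg (μ .se x) (h 4 y z t)) + (-3 : ℤ) • (congrArg (μ .sw t) (h 2 y x z)) +
    (-3 : ℤ) • (congrArg (μ .sw t) (h 0 y x z)) + (-3 : ℤ) • (congrArg (μ .sw t) (h 4 y x z)) +
    (2 : ℤ) • (congrArg (μ .sw t) (h 5 x y z)) + (2 : ℤ) • (congrArg (μ .sw t) (h 7 x y z)) +
    (2 : ℤ) • (congrArg (μ .sw t) (hs x z y)) + (-1 : ℤ) • (congrArg (μ .sw t) (h 6 x z y)) +
    (-1 : ℤ) • (congrArg (μ .sw t) (h 6 z x y)) + (-1 : ℤ) • (congrArg (μ .sw t) (h 8 x z y)) +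
    (-2 : ℤ) • h 5 t y (Quad.star μ z x) + (-4 : ℤ) • h 7 x (μ .ne y t) z +
    (-3 : ℤ) • hs (Quad.star μ x z) t y + (4 : ℤ) • (congrArg (μ .sw t) (h 1 y x z)) +
    (4 : ℤ) • (congrArg (μ .sw t) (h 3 y x z)) + (4 : ℤ) • (congrArg (μ .sw t) (h 3 y z x)) +
    (-2 : ℤ) • h 2 y t (Quad.star μ z x) + (-1 : ℤ) • h 5 t y (Quad.star μ x z) +
    (2 : ℤ) • h 6 t (Quad.star μ x z) y + (-1 : ℤ) • h 4 y (Quad.star μ z x) t +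
    (3 : ℤ) • h 0 (μ .ne y t) x z + (-2 : ℤ) • h 1 (μ .ne y t) x z +
    (-1 : ℤ) • h 8 x z (μ .ne y t) + (1 : ℤ) • h 6 t (Quad.star μ z x) y +
    (1 : ℤ) • (congrArg (μ .se z) (h 2 y t x)) + (-1 : ℤ) • h 6 t x (vee μ z y) +
    (-2 : ℤ) • h 7 x (μ .sw t y) z + (2 : ℤ) • h 2 (wedge μ y z) t x +
    (-2 : ℤ) • (congrArg ((μ .nw).flip x) (h 3 y t z)) + (2 : ℤ) • (congrArg (μ .se x) (hs z t y))
    + (-2 : ℤ) • h 4 y (Quad.star μ x z) t + (-1 : ℤ) • h 2 y (succ μ z t) x +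
    (1 : ℤ) • h 4 y z (prec μ t x) + (2 : ℤ) • hs x t (vee μ z y) +
    (1 : ℤ) • h 4 (wedge μ y z) x t + (1 : ℤ) • h 6 t z (wedge μ y x) +
    (1 : ℤ) • h 2 y (prec μ t z) x + (1 : ℤ) • h 3 y t (Quad.star μ x z)
  simp only [md2, quadToMD, altQuadRel, assocR, assocL, assocNE, assocSW, assocN, assocW,
    assocS, assocE, assocM, succ, prec, vee, wedge, Quad.star, map_add, map_sub, map_zero,
    LinearMap.add_apply, LinearMap.sub_apply, LinearMap.flip_apply]
  abel

set_option maxHeartbeats 0 in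
theorem md3_quadToMD {μ : BilinearOps K QuadOp A} (h : IsAlternativeQuadrialgebra μ)
    (x y z t : A) : md3 (quadToMD μ) x y z t = 0 := by
  have hs := assocS_add_assocE h
  linear_combination (norm := skip) (3 : ℤ) • h 6 (prec μ t y) x z +
    (4 : ℤ) • (congrArg ((μ .ne).flip t) (h 2 z x y)) +
    (4 : ℤ) • (congrArg ((μ .ne).flip t) (h 0 z x y)) +
    (4 : ℤ) • (congrArg ((μ .ne).flip t) (h 4 z x y)) +
    (-3 : ℤ) • (congrArg ((μ .ne).flip t) (h 1 z x y)) +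
    (-3 : ℤ) • (congrArg ((μ .ne).flip t) (h 3 z x y)) +
    (-3 : ℤ) • (congrArg ((μ .ne).flip t) (h 3 z y x)) +
    (1 : ℤ) • (congrArg ((μ .ne).flip t) (h 5 x z y)) +
    (1 : ℤ) • (congrArg ((μ .ne).flip t) (hs x y z)) +
    (1 : ℤ) • (congrArg ((μ .ne).flip t) (h 7 x z y)) +
    (4 : ℤ) • (congrArg ((μ .nw).flip x) (h 6 t y z)) + (-4 : ℤ) • h 5 (prec μ t y) z x +
    (2 : ℤ) • h 4 z y (succ μ x t) + (-2 : ℤ) • (congrArg (μ .se y) (h 3 z t x)) +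
    (1 : ℤ) • (congrArg (μ .se y) (h 2 z t x)) + (-2 : ℤ) • (congrArg (μ .ne z) (h 3 y t x)) +
    (-2 : ℤ) • (congrArg (μ .ne z) (hs y t x)) + (-2 : ℤ) • (congrArg (μ .ne z) (h 7 y t x)) +
    (-2 : ℤ) • h 3 z t (Quad.star μ y x) + (1 : ℤ) • h 4 z x (prec μ t y) +
    (-1 : ℤ) • (congrArg ((μ .ne).flip t) (h 5 y z x)) +
    (-1 : ℤ) • (congrArg ((μ .ne).flip t) (hs y x z)) +
    (-1 : ℤ) • (congrArg ((μ .ne).flip t) (h 7 y z x)) +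
    (-1 : ℤ) • (congrArg (μ .se x) (h 2 z t y)) + (2 : ℤ) • h 5 t (vee μ y z) x +
    (-1 : ℤ) • h 6 t x (vee μ y z) + (1 : ℤ) • (congrArg (μ .se x) (h 6 t y z)) +
    (3 : ℤ) • h 4 (wedge μ z y) x t + (-2 : ℤ) • (congrArg (μ .se x) (hs y t z)) +
    (3 : ℤ) • (congrArg (μ .se x) (h 4 z y t)) + (-3 : ℤ) • (congrArg (μ .sw t) (h 6 x y z)) +
    (-3 : ℤ) • (congrArg (μ .sw t) (h 6 y x z)) + (-3 : ℤ) • (congrArg (μ .sw t) (h 8 x y z)) +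
    (2 : ℤ) • (congrArg (μ .sw t) (h 5 x z y)) + (2 : ℤ) • (congrArg (μ .sw t) (hs x y z)) +
    (2 : ℤ) • (congrArg (μ .sw t) (h 7 x z y)) + (-1 : ℤ) • (congrArg (μ .sw t) (h 2 z x y)) +
    (-1 : ℤ) • (congrArg (μ .sw t) (h 0 z x y)) + (-1 : ℤ) • (congrArg (μ .sw t) (h 4 z x y)) +
    (-2 : ℤ) • h 5 t (wedge μ z x) y + (-4 : ℤ) • hs x (succ μ y t) z +
    (-3 : ℤ) • h 3 (vee μ x z) t y + (4 : ℤ) • (congrArg (μ .sw t) (h 5 y z x)) +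
    (4 : ℤ) • (congrArg (μ .sw t) (hs y x z)) + (4 : ℤ) • (congrArg (μ .sw t) (h 7 y z x)) +
    (-2 : ℤ) • h 6 t y (wedge μ z x) + (-1 : ℤ) • h 5 t (vee μ x z) y +
    (2 : ℤ) • h 2 (vee μ x z) t y + (-1 : ℤ) • h 4 (wedge μ z x) y t +
    (3 : ℤ) • h 6 (succ μ y t) x z + (-2 : ℤ) • h 5 (succ μ y t) z x +
    (-1 : ℤ) • h 4 z x (succ μ y t) + (1 : ℤ) • h 2 (wedge μ z x) t y +
    (1 : ℤ) • (congrArg (μ .ne z) (h 2 y t x)) + (1 : ℤ) • (congrArg (μ .ne z) (h 0 t y x)) +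
    (1 : ℤ) • (congrArg (μ .ne z) (h 6 t y x)) + (-1 : ℤ) • h 6 t x (wedge μ z y) +
    (-2 : ℤ) • hs x (prec μ t y) z + (2 : ℤ) • h 2 (vee μ y z) t x +
    (-2 : ℤ) • (congrArg ((μ .nw).flip x) (hs y t z)) + (2 : ℤ) • (congrArg (μ .se x) (h 3 z t y))
    + (-2 : ℤ) • h 4 (vee μ x z) y t + (-1 : ℤ) • h 0 (μ .ne z t) y x +
    (1 : ℤ) • h 4 z y (prec μ t x) + (2 : ℤ) • hs x t (wedge μ z y) +
    (1 : ℤ) • h 4 (vee μ y z) x t + (1 : ℤ) • h 2 z t (Quad.star μ y x) +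
    (1 : ℤ) • h 0 (μ .sw t z) y x + (1 : ℤ) • hs y t (vee μ x z)
  simp only [md3, quadToMD, altQuadRel, assocR, assocL, assocNE, assocSW, assocN, assocW,
    assocS, assocE, assocM, succ, prec, vee, wedge, Quad.star, map_add, map_sub, map_zero,
    LinearMap.add_apply, LinearMap.sub_apply, LinearMap.flip_apply]
  abel

-- Here t wins both races. A relation between x, y, z inside a product with t is therefore summed
-- over both winners, which gives groups of nine.
set_option maxHeartbeats 0 in
theorem md4_quadToMD {μ : BilinearOps K QuadOp A} (h : IsAlternativeQuadrialgebra μ)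
    (x y z t : A) : md4 (quadToMD μ) x y z t = 0 := by
  have hs := assocS_add_assocE h
  linear_combination (norm := skip) (3 : ℤ) • h 0 (μ .nw t y) x z +
    (4 : ℤ) • (congrArg ((μ .se).flip t) (h 0 x z y)) +
    (4 : ℤ) • (congrArg ((μ .se).flip t) (h 2 z x y)) +
    (4 : ℤ) • (congrArg ((μ .se).flip t) (h 6 x z y)) +
    (4 : ℤ) • (congrArg ((μ .se).flip t) (h 2 x z y)) +
    (4 : ℤ) • (congrArg ((μ .se).flip t) (h 0 z x y)) +
    (4 : ℤ) • (congrArg ((μ .se).flip t) (h 6 z x y)) +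
    (4 : ℤ) • (congrArg ((μ .se).flip t) (h 4 x z y)) +
    (4 : ℤ) • (congrArg ((μ .se).flip t) (h 4 z x y)) +
    (4 : ℤ) • (congrArg ((μ .se).flip t) (h 8 x z y)) +
    (-3 : ℤ) • (congrArg ((μ .se).flip t) (h 1 z x y)) +
    (-3 : ℤ) • (congrArg ((μ .se).flip t) (h 5 z x y)) +
    (-3 : ℤ) • (congrArg ((μ .se).flip t) (h 5 z y x)) +
    (-3 : ℤ) • (congrArg ((μ .se).flip t) (h 3 z x y)) +
    (-3 : ℤ) • (congrArg ((μ .se).flip t) (h 7 z x y)) +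
    (-3 : ℤ) • (congrArg ((μ .se).flip t) (hs z x y)) +
    (-3 : ℤ) • (congrArg ((μ .se).flip t) (h 3 z y x)) +
    (-3 : ℤ) • (congrArg ((μ .se).flip t) (hs z y x)) +
    (-3 : ℤ) • (congrArg ((μ .se).flip t) (h 7 z y x)) +
    (1 : ℤ) • (congrArg ((μ .se).flip t) (h 1 x y z)) +
    (1 : ℤ) • (congrArg ((μ .se).flip t) (h 5 x y z)) +
    (1 : ℤ) • (congrArg ((μ .se).flip t) (h 5 x z y)) +
    (1 : ℤ) • (congrArg ((μ .se).flip t) (h 3 x y z)) +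
    (1 : ℤ) • (congrArg ((μ .se).flip t) (h 7 x y z)) +
    (1 : ℤ) • (congrArg ((μ .se).flip t) (hs x y z)) +
    (1 : ℤ) • (congrArg ((μ .se).flip t) (h 3 x z y)) +
    (1 : ℤ) • (congrArg ((μ .se).flip t) (hs x z y)) +
    (1 : ℤ) • (congrArg ((μ .se).flip t) (h 7 x z y)) +
    (4 : ℤ) • (congrArg ((μ .nw).flip x) (h 0 t y z)) + (-4 : ℤ) • h 1 (μ .nw t y) x z +
    (2 : ℤ) • h 8 y z (μ .se x t) + (-2 : ℤ) • (congrArg (μ .se y) (h 7 z t x)) +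
    (1 : ℤ) • (congrArg (μ .se y) (h 0 t z x)) + (-2 : ℤ) • (congrArg (μ .se z) (h 7 y t x)) +
    (-2 : ℤ) • h 7 z t (Quad.star μ y x) + (1 : ℤ) • h 8 x z (μ .nw t y) +
    (-1 : ℤ) • (congrArg ((μ .se).flip t) (h 1 y x z)) +
    (-1 : ℤ) • (congrArg ((μ .se).flip t) (h 5 y x z)) +
    (-1 : ℤ) • (congrArg ((μ .se).flip t) (h 5 y z x)) +
    (-1 : ℤ) • (congrArg ((μ .se).flip t) (h 3 y x z)) +
    (-1 : ℤ) • (congrArg ((μ .se).flip t) (h 7 y x z)) +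
    (-1 : ℤ) • (congrArg ((μ .se).flip t) (hs y x z)) +
    (-1 : ℤ) • (congrArg ((μ .se).flip t) (h 3 y z x)) +
    (-1 : ℤ) • (congrArg ((μ .se).flip t) (hs y z x)) +
    (-1 : ℤ) • (congrArg ((μ .se).flip t) (h 7 y z x)) +
    (-1 : ℤ) • (congrArg (μ .se x) (h 0 t z y)) + (2 : ℤ) • h 1 t x (Quad.star μ y z) +
    (-1 : ℤ) • h 0 t x (Quad.star μ y z) + (1 : ℤ) • (congrArg (μ .se x) (h 0 t y z)) +
    (3 : ℤ) • h 8 x (Quad.star μ z y) t + (-2 : ℤ) • (congrArg (μ .se x) (h 7 y t z)) +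
    (3 : ℤ) • (congrArg (μ .se x) (h 8 y z t)) + (-3 : ℤ) • (congrArg (μ .nw t) (h 0 x y z)) +
    (-3 : ℤ) • (congrArg (μ .nw t) (h 2 y x z)) + (-3 : ℤ) • (congrArg (μ .nw t) (h 6 x y z)) +
    (-3 : ℤ) • (congrArg (μ .nw t) (h 2 x y z)) + (-3 : ℤ) • (congrArg (μ .nw t) (h 0 y x z)) +
    (-3 : ℤ) • (congrArg (μ .nw t) (h 6 y x z)) + (-3 : ℤ) • (congrArg (μ .nw t) (h 4 x y z)) +
    (-3 : ℤ) • (congrArg (μ .nw t) (h 4 y x z)) + (-3 : ℤ) • (congrArg (μ .nw t) (h 8 x y z)) +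
    (2 : ℤ) • (congrArg (μ .nw t) (h 1 x y z)) + (2 : ℤ) • (congrArg (μ .nw t) (h 5 x y z)) +
    (2 : ℤ) • (congrArg (μ .nw t) (h 5 x z y)) + (2 : ℤ) • (congrArg (μ .nw t) (h 3 x y z)) +
    (2 : ℤ) • (congrArg (μ .nw t) (h 7 x y z)) + (2 : ℤ) • (congrArg (μ .nw t) (hs x y z)) +
    (2 : ℤ) • (congrArg (μ .nw t) (h 3 x z y)) + (2 : ℤ) • (congrArg (μ .nw t) (hs x z y)) +
    (2 : ℤ) • (congrArg (μ .nw t) (h 7 x z y)) + (-1 : ℤ) • (congrArg (μ .nw t) (h 0 x z y)) +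
    (-1 : ℤ) • (congrArg (μ .nw t) (h 2 z x y)) + (-1 : ℤ) • (congrArg (μ .nw t) (h 6 x z y)) +
    (-1 : ℤ) • (congrArg (μ .nw t) (h 2 x z y)) + (-1 : ℤ) • (congrArg (μ .nw t) (h 0 z x y)) +
    (-1 : ℤ) • (congrArg (μ .nw t) (h 6 z x y)) + (-1 : ℤ) • (congrArg (μ .nw t) (h 4 x z y)) +
    (-1 : ℤ) • (congrArg (μ .nw t) (h 4 z x y)) + (-1 : ℤ) • (congrArg (μ .nw t) (h 8 x z y)) +
    (-2 : ℤ) • h 1 t y (Quad.star μ z x) + (-4 : ℤ) • h 7 x (μ .se y t) z +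
    (-3 : ℤ) • h 7 (Quad.star μ x z) t y + (4 : ℤ) • (congrArg (μ .nw t) (h 1 y x z)) +
    (4 : ℤ) • (congrArg (μ .nw t) (h 5 y x z)) + (4 : ℤ) • (congrArg (μ .nw t) (h 5 y z x)) +
    (4 : ℤ) • (congrArg (μ .nw t) (h 3 y x z)) + (4 : ℤ) • (congrArg (μ .nw t) (h 7 y x z)) +
    (4 : ℤ) • (congrArg (μ .nw t) (hs y x z)) + (4 : ℤ) • (congrArg (μ .nw t) (h 3 y z x)) +
    (4 : ℤ) • (congrArg (μ .nw t) (hs y z x)) + (4 : ℤ) • (congrArg (μ .nw t) (h 7 y z x)) +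
    (-2 : ℤ) • h 0 t y (Quad.star μ z x) + (-1 : ℤ) • h 1 t (Quad.star μ x z) y +
    (2 : ℤ) • h 0 t (Quad.star μ x z) y + (-1 : ℤ) • h 8 y (Quad.star μ z x) t +
    (3 : ℤ) • h 0 (μ .se y t) x z + (-2 : ℤ) • h 1 (μ .se y t) x z +
    (-1 : ℤ) • h 8 x z (μ .se y t) + (1 : ℤ) • h 0 t (Quad.star μ z x) y +
    (1 : ℤ) • (congrArg (μ .se z) (h 0 t y x)) + (-1 : ℤ) • h 0 t x (Quad.star μ z y) +
    (-2 : ℤ) • h 7 x (μ .nw t y) z + (2 : ℤ) • h 0 t (Quad.star μ y z) x +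
    (-2 : ℤ) • (congrArg ((μ .nw).flip x) (h 7 y t z)) +
    (2 : ℤ) • (congrArg (μ .se x) (h 7 z t y)) + (-2 : ℤ) • h 8 (Quad.star μ x z) y t +
    (-1 : ℤ) • h 0 (μ .se z t) y x + (1 : ℤ) • h 8 y z (μ .nw t x) +
    (2 : ℤ) • h 7 x t (Quad.star μ z y) + (1 : ℤ) • h 8 x (Quad.star μ y z) t +
    (1 : ℤ) • h 0 t z (Quad.star μ y x) + (1 : ℤ) • h 0 (μ .nw t z) y x +
    (1 : ℤ) • h 7 y t (Quad.star μ x z)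
  simp only [md4, quadToMD, altQuadRel, assocR, assocL, assocNE, assocSW, assocN, assocW,
    assocS, assocE, assocM, succ, prec, vee, wedge, Quad.star, map_add, map_sub, map_zero,
    LinearMap.add_apply, LinearMap.sub_apply, LinearMap.flip_apply]
  abel

theorem IsAlternativeQuadrialgebra.isMDendriform_quadToMD {μ : BilinearOps K QuadOp A}
    (h : IsAlternativeQuadrialgebra μ) : IsMDendriform (quadToMD μ)
  | 0 => md1_quadToMD h
  | 1 => md2_quadToMD h
  | 2 => md3_quadToMD h
  | 3 => md4_quadToMD h

end AlternativeQuadrialgebras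

/-! ### Algebras with basis the finite subsets of a set. -/

section SetAlgebra

variable {K Ω ι : Type*} [Field K] [DecidableEq ι]

/-- The algebra with basis the finite subsets of `ι`, in which the product of the basis elements
`R` and `T` is the multiple `γ ω R T` of `R ∪ T`. -/
noncomputable def setOps (γ : Ω → Finset ι → Finset ι → K) : BilinearOps K Ω (Finset ι →₀ K) :=
  fun ω => Finsupp.linearCombination K fun R =>
    Finsupp.linearCombination K fun T => Finsupp.single (R ∪ T) (γ ω R T)

theorem setOps_single (γ : Ω → Finset ι → Finset ι → K) (ω : Ω) (R T : Finset ι) (a b : K) :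
    setOps γ ω (Finsupp.single R a) (Finsupp.single T b) =
      Finsupp.single (R ∪ T) (a * b * γ ω R T) := by
  simp only [setOps, Finsupp.linearCombination_single, LinearMap.smul_apply, Finsupp.smul_single,
    smul_eq_mul, mul_assoc]

/-- If only disjoint sets have a nonzero product, then a product contributing to S is a splitting of
S, which is determined by its left part R. -/
theorem setOps_apply {γ : Ω → Finset ι → Finset ι → K}
    (hγ : ∀ ω R T, ¬ Disjoint R T → γ ω R T = 0) (ω : Ω) (a b : Finset ι →₀ K) (S : Finset ι) :
    setOps γ ω a b S = ∑ R ∈ S.powerset, γ ω R (S \ R) * (a R * b (S \ R)) := by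
  induction a using Finsupp.induction_linear with
  | zero => simp
  | add a a' ha ha' =>
    simp only [map_add, LinearMap.add_apply, Finsupp.add_apply, ha, ha', ← Finset.sum_add_distrib]
    exact Finset.sum_congr rfl fun R _ => by ring
  | single R r =>
    induction b using Finsupp.induction_linear with
    | zero => simp
    | add b b' hb hb' =>
      simp only [map_add, Finsupp.add_apply, hb, hb', ← Finset.sum_add_distrib]
      exact Finset.sum_congr rfl fun R _ => by ring
    | single T t =>
      rw [setOps_single]
      by_cases hd : Disjoint R T
      · by_cases hS : R ∪ T = S
        · subst hS
          have hT : (R ∪ T) \ R = T := by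
            rw [Finset.union_sdiff_left, sdiff_eq_left.2 hd.symm]
          rw [Finset.sum_eq_single R]
          · simp [hT]
            ring
          · intro R' _ hR'
            simp [Finsupp.single_apply, hR'.symm]
          · intro h
            exact absurd (Finset.mem_powerset.2 Finset.subset_union_left) h
        · rw [Finsupp.single_apply, if_neg hS, Finset.sum_eq_zero]
          intro R' hR'
          by_cases h1 : R = R'
          · subst h1
            have : T ≠ S \ R := by
              rintro rfl
              exact hS (Finset.union_sdiff_of_subset (Finset.mem_powerset.1 hR'))
            simp [this]
          · simp [Finsupp.single_apply, h1]
      · rw [hγ _ _ _ hd, mul_zero, Finsupp.single_zero, Finsupp.zero_apply, Finset.sum_eq_zero]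
        intro R' _
        by_cases h1 : R = R'
        · subst h1
          have : T ≠ S \ R := by
            rintro rfl
            exact hd Finset.disjoint_sdiff
          simp [this]
        · simp [Finsupp.single_apply, h1]

end SetAlgebra

/-! ### Reduction of the defining relations to basis elements. -/

section Bases

open Quad

variable {K A : Type*} [Field K] [AddCommGroup A] [Module K A]

theorem altQuadRel_add_left (μ : BilinearOps K QuadOp A) (i : Fin 9) (x x' y z : A) :
    altQuadRel μ i (x + x') y z = altQuadRel μ i x y z + altQuadRel μ i x' y z := by
  fin_cases i <;>
    simp only [altQuadRel, assocR, assocL, assocNE, assocSW, assocN, assocW, assocS, assocE,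
      assocM, succ, prec, vee, wedge, Quad.star, map_add, LinearMap.add_apply] <;> abel

theorem altQuadRel_add_middle (μ : BilinearOps K QuadOp A) (i : Fin 9) (x y y' z : A) :
    altQuadRel μ i x (y + y') z = altQuadRel μ i x y z + altQuadRel μ i x y' z := by
  fin_cases i <;>
    simp only [altQuadRel, assocR, assocL, assocNE, assocSW, assocN, assocW, assocS, assocE,
      assocM, succ, prec, vee, wedge, Quad.star, map_add, LinearMap.add_apply] <;> abel

theorem altQuadRel_add_right (μ : BilinearOps K QuadOp A) (i : Fin 9) (x y z z' : A) :
    altQuadRel μ i x y (z + z') = altQuadRel μ i x y z + altQuadRel μ i x y z' := by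
  fin_cases i <;>
    simp only [altQuadRel, assocR, assocL, assocNE, assocSW, assocN, assocW, assocS, assocE,
      assocM, succ, prec, vee, wedge, Quad.star, map_add, LinearMap.add_apply] <;> abel

theorem IsAlternativeQuadrialgebra.of_single {I : Type*} {μ : BilinearOps K QuadOp (I →₀ K)}
    (h : ∀ i R T U (a b c : K),
      altQuadRel μ i (Finsupp.single R a) (Finsupp.single T b) (Finsupp.single U c) = 0) :
    IsAlternativeQuadrialgebra μ := by
  have zero (g : (I →₀ K) → (I →₀ K)) (hg : ∀ x y, g (x + y) = g x + g y) : g 0 = 0 := by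
    simpa using hg 0 0
  intro i x y z
  induction x using Finsupp.induction_linear with
  | zero => exact zero (altQuadRel μ i · y z) (altQuadRel_add_left μ i · · y z)
  | add x x' hx hx' => rw [altQuadRel_add_left, hx, hx', add_zero]
  | single R a =>
    induction y using Finsupp.induction_linear with
    | zero =>
      exact zero (altQuadRel μ i (.single R a) · z) (altQuadRel_add_middle μ i (.single R a) · · z)
    | add y y' hy hy' => rw [altQuadRel_add_middle, hy, hy', add_zero]
    | single T b =>
      induction z using Finsupp.induction_linear with
      | zero =>
        exact zero (altQuadRel μ i (.single R a) (.single T b) ·)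
          (altQuadRel_add_right μ i (.single R a) (.single T b) · ·)
      | add z z' hz hz' => rw [altQuadRel_add_right, hz, hz', add_zero]
      | single U c => exact h i R T U a b c

end Bases

/-! ### Indicators of the outcome of a race. -/

section Races

variable {K : Type*} [Field K]

/-- The indicator of `0 < a < b`. -/
def beats (K : Type*) [Field K] (b a : ℕ) : K := if 0 < a ∧ a < b then 1 else 0

/-- The indicator of `0 < b < a` and `0 < c < a`. -/
def beatsBoth (K : Type*) [Field K] (a b c : ℕ) : K :=
  if (0 < b ∧ b < a) ∧ (0 < c ∧ c < a) then 1 else 0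

theorem beatsBoth_comm (a b c : ℕ) : beatsBoth K a b c = beatsBoth K a c b := by
  simp only [beatsBoth, and_comm]

theorem beats_mul_beats_max_left (a b c : ℕ) :
    beats K a b * beats K (max a b) c = beatsBoth K a b c := by
  unfold beats beatsBoth
  split_ifs <;> first | (exfalso; omega) | simp

theorem beats_mul_beats_max_middle (a b c : ℕ) :
    beats K b a * beats K (max a b) c = beatsBoth K b a c := by
  unfold beats beatsBoth
  split_ifs <;> first | (exfalso; omega) | simp

theorem beats_max_mul_beats_middle (a b c : ℕ) :
    beats K (max b c) a * beats K b c = beatsBoth K b a c := by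
  unfold beats beatsBoth
  split_ifs <;> first | (exfalso; omega) | simp

theorem beats_max_mul_beats_right (a b c : ℕ) :
    beats K (max b c) a * beats K c b = beatsBoth K c a b := by
  unfold beats beatsBoth
  split_ifs <;> first | (exfalso; omega) | simp

/-- If c beats the maximum of a and b, the outcome between a and b should not matter. A tie of
positive heights would be lost from the sum on the left; the hypothesis excludes it. -/
theorem beats_add_beats_mul_beats_max {a b : ℕ} (h : a = b → a = 0) (c : ℕ) :
    (beats K a b + beats K b a) * beats K c (max a b) = beatsBoth K c a b := by
  unfold beats beatsBoth
  split_ifs <;> first | (exfalso; omega) | simp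

end Races

/-! ### A quadrialgebra from two orders and an alternating associator. -/

section SetQuadrialgebra

open Quad

variable {K ι : Type*} [Field K] [DecidableEq ι]

/-- One more than the maximum of `τ` on `R`, and `0` if `R` is empty. -/
def height (τ : ι → ℕ) (R : Finset ι) : ℕ := R.sup fun i => τ i + 1

theorem height_union (τ : ι → ℕ) (R T : Finset ι) :
    height τ (R ∪ T) = max (height τ R) (height τ T) :=
  Finset.sup_union

-- Disjoint nonempty sets cannot share their greatest value of an injective function, so the only
-- tie is between empty sets. The shift by one in `height` separates the empty set from a set with
-- maximum 0.
omit [DecidableEq ι] in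
theorem height_eq_zero_of_eq {τ : ι → ℕ} (hτ : Function.Injective τ) {R T : Finset ι}
    (hd : Disjoint R T) (h : height τ R = height τ T) : height τ R = 0 := by
  rcases R.eq_empty_or_nonempty with rfl | hR
  · rfl
  rcases T.eq_empty_or_nonempty with rfl | hT
  · exact h
  obtain ⟨i, hi, hi'⟩ := Finset.exists_mem_eq_sup R hR fun i => τ i + 1
  obtain ⟨j, hj, hj'⟩ := Finset.exists_mem_eq_sup T hT fun i => τ i + 1
  have hij : i = j := hτ (by unfold height at h; omega)
  exact absurd (hij ▸ hj) (Finset.disjoint_left.1 hd hi)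

/-- The structure constants of a quadrialgebra with basis the finite subsets of `ι`. The first
arrow component of an operation tells which factor has the greater height for `σ`, the second one
which factor has the greater height for `τ`. -/
def quadWeight (σ τ : ι → ℕ) (ε : Finset ι → Finset ι → K) (ω : QuadOp) (R T : Finset ι) : K :=
  if Disjoint R T then
    (match ω with
      | .ne => beats K (height σ T) (height σ R) * beats K (height τ R) (height τ T)
      | .se => beats K (height σ T) (height σ R) * beats K (height τ T) (height τ R)
      | .sw => beats K (height σ R) (height σ T) * beats K (height τ T) (height τ R)
      | .nw => beats K (height σ R) (height σ T) * beats K (height τ R) (height τ T)) * ε R T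
  else 0

/-- The associator of the structure constants `ε`. -/
def weightAssociator (ε : Finset ι → Finset ι → K) (R T U : Finset ι) : K :=
  ε R T * ε (R ∪ T) U - ε T U * ε R (T ∪ U)

variable {σ τ : ι → ℕ} {ε : Finset ι → Finset ι → K}

/-- Both terms of an associator factor into a race for `σ`, a race for `τ` and a product of two
values of `ε`. In both terms the races say that the same argument beats the other two. The sums `*`,
`≻`, `≺`, `∨`, `∧` occur where the outcome between two losers is left open. So the associator of `ε`
factors out. The other eight associators work alike, with the winners (for `σ`, `τ`) at positions M
(2,2), L (3,3), NE (3,1), SW (1,3), N (2,1), W (1,2), S (2,3), E (3,2). -/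
theorem assocR_setOps_single (hσ : Function.Injective σ) (hτ : Function.Injective τ)
    {R T U : Finset ι} (hRT : Disjoint R T) (hRU : Disjoint R U) (hTU : Disjoint T U) (a b c : K) :
    assocR (setOps (quadWeight σ τ ε)) (.single R a) (.single T b) (.single U c) =
      .single (R ∪ T ∪ U) (a * b * c * (beatsBoth K (height σ R) (height σ T) (height σ U) *
        beatsBoth K (height τ R) (height τ T) (height τ U) * weightAssociator ε R T U)) := by
  have l₁ := beats_mul_beats_max_left (K := K) (height σ R) (height σ T) (height σ U)
  have r₁ := beats_add_beats_mul_beats_max (K := K) (height_eq_zero_of_eq hσ hTU) (height σ R)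
  have l₂ := beats_mul_beats_max_left (K := K) (height τ R) (height τ T) (height τ U)
  have r₂ := beats_add_beats_mul_beats_max (K := K) (height_eq_zero_of_eq hτ hTU) (height τ R)
  simp only [assocR, Quad.star, setOps_single, ← Finsupp.single_add, ← Finsupp.single_sub,
    ← Finset.union_assoc]
  congr 1
  simp only [quadWeight, hRT, hTU, Finset.disjoint_union_left, Finset.disjoint_union_right, hRU,
    and_self, if_true, height_union, weightAssociator]
  linear_combination (exp := 1) a * b * c * (ε R T * ε (R ∪ T) U * ((beats K (height τ R) (height
    τ T) * beats K (max (height τ R) (height τ T)) (height τ U)) * l₁ + beatsBoth K (height σ R)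
    (height σ T) (height σ U) * l₂) -
    ε T U * ε R (T ∪ U) * (((beats K (height τ T) (height τ U) + beats K (height τ U) (height τ
      T)) * beats K (height τ R) (max (height τ T) (height τ U))) * r₁ + beatsBoth K (height σ
      R) (height σ T) (height σ U) * r₂))

theorem assocM_setOps_single
    {R T U : Finset ι} (hRT : Disjoint R T) (hRU : Disjoint R U) (hTU : Disjoint T U) (a b c : K) :
    assocM (setOps (quadWeight σ τ ε)) (.single R a) (.single T b) (.single U c) =
      .single (R ∪ T ∪ U) (a * b * c * (beatsBoth K (height σ T) (height σ R) (height σ U) *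
        beatsBoth K (height τ T) (height τ R) (height τ U) * weightAssociator ε R T U)) := by
  have l₁ := beats_mul_beats_max_middle (K := K) (height σ R) (height σ T) (height σ U)
  have r₁ := beats_max_mul_beats_middle (K := K) (height σ R) (height σ T) (height σ U)
  have l₂ := beats_mul_beats_max_middle (K := K) (height τ R) (height τ T) (height τ U)
  have r₂ := beats_max_mul_beats_middle (K := K) (height τ R) (height τ T) (height τ U)
  simp only [assocM, setOps_single, ← Finsupp.single_sub,
    ← Finset.union_assoc]
  congr 1
  simp only [quadWeight, hRT, hTU, Finset.disjoint_union_left, Finset.disjoint_union_right, hRU,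
    and_self, if_true, height_union, weightAssociator]
  linear_combination (exp := 1) a * b * c * (ε R T * ε (R ∪ T) U * ((beats K (height τ T) (height
    τ R) * beats K (max (height τ R) (height τ T)) (height τ U)) * l₁ + beatsBoth K (height σ T)
    (height σ R) (height σ U) * l₂) -
    ε T U * ε R (T ∪ U) * ((beats K (max (height τ T) (height τ U)) (height τ R) * beats K
      (height τ T) (height τ U)) * r₁ + beatsBoth K (height σ T) (height σ R) (height σ U) *
      r₂))

theorem assocL_setOps_single (hσ : Function.Injective σ) (hτ : Function.Injective τ)
    {R T U : Finset ι} (hRT : Disjoint R T) (hRU : Disjoint R U) (hTU : Disjoint T U) (a b c : K) :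
    assocL (setOps (quadWeight σ τ ε)) (.single R a) (.single T b) (.single U c) =
      .single (R ∪ T ∪ U) (a * b * c * (beatsBoth K (height σ U) (height σ R) (height σ T) *
        beatsBoth K (height τ U) (height τ R) (height τ T) * weightAssociator ε R T U)) := by
  have l₁ := beats_add_beats_mul_beats_max (K := K) (height_eq_zero_of_eq hσ hRT) (height σ U)
  have r₁ := beats_max_mul_beats_right (K := K) (height σ R) (height σ T) (height σ U)
  have l₂ := beats_add_beats_mul_beats_max (K := K) (height_eq_zero_of_eq hτ hRT) (height τ U)
  have r₂ := beats_max_mul_beats_right (K := K) (height τ R) (height τ T) (height τ U)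
  simp only [assocL, Quad.star, setOps_single, ← Finsupp.single_add, ← Finsupp.single_sub,
    ← Finset.union_assoc]
  congr 1
  simp only [quadWeight, hRT, hTU, Finset.disjoint_union_left, Finset.disjoint_union_right, hRU,
    and_self, if_true, height_union, weightAssociator]
  linear_combination (exp := 1) a * b * c * (ε R T * ε (R ∪ T) U * (((beats K (height τ R) (height
    τ T) + beats K (height τ T) (height τ R)) * beats K (height τ U) (max (height τ R) (height τ
    T))) * l₁ + beatsBoth K (height σ U) (height σ R) (height σ T) * l₂) -
    ε T U * ε R (T ∪ U) * ((beats K (max (height τ T) (height τ U)) (height τ R) * beats K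
      (height τ U) (height τ T)) * r₁ + beatsBoth K (height σ U) (height σ R) (height σ T) *
      r₂))

theorem assocNE_setOps_single (hσ : Function.Injective σ) (hτ : Function.Injective τ)
    {R T U : Finset ι} (hRT : Disjoint R T) (hRU : Disjoint R U) (hTU : Disjoint T U) (a b c : K) :
    assocNE (setOps (quadWeight σ τ ε)) (.single R a) (.single T b) (.single U c) =
      .single (R ∪ T ∪ U) (a * b * c * (beatsBoth K (height σ U) (height σ R) (height σ T) *
        beatsBoth K (height τ R) (height τ T) (height τ U) * weightAssociator ε R T U)) := by
  have l₁ := beats_add_beats_mul_beats_max (K := K) (height_eq_zero_of_eq hσ hRT) (height σ U)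
  have r₁ := beats_max_mul_beats_right (K := K) (height σ R) (height σ T) (height σ U)
  have l₂ := beats_mul_beats_max_left (K := K) (height τ R) (height τ T) (height τ U)
  have r₂ := beats_add_beats_mul_beats_max (K := K) (height_eq_zero_of_eq hτ hTU) (height τ R)
  simp only [assocNE, succ, wedge, setOps_single, ← Finsupp.single_add, ← Finsupp.single_sub,
    ← Finset.union_assoc]
  congr 1
  simp only [quadWeight, hRT, hTU, Finset.disjoint_union_left, Finset.disjoint_union_right, hRU,
    and_self, if_true, height_union, weightAssociator]
  linear_combination (exp := 1) a * b * c * (ε R T * ε (R ∪ T) U * ((beats K (height τ R) (height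
    τ T) * beats K (max (height τ R) (height τ T)) (height τ U)) * l₁ + beatsBoth K (height σ U)
    (height σ R) (height σ T) * l₂) -
    ε T U * ε R (T ∪ U) * (((beats K (height τ T) (height τ U) + beats K (height τ U) (height τ
      T)) * beats K (height τ R) (max (height τ T) (height τ U))) * r₁ + beatsBoth K (height σ
      U) (height σ R) (height σ T) * r₂))

theorem assocSW_setOps_single (hσ : Function.Injective σ) (hτ : Function.Injective τ)
    {R T U : Finset ι} (hRT : Disjoint R T) (hRU : Disjoint R U) (hTU : Disjoint T U) (a b c : K) :
    assocSW (setOps (quadWeight σ τ ε)) (.single R a) (.single T b) (.single U c) =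
      .single (R ∪ T ∪ U) (a * b * c * (beatsBoth K (height σ R) (height σ T) (height σ U) *
        beatsBoth K (height τ U) (height τ R) (height τ T) * weightAssociator ε R T U)) := by
  have l₁ := beats_mul_beats_max_left (K := K) (height σ R) (height σ T) (height σ U)
  have r₁ := beats_add_beats_mul_beats_max (K := K) (height_eq_zero_of_eq hσ hTU) (height σ R)
  have l₂ := beats_add_beats_mul_beats_max (K := K) (height_eq_zero_of_eq hτ hRT) (height τ U)
  have r₂ := beats_max_mul_beats_right (K := K) (height τ R) (height τ T) (height τ U)
  simp only [assocSW, prec, vee, setOps_single, ← Finsupp.single_add, ← Finsupp.single_sub,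
    ← Finset.union_assoc]
  congr 1
  simp only [quadWeight, hRT, hTU, Finset.disjoint_union_left, Finset.disjoint_union_right, hRU,
    and_self, if_true, height_union, weightAssociator]
  linear_combination (exp := 1) a * b * c * (ε R T * ε (R ∪ T) U * (((beats K (height τ R) (height
    τ T) + beats K (height τ T) (height τ R)) * beats K (height τ U) (max (height τ R) (height τ
    T))) * l₁ + beatsBoth K (height σ R) (height σ T) (height σ U) * l₂) -
    ε T U * ε R (T ∪ U) * ((beats K (max (height τ T) (height τ U)) (height τ R) * beats K
      (height τ U) (height τ T)) * r₁ + beatsBoth K (height σ R) (height σ T) (height σ U) *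
      r₂))

theorem assocN_setOps_single (hτ : Function.Injective τ)
    {R T U : Finset ι} (hRT : Disjoint R T) (hRU : Disjoint R U) (hTU : Disjoint T U) (a b c : K) :
    assocN (setOps (quadWeight σ τ ε)) (.single R a) (.single T b) (.single U c) =
      .single (R ∪ T ∪ U) (a * b * c * (beatsBoth K (height σ T) (height σ R) (height σ U) *
        beatsBoth K (height τ R) (height τ T) (height τ U) * weightAssociator ε R T U)) := by
  have l₁ := beats_mul_beats_max_middle (K := K) (height σ R) (height σ T) (height σ U)
  have r₁ := beats_max_mul_beats_middle (K := K) (height σ R) (height σ T) (height σ U)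
  have l₂ := beats_mul_beats_max_left (K := K) (height τ R) (height τ T) (height τ U)
  have r₂ := beats_add_beats_mul_beats_max (K := K) (height_eq_zero_of_eq hτ hTU) (height τ R)
  simp only [assocN, prec, setOps_single, ← Finsupp.single_add, ← Finsupp.single_sub,
    ← Finset.union_assoc]
  congr 1
  simp only [quadWeight, hRT, hTU, Finset.disjoint_union_left, Finset.disjoint_union_right, hRU,
    and_self, if_true, height_union, weightAssociator]
  linear_combination (exp := 1) a * b * c * (ε R T * ε (R ∪ T) U * ((beats K (height τ R) (height
    τ T) * beats K (max (height τ R) (height τ T)) (height τ U)) * l₁ + beatsBoth K (height σ T)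
    (height σ R) (height σ U) * l₂) -
    ε T U * ε R (T ∪ U) * (((beats K (height τ T) (height τ U) + beats K (height τ U) (height τ
      T)) * beats K (height τ R) (max (height τ T) (height τ U))) * r₁ + beatsBoth K (height σ
      T) (height σ R) (height σ U) * r₂))

theorem assocW_setOps_single (hσ : Function.Injective σ)
    {R T U : Finset ι} (hRT : Disjoint R T) (hRU : Disjoint R U) (hTU : Disjoint T U) (a b c : K) :
    assocW (setOps (quadWeight σ τ ε)) (.single R a) (.single T b) (.single U c) =
      .single (R ∪ T ∪ U) (a * b * c * (beatsBoth K (height σ R) (height σ T) (height σ U) *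
        beatsBoth K (height τ T) (height τ R) (height τ U) * weightAssociator ε R T U)) := by
  have l₁ := beats_mul_beats_max_left (K := K) (height σ R) (height σ T) (height σ U)
  have r₁ := beats_add_beats_mul_beats_max (K := K) (height_eq_zero_of_eq hσ hTU) (height σ R)
  have l₂ := beats_mul_beats_max_middle (K := K) (height τ R) (height τ T) (height τ U)
  have r₂ := beats_max_mul_beats_middle (K := K) (height τ R) (height τ T) (height τ U)
  simp only [assocW, wedge, setOps_single, ← Finsupp.single_add, ← Finsupp.single_sub,
    ← Finset.union_assoc]
  congr 1
  simp only [quadWeight, hRT, hTU, Finset.disjoint_union_left, Finset.disjoint_union_right, hRU,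
    and_self, if_true, height_union, weightAssociator]
  linear_combination (exp := 1) a * b * c * (ε R T * ε (R ∪ T) U * ((beats K (height τ T) (height
    τ R) * beats K (max (height τ R) (height τ T)) (height τ U)) * l₁ + beatsBoth K (height σ R)
    (height σ T) (height σ U) * l₂) -
    ε T U * ε R (T ∪ U) * ((beats K (max (height τ T) (height τ U)) (height τ R) * beats K
      (height τ T) (height τ U)) * r₁ + beatsBoth K (height σ R) (height σ T) (height σ U) *
      r₂))

theorem assocS_setOps_single (hτ : Function.Injective τ)
    {R T U : Finset ι} (hRT : Disjoint R T) (hRU : Disjoint R U) (hTU : Disjoint T U) (a b c : K) :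
    assocS (setOps (quadWeight σ τ ε)) (.single R a) (.single T b) (.single U c) =
      .single (R ∪ T ∪ U) (a * b * c * (beatsBoth K (height σ T) (height σ R) (height σ U) *
        beatsBoth K (height τ U) (height τ R) (height τ T) * weightAssociator ε R T U)) := by
  have l₁ := beats_mul_beats_max_middle (K := K) (height σ R) (height σ T) (height σ U)
  have r₁ := beats_max_mul_beats_middle (K := K) (height σ R) (height σ T) (height σ U)
  have l₂ := beats_add_beats_mul_beats_max (K := K) (height_eq_zero_of_eq hτ hRT) (height τ U)
  have r₂ := beats_max_mul_beats_right (K := K) (height τ R) (height τ T) (height τ U)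
  simp only [assocS, succ, setOps_single, ← Finsupp.single_add, ← Finsupp.single_sub,
    ← Finset.union_assoc]
  congr 1
  simp only [quadWeight, hRT, hTU, Finset.disjoint_union_left, Finset.disjoint_union_right, hRU,
    and_self, if_true, height_union, weightAssociator]
  linear_combination (exp := 1) a * b * c * (ε R T * ε (R ∪ T) U * (((beats K (height τ R) (height
    τ T) + beats K (height τ T) (height τ R)) * beats K (height τ U) (max (height τ R) (height τ
    T))) * l₁ + beatsBoth K (height σ T) (height σ R) (height σ U) * l₂) -
    ε T U * ε R (T ∪ U) * ((beats K (max (height τ T) (height τ U)) (height τ R) * beats K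
      (height τ U) (height τ T)) * r₁ + beatsBoth K (height σ T) (height σ R) (height σ U) *
      r₂))

theorem assocE_setOps_single (hσ : Function.Injective σ)
    {R T U : Finset ι} (hRT : Disjoint R T) (hRU : Disjoint R U) (hTU : Disjoint T U) (a b c : K) :
    assocE (setOps (quadWeight σ τ ε)) (.single R a) (.single T b) (.single U c) =
      .single (R ∪ T ∪ U) (a * b * c * (beatsBoth K (height σ U) (height σ R) (height σ T) *
        beatsBoth K (height τ T) (height τ R) (height τ U) * weightAssociator ε R T U)) := by
  have l₁ := beats_add_beats_mul_beats_max (K := K) (height_eq_zero_of_eq hσ hRT) (height σ U)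
  have r₁ := beats_max_mul_beats_right (K := K) (height σ R) (height σ T) (height σ U)
  have l₂ := beats_mul_beats_max_middle (K := K) (height τ R) (height τ T) (height τ U)
  have r₂ := beats_max_mul_beats_middle (K := K) (height τ R) (height τ T) (height τ U)
  simp only [assocE, vee, setOps_single, ← Finsupp.single_add, ← Finsupp.single_sub,
    ← Finset.union_assoc]
  congr 1
  simp only [quadWeight, hRT, hTU, Finset.disjoint_union_left, Finset.disjoint_union_right, hRU,
    and_self, if_true, height_union, weightAssociator]
  linear_combination (exp := 1) a * b * c * (ε R T * ε (R ∪ T) U * ((beats K (height τ T) (height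
    τ R) * beats K (max (height τ R) (height τ T)) (height τ U)) * l₁ + beatsBoth K (height σ U)
    (height σ R) (height σ T) * l₂) -
    ε T U * ε R (T ∪ U) * ((beats K (max (height τ T) (height τ U)) (height τ R) * beats K
      (height τ T) (height τ U)) * r₁ + beatsBoth K (height σ U) (height σ R) (height σ T) *
      r₂))

theorem quadWeight_of_not_disjoint {ω : QuadOp} {R T : Finset ι} (h : ¬ Disjoint R T) :
    quadWeight σ τ ε ω R T = 0 :=
  if_neg h

/-- In each defining relation the second associator is the first with two adjacent arguments
exchanged and with the same sets as winners. The indicators of the races are then a common factor,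
and what remains is alternativity of the associator of `ε`. -/
theorem isAlternativeQuadrialgebra_setOps (hσ : Function.Injective σ) (hτ : Function.Injective τ)
    (hl : ∀ R T U, Disjoint R T → Disjoint R U → Disjoint T U →
      weightAssociator ε R T U + weightAssociator ε T R U = 0)
    (hr : ∀ R T U, Disjoint R T → Disjoint R U → Disjoint T U →
      weightAssociator ε R T U + weightAssociator ε R U T = 0) :
    IsAlternativeQuadrialgebra (setOps (quadWeight σ τ ε)) := by
  refine IsAlternativeQuadrialgebra.of_single fun i R T U a b c => ?_
  by_cases hd : Disjoint R T ∧ Disjoint R U ∧ Disjoint T U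
  · obtain ⟨hRT, hRU, hTU⟩ := hd
    have hl := hl R T U hRT hRU hTU
    have hr := hr R T U hRT hRU hTU
    fin_cases i
    · have e₁ := assocR_setOps_single hσ hτ (ε := ε) hRT hRU hTU a b c
      have e₂ := assocM_setOps_single  (ε := ε) (σ := σ) (τ := τ) hRT.symm hTU hRU b a c
      simp only [altQuadRel]
      rw [e₁, e₂, Finset.union_comm T R, ← Finsupp.single_add, Finsupp.single_eq_zero]
      linear_combination (exp := 1) a * b * c *
        (beatsBoth K (height σ R) (height σ T) (height σ U) * beatsBoth K (height τ R)
          (height τ T) (height τ U)) * hl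
    · have e₁ := assocR_setOps_single hσ hτ (ε := ε) hRT hRU hTU a b c
      have e₂ := assocR_setOps_single hσ hτ (ε := ε) hRU hRT hTU.symm a c b
      simp only [altQuadRel]
      rw [e₁, e₂, Finset.union_right_comm R U T, ← Finsupp.single_add, Finsupp.single_eq_zero,
        beatsBoth_comm (height σ R) (height σ U),
        beatsBoth_comm (height τ R) (height τ U)]
      linear_combination (exp := 1) a * b * c *
        (beatsBoth K (height σ R) (height σ T) (height σ U) * beatsBoth K (height τ R)
          (height τ T) (height τ U)) * hr
    · have e₁ := assocN_setOps_single hτ (ε := ε) (σ := σ) hRT hRU hTU a b c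
      have e₂ := assocW_setOps_single hσ (ε := ε) (τ := τ) hRT.symm hTU hRU b a c
      simp only [altQuadRel]
      rw [e₁, e₂, Finset.union_comm T R, ← Finsupp.single_add, Finsupp.single_eq_zero]
      linear_combination (exp := 1) a * b * c *
        (beatsBoth K (height σ T) (height σ R) (height σ U) * beatsBoth K (height τ R)
          (height τ T) (height τ U)) * hl
    · have e₁ := assocN_setOps_single hτ (ε := ε) (σ := σ) hRT hRU hTU a b c
      have e₂ := assocNE_setOps_single hσ hτ (ε := ε) hRU hRT hTU.symm a c b
      simp only [altQuadRel]
      rw [e₁, e₂, Finset.union_right_comm R U T, ← Finsupp.single_add, Finsupp.single_eq_zero,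
        beatsBoth_comm (height τ R) (height τ U)]
      linear_combination (exp := 1) a * b * c *
        (beatsBoth K (height σ T) (height σ R) (height σ U) * beatsBoth K (height τ R)
          (height τ T) (height τ U)) * hr
    · have e₁ := assocNE_setOps_single hσ hτ (ε := ε) hRT hRU hTU a b c
      have e₂ := assocE_setOps_single hσ (ε := ε) (τ := τ) hRT.symm hTU hRU b a c
      simp only [altQuadRel]
      rw [e₁, e₂, Finset.union_comm T R, ← Finsupp.single_add, Finsupp.single_eq_zero,
        beatsBoth_comm (height σ U) (height σ T)]
      linear_combination (exp := 1) a * b * c *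
        (beatsBoth K (height σ U) (height σ R) (height σ T) * beatsBoth K (height τ R)
          (height τ T) (height τ U)) * hl
    · have e₁ := assocW_setOps_single hσ (ε := ε) (τ := τ) hRT hRU hTU a b c
      have e₂ := assocSW_setOps_single hσ hτ (ε := ε) hRU hRT hTU.symm a c b
      simp only [altQuadRel]
      rw [e₁, e₂, Finset.union_right_comm R U T, ← Finsupp.single_add, Finsupp.single_eq_zero,
        beatsBoth_comm (height σ R) (height σ U)]
      linear_combination (exp := 1) a * b * c *
        (beatsBoth K (height σ R) (height σ T) (height σ U) * beatsBoth K (height τ T)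
          (height τ R) (height τ U)) * hr
    · have e₁ := assocSW_setOps_single hσ hτ (ε := ε) hRT hRU hTU a b c
      have e₂ := assocS_setOps_single hτ (ε := ε) (σ := σ) hRT.symm hTU hRU b a c
      simp only [altQuadRel]
      rw [e₁, e₂, Finset.union_comm T R, ← Finsupp.single_add, Finsupp.single_eq_zero,
        beatsBoth_comm (height τ U) (height τ T)]
      linear_combination (exp := 1) a * b * c *
        (beatsBoth K (height σ R) (height σ T) (height σ U) * beatsBoth K (height τ U)
          (height τ R) (height τ T)) * hl
    · have e₁ := assocM_setOps_single  (ε := ε) (σ := σ) (τ := τ) hRT hRU hTU a b c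
      have e₂ := assocL_setOps_single hσ hτ (ε := ε) hRU hRT hTU.symm a c b
      simp only [altQuadRel]
      rw [e₁, e₂, Finset.union_right_comm R U T, ← Finsupp.single_add, Finsupp.single_eq_zero]
      linear_combination (exp := 1) a * b * c *
        (beatsBoth K (height σ T) (height σ R) (height σ U) * beatsBoth K (height τ T)
          (height τ R) (height τ U)) * hr
    · have e₁ := assocL_setOps_single hσ hτ (ε := ε) hRT hRU hTU a b c
      have e₂ := assocL_setOps_single hσ hτ (ε := ε) hRT.symm hTU hRU b a c
      simp only [altQuadRel]
      rw [e₁, e₂, Finset.union_comm T R, ← Finsupp.single_add, Finsupp.single_eq_zero,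
        beatsBoth_comm (height σ U) (height σ T),
        beatsBoth_comm (height τ U) (height τ T)]
      linear_combination (exp := 1) a * b * c *
        (beatsBoth K (height σ U) (height σ R) (height σ T) * beatsBoth K (height τ U)
          (height τ R) (height τ T)) * hl
  -- If two of the three sets meet, then every product of the three vanishes, however it is
  -- bracketed.
  · have left (R T U : Finset ι) (a b c : K)
        (h : ¬ (Disjoint R T ∧ Disjoint R U ∧ Disjoint T U)) (ω ω' : QuadOp) :
        setOps (quadWeight σ τ ε) ω (setOps (quadWeight σ τ ε) ω' (.single R a) (.single T b))
          (.single U c) = 0 := by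
      rw [setOps_single, setOps_single, Finsupp.single_eq_zero]
      by_cases h' : Disjoint R T
      · rw [quadWeight_of_not_disjoint (R := R ∪ T), mul_zero]
        rw [Finset.disjoint_union_left]
        tauto
      · rw [quadWeight_of_not_disjoint h']
        ring
    have right (R T U : Finset ι) (a b c : K)
        (h : ¬ (Disjoint R T ∧ Disjoint R U ∧ Disjoint T U)) (ω ω' : QuadOp) :
        setOps (quadWeight σ τ ε) ω (.single R a)
          (setOps (quadWeight σ τ ε) ω' (.single T b) (.single U c)) = 0 := by
      rw [setOps_single, setOps_single, Finsupp.single_eq_zero]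
      by_cases h' : Disjoint T U
      · rw [quadWeight_of_not_disjoint (T := T ∪ U), mul_zero]
        rw [Finset.disjoint_union_right]
        tauto
      · rw [quadWeight_of_not_disjoint h']
        ring
    have hd' : ¬ (Disjoint T R ∧ Disjoint T U ∧ Disjoint R U) := by
      rw [disjoint_comm (a := T) (b := R)]
      tauto
    have hd'' : ¬ (Disjoint R U ∧ Disjoint R T ∧ Disjoint U T) := by
      rw [disjoint_comm (a := U) (b := T)]
      tauto
    fin_cases i <;>
      simp only [altQuadRel, assocR, assocL, assocNE, assocSW, assocN, assocW, assocS, assocE,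
        assocM, succ, prec, vee, wedge, Quad.star, map_add, LinearMap.add_apply,
        left R T U a b c hd, right R T U a b c hd, left T R U b a c hd', right T R U b a c hd',
        left R U T a c b hd'', right R U T a c b hd'', add_zero, sub_zero]

end SetQuadrialgebra

/-! ### Octonion signs. -/

section Octonions

/-- The cocycle that twists the group algebra of `(ℤ/2)³` into the octonions. -/
def octonionSign (a b : ZMod 2 × ZMod 2 × ZMod 2) : ℤ :=
  if a.1 * (b.1 + b.2.1 + b.2.2) + a.2.1 * (b.2.1 + b.2.2) + a.2.2 * b.2.2 +
    b.1 * a.2.1 * a.2.2 + a.1 * b.2.1 * a.2.2 + a.1 * a.2.1 * b.2.2 = 0 then 1 else -1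

/-- Linearized alternativity of the octonions on basis elements, a check of 512 cases. -/
theorem octonionSign_left_alternative (a b c : ZMod 2 × ZMod 2 × ZMod 2) :
    octonionSign a b * octonionSign (a + b) c - octonionSign b c * octonionSign a (b + c) +
      (octonionSign b a * octonionSign (b + a) c - octonionSign a c * octonionSign b (a + c)) =
        0 := by
  revert a b c
  decide +kernel

theorem octonionSign_right_alternative (a b c : ZMod 2 × ZMod 2 × ZMod 2) :
    octonionSign a b * octonionSign (a + b) c - octonionSign b c * octonionSign a (b + c) +
      (octonionSign a c * octonionSign (a + c) b - octonionSign c b * octonionSign a (c + b)) =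
        0 := by
  revert a b c
  decide +kernel

variable {ι : Type*} (K : Type*) [Field K]

/-- The octonion sign of the product of two monomials in octonion units `e i`. -/
def octonionWeight (e : ι → ZMod 2 × ZMod 2 × ZMod 2) (R T : Finset ι) : K :=
  (octonionSign (∑ i ∈ R, e i) (∑ i ∈ T, e i) : ℤ)

/-- The octonion sign of the commutator of two monomials in octonion units `e i`. -/
def octonionBracket (e : ι → ZMod 2 × ZMod 2 × ZMod 2) (R T : Finset ι) : ℤ :=
  octonionSign (∑ i ∈ R, e i) (∑ i ∈ T, e i) - octonionSign (∑ i ∈ T, e i) (∑ i ∈ R, e i)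

variable {K}

theorem isAlternativeQuadrialgebra_octonionWeight [DecidableEq ι] {σ τ : ι → ℕ}
    (hσ : Function.Injective σ) (hτ : Function.Injective τ)
    (e : ι → ZMod 2 × ZMod 2 × ZMod 2) :
    IsAlternativeQuadrialgebra (setOps (quadWeight σ τ (octonionWeight K e))) := by
  refine isAlternativeQuadrialgebra_setOps hσ hτ ?_ ?_
  · intro R T U hRT hRU hTU
    simp only [weightAssociator, octonionWeight, Finset.sum_union, hRT, hRT.symm, hRU, hTU]
    exact_mod_cast congrArg (Int.cast : ℤ → K) (octonionSign_left_alternative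
      (∑ i ∈ R, e i) (∑ i ∈ T, e i) (∑ i ∈ U, e i))
  · intro R T U hRT hRU hTU
    simp only [weightAssociator, octonionWeight, Finset.sum_union, hRT, hTU.symm, hRU, hTU]
    exact_mod_cast congrArg (Int.cast : ℤ → K) (octonionSign_right_alternative
      (∑ i ∈ R, e i) (∑ i ∈ T, e i) (∑ i ∈ U, e i))

end Octonions

/-! ### The operations `◀` and `▶` of the model. -/

section Commutators

variable {K ι : Type*} [Field K] [DecidableEq ι] {σ τ : ι → ℕ}

/-- The operation of `MDOp` singled out by the factor of greater height. -/
def winnerOp (τ : ι → ℕ) (R T : Finset ι) : MDOp :=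
  if height τ R < height τ T then .right else .left

/-- The indicator of a proposition. -/
noncomputable def indicator (K : Type*) [Field K] (P : Prop) : K :=
  open Classical in if P then 1 else 0

theorem indicator_and (P Q : Prop) : indicator K (P ∧ Q) = indicator K P * indicator K Q := by
  by_cases hP : P <;> by_cases hQ : Q <;> simp [indicator, hP, hQ]

theorem indicator_false : indicator K False = 0 := by simp [indicator]

/-- The structure constants of the commutator operations of `quadWeight`. -/
noncomputable def commutatorWeight (σ τ : ι → ℕ) (e : ι → ZMod 2 × ZMod 2 × ZMod 2) (ω : MDOp) (R T
  : Finset ι) : K :=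
  indicator K (Disjoint R T ∧ R.Nonempty ∧ height σ R < height σ T ∧ ω = winnerOp τ R T) *
    (octonionBracket e R T : ℤ)

omit [DecidableEq ι] in
theorem height_pos {R : Finset ι} (h : R.Nonempty) : 0 < height τ R := by
  obtain ⟨i, hi⟩ := h
  exact (Nat.succ_pos (τ i)).trans_le (Finset.le_sup (f := fun i => τ i + 1) hi)

omit [DecidableEq ι] in
theorem beats_height (R T : Finset ι) :
    beats K (height τ T) (height τ R) = indicator K (R.Nonempty ∧ height τ R < height τ T) := by
  rcases R.eq_empty_or_nonempty with rfl | hR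
  · simp [beats, indicator, height]
  · simp [beats, indicator, hR, height_pos hR]

omit [DecidableEq ι] in
theorem nonempty_of_height_lt {R T : Finset ι} (h : height τ R < height τ T) : T.Nonempty := by
  by_contra hT
  rw [Finset.not_nonempty_iff_eq_empty.1 hT] at h
  exact Nat.not_lt_zero _ h

/-- The two terms of `◀` or `▶` have the same outcome of both races: the right factor wins for `σ`,
and the winner for `τ` is the one named by the operation. Only the signs differ, and their
difference is the octonion commutator. Injectivity of `τ` is needed because `winnerOp` assigns ties
to `left`. -/
theorem quadToMD_setOps (hτ : Function.Injective τ) (e : ι → ZMod 2 × ZMod 2 × ZMod 2) :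
    quadToMD (setOps (quadWeight σ τ (octonionWeight K e))) =
      setOps (commutatorWeight σ τ e) := by
  have left (R T : Finset ι) : quadWeight σ τ (octonionWeight K e) .ne R T -
      quadWeight σ τ (octonionWeight K e) .sw T R = commutatorWeight σ τ e .left R T := by
    by_cases hd : Disjoint R T
    · have hne : height τ R = height τ T → height τ R = 0 := height_eq_zero_of_eq hτ hd
      simp only [quadWeight, hd, hd.symm, if_true, beats_height, commutatorWeight,
        octonionWeight, octonionBracket, Int.cast_sub, ← mul_sub, ← indicator_and]
      congr 2
      simp only [winnerOp, true_and, and_assoc, eq_iff_iff]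
      refine and_congr_right fun hR => and_congr_right fun h => ?_
      have hT := nonempty_of_height_lt h
      have := height_pos (τ := τ) hR
      split_ifs with h'
      · simp [h'.le]
      · simp only [hT, true_and, iff_true]
        omega
    · simp [quadWeight, commutatorWeight, hd, disjoint_comm.not.1 hd, indicator_false]
  have right (R T : Finset ι) : quadWeight σ τ (octonionWeight K e) .se R T -
      quadWeight σ τ (octonionWeight K e) .nw T R = commutatorWeight σ τ e .right R T := by
    by_cases hd : Disjoint R T
    · simp only [quadWeight, hd, hd.symm, if_true, beats_height, commutatorWeight,
        octonionWeight, octonionBracket, Int.cast_sub, ← mul_sub, ← indicator_and]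
      congr 2
      simp only [winnerOp, true_and, and_assoc, eq_iff_iff]
      refine and_congr_right fun hR => and_congr_right fun h => ?_
      split_ifs with h' <;> simp [hR, h']
    · simp [quadWeight, commutatorWeight, hd, disjoint_comm.not.1 hd, indicator_false]
  funext ω
  refine Finsupp.lhom_ext' fun R => LinearMap.ext_ring ?_
  refine Finsupp.lhom_ext' fun T => LinearMap.ext_ring ?_
  cases ω
  · change setOps _ _ (.single R (1 : K)) (.single T (1 : K)) -
      setOps _ _ (.single T (1 : K)) (.single R (1 : K)) =
        setOps _ _ (.single R (1 : K)) (.single T (1 : K))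
    simp only [setOps_single, Finset.union_comm T R, ← Finsupp.single_sub, ← left, one_mul]
  · change setOps _ _ (.single R (1 : K)) (.single T (1 : K)) -
      setOps _ _ (.single T (1 : K)) (.single R (1 : K)) =
        setOps _ _ (.single R (1 : K)) (.single T (1 : K))
    simp only [setOps_single, Finset.union_comm T R, ← Finsupp.single_sub, ← right, one_mul]

omit [DecidableEq ι] in
theorem commutatorWeight_of_not_disjoint (e : ι → ZMod 2 × ZMod 2 × ZMod 2) (ω : MDOp)
    (R T : Finset ι) (h : ¬ Disjoint R T) : (commutatorWeight σ τ e ω R T : K) = 0 := by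
  simp [commutatorWeight, h, indicator_false]

end Commutators

/-! ### The universal property of the free alternative quadrialgebra. -/

section Homomorphisms

variable {K Ω X A B : Type*} [Field K] [AddCommGroup A] [Module K A] [AddCommGroup B] [Module K B]

theorem OpMonomial.map_eval {μ : BilinearOps K Ω A} {ν : BilinearOps K Ω B} (φ : A →ₗ[K] B)
    (hφ : ∀ ω a b, φ (μ ω a b) = ν ω (φ a) (φ b)) (v : X → A) (m : OpMonomial Ω X) :
    φ (m.eval μ v) = m.eval ν fun x => φ (v x) := by
  induction m with
  | var x => rfl
  | app ω a b ha hb => simp only [OpMonomial.eval, hφ, ha, hb]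

theorem map_polyEval {μ : BilinearOps K Ω A} {ν : BilinearOps K Ω B} (φ : A →ₗ[K] B)
    (hφ : ∀ ω a b, φ (μ ω a b) = ν ω (φ a) (φ b)) (v : X → A) (f : FreeOpAlgebra K Ω X) :
    φ (polyEval μ v f) = polyEval ν (fun x => φ (v x)) f := by
  simp only [polyEval, Finsupp.linearCombination_apply, Finsupp.sum, map_sum, map_smul,
    OpMonomial.map_eval φ hφ]

theorem polyEval_freeOps (μ : BilinearOps K Ω A) (v : X → A) (ω : Ω)
    (p q : FreeOpAlgebra K Ω X) :
    polyEval μ v (freeOps K Ω X ω p q) = μ ω (polyEval μ v p) (polyEval μ v q) := by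
  have : (freeOps K Ω X ω).compr₂ (polyEval μ v) =
      (μ ω).compl₁₂ (polyEval μ v) (polyEval μ v) := by
    refine Finsupp.lhom_ext' fun a => LinearMap.ext_ring ?_
    refine Finsupp.lhom_ext' fun b => LinearMap.ext_ring ?_
    simp [freeOps, polyEval, OpMonomial.eval]
  exact LinearMap.congr_fun₂ this p q

theorem map_altQuadRel {μ : BilinearOps K QuadOp A} {ν : BilinearOps K QuadOp B} (φ : A →ₗ[K] B)
    (hφ : ∀ ω a b, φ (μ ω a b) = ν ω (φ a) (φ b)) (i : Fin 9) (x y z : A) :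
    φ (altQuadRel μ i x y z) = altQuadRel ν i (φ x) (φ y) (φ z) := by
  fin_cases i <;>
    simp only [altQuadRel, Quad.assocR, Quad.assocL, Quad.assocNE, Quad.assocSW, Quad.assocN,
      Quad.assocW, Quad.assocS, Quad.assocE, Quad.assocM, Quad.succ, Quad.prec, Quad.vee,
      Quad.wedge, Quad.star, map_add, map_sub, LinearMap.add_apply, hφ]

theorem altQuadIdeal_le_ker {μ : BilinearOps K QuadOp A} (h : IsAlternativeQuadrialgebra μ)
    (v : X → A) : altQuadIdeal K X ≤ LinearMap.ker (polyEval μ v) := by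
  refine sInf_le ⟨?_, ?_⟩
  · rintro _ ⟨i, x, y, z, rfl⟩
    rw [SetLike.mem_coe, LinearMap.mem_ker, map_altQuadRel _ (polyEval_freeOps μ v)]
    exact h i _ _ _
  · rintro ω a b (h | h) <;> rw [LinearMap.mem_ker] at h ⊢ <;> simp [polyEval_freeOps, h]

/-- An identity of the free alternative quadrialgebra holds in all alternative quadrialgebras. -/
theorem polyEval_quadToMD_eq_zero {f : FreeOpAlgebra K MDOp X}
    (hf : IsIdentityOf f (quadToMD (freeAltQuadOps K X))) {μ : BilinearOps K QuadOp A}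
    (h : IsAlternativeQuadrialgebra μ) (v : X → A) : polyEval (quadToMD μ) v f = 0 := by
  let φ : FreeAltQuad K X →ₗ[K] A := (altQuadIdeal K X).liftQ _ (altQuadIdeal_le_ker h v)
  have hφ (ω : QuadOp) (a b : FreeAltQuad K X) :
      φ (freeAltQuadOps K X ω a b) = μ ω (φ a) (φ b) := by
    obtain ⟨a, rfl⟩ := Submodule.mkQ_surjective _ a
    obtain ⟨b, rfl⟩ := Submodule.mkQ_surjective _ b
    exact polyEval_freeOps μ v ω a b
  have hφ' (ω : MDOp) (a b : FreeAltQuad K X) :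
      φ (quadToMD (freeAltQuadOps K X) ω a b) = quadToMD μ ω (φ a) (φ b) := by
    cases ω <;> simp [quadToMD, hφ]
  -- The identity is only needed at the generic point, the classes of the variables. The
  -- homomorphism `φ` carries it to the point `v`.
  have key := map_polyEval φ hφ' (fun x => (altQuadIdeal K X).mkQ (.single (.var x) 1)) f
  rw [hf, map_zero] at key
  rw [key]
  congr 2
  funext x
  simp [φ, polyEval, OpMonomial.eval]

end Homomorphisms

/-! ### Monomials of degree at most 4. -/

section Shapes

variable {Ω X : Type*}

/-- The monomial `((x y) z) t`. -/
def shapeA (ω₁ ω₂ ω₃ : Ω) (x y z t : X) : OpMonomial Ω X :=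
  .app ω₃ (.app ω₂ (.app ω₁ (.var x) (.var y)) (.var z)) (.var t)

/-- The monomial `(x (y z)) t`. -/
def shapeB (ω₁ ω₂ ω₃ : Ω) (x y z t : X) : OpMonomial Ω X :=
  .app ω₃ (.app ω₂ (.var x) (.app ω₁ (.var y) (.var z))) (.var t)

/-- The monomial `(x y) (z t)`. -/
def shapeC (ω₁ ω₂ ω₃ : Ω) (x y z t : X) : OpMonomial Ω X :=
  .app ω₃ (.app ω₁ (.var x) (.var y)) (.app ω₂ (.var z) (.var t))

/-- The monomial `x ((y z) t)`. -/
def shapeD (ω₁ ω₂ ω₃ : Ω) (x y z t : X) : OpMonomial Ω X :=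
  .app ω₃ (.var x) (.app ω₂ (.app ω₁ (.var y) (.var z)) (.var t))

/-- The monomial `x (y (z t))`. -/
def shapeE (ω₁ ω₂ ω₃ : Ω) (x y z t : X) : OpMonomial Ω X :=
  .app ω₃ (.var x) (.app ω₂ (.var y) (.app ω₁ (.var z) (.var t)))

theorem OpMonomial.degree_pos (m : OpMonomial Ω X) : 0 < m.degree := by
  induction m with
  | var x => exact Nat.one_pos
  | app ω a b ha hb => exact Nat.add_pos_left ha _

theorem OpMonomial.degree_eq_one {m : OpMonomial Ω X} (h : m.degree = 1) : ∃ x, m = .var x := by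
  cases m with
  | var x => exact ⟨x, rfl⟩
  | app ω a b =>
    have ha := a.degree_pos
    have hb := b.degree_pos
    simp only [degree] at h
    omega

theorem OpMonomial.degree_eq_two {m : OpMonomial Ω X} (h : m.degree = 2) :
    ∃ ω x y, m = .app ω (.var x) (.var y) := by
  cases m with
  | var x => simp [degree] at h
  | app ω a b =>
    have ha := a.degree_pos
    have hb := b.degree_pos
    simp only [degree] at h
    obtain ⟨x, rfl⟩ := degree_eq_one (m := a) (by omega)
    obtain ⟨y, rfl⟩ := degree_eq_one (m := b) (by omega)
    exact ⟨ω, x, y, rfl⟩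

theorem OpMonomial.degree_eq_three {m : OpMonomial Ω X} (h : m.degree = 3) :
    (∃ ω₁ ω₂ x y z, m = .app ω₂ (.app ω₁ (.var x) (.var y)) (.var z)) ∨
      ∃ ω₁ ω₂ x y z, m = .app ω₂ (.var x) (.app ω₁ (.var y) (.var z)) := by
  cases m with
  | var x => simp [degree] at h
  | app ω a b =>
    have ha := a.degree_pos
    have hb := b.degree_pos
    simp only [degree] at h
    obtain h1 | h1 : a.degree = 2 ∧ b.degree = 1 ∨ a.degree = 1 ∧ b.degree = 2 := by omega
    · obtain ⟨ω₁, x, y, rfl⟩ := degree_eq_two h1.1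
      obtain ⟨z, rfl⟩ := degree_eq_one h1.2
      exact .inl ⟨ω₁, ω, x, y, z, rfl⟩
    · obtain ⟨x, rfl⟩ := degree_eq_one h1.1
      obtain ⟨ω₁, y, z, rfl⟩ := degree_eq_two h1.2
      exact .inr ⟨ω₁, ω, x, y, z, rfl⟩

theorem OpMonomial.degree_eq_four {m : OpMonomial Ω X} (h : m.degree = 4) :
    ∃ ω₁ ω₂ ω₃ x y z t, m = shapeA ω₁ ω₂ ω₃ x y z t ∨ m = shapeB ω₁ ω₂ ω₃ x y z t ∨
      m = shapeC ω₁ ω₂ ω₃ x y z t ∨ m = shapeD ω₁ ω₂ ω₃ x y z t ∨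
      m = shapeE ω₁ ω₂ ω₃ x y z t := by
  cases m with
  | var x => simp [degree] at h
  | app ω a b =>
    have ha := a.degree_pos
    have hb := b.degree_pos
    simp only [degree] at h
    obtain h1 | h1 | h1 : a.degree = 3 ∧ b.degree = 1 ∨ a.degree = 2 ∧ b.degree = 2 ∨
      a.degree = 1 ∧ b.degree = 3 := by omega
    · obtain ⟨t, rfl⟩ := degree_eq_one h1.2
      obtain ⟨ω₁, ω₂, x, y, z, rfl⟩ | ⟨ω₁, ω₂, x, y, z, rfl⟩ := degree_eq_three h1.1
      · exact ⟨ω₁, ω₂, ω, x, y, z, t, .inl rfl⟩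
      · exact ⟨ω₁, ω₂, ω, x, y, z, t, .inr (.inl rfl)⟩
    · obtain ⟨ω₁, x, y, rfl⟩ := degree_eq_two h1.1
      obtain ⟨ω₂, z, t, rfl⟩ := degree_eq_two h1.2
      exact ⟨ω₁, ω₂, ω, x, y, z, t, .inr (.inr (.inl rfl))⟩
    · obtain ⟨x, rfl⟩ := degree_eq_one h1.1
      obtain ⟨ω₁, ω₂, y, z, t, rfl⟩ | ⟨ω₁, ω₂, y, z, t, rfl⟩ := degree_eq_three h1.2
      · exact ⟨ω₁, ω₂, ω, x, y, z, t, .inr (.inr (.inr (.inl rfl)))⟩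
      · exact ⟨ω₁, ω₂, ω, x, y, z, t, .inr (.inr (.inr (.inr rfl)))⟩

end Shapes

/-! ### Coefficients of products in the model with four labels. -/

section Evaluation

variable {K X : Type*} [Field K]

/-- The substitution that sends a variable to the sum of the one-element sets at which it
occurs in `u`. -/
noncomputable def labelSubst (K : Type*) [Field K] (u : Fin 4 → X) (x : X) : Finset (Fin 4) →₀ K :=
  ∑ i, .single {i} (indicator K (x = u i))

/-- `a` is a combination of sets with `d` elements. -/
def IsPureOfCard (a : Finset (Fin 4) →₀ K) (d : ℕ) : Prop := ∀ S, a S ≠ 0 → S.card = d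

theorem isPureOfCard_labelSubst (u : Fin 4 → X) (x : X) : IsPureOfCard (labelSubst K u x) 1 := by
  intro S h
  rw [labelSubst, Finsupp.finsetSum_apply] at h
  obtain ⟨i, -, hi⟩ := Finset.exists_ne_zero_of_sum_ne_zero h
  rw [Finsupp.single_apply] at hi
  split_ifs at hi with h'
  · rw [← h', Finset.card_singleton]
  · exact absurd rfl hi

theorem labelSubst_singleton (u : Fin 4 → X) (x : X) (i : Fin 4) :
    labelSubst K u x {i} = indicator K (x = u i) := by
  simp [labelSubst, Finsupp.finsetSum_apply, Finsupp.single_apply]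

variable (K) in
/-- The commutator operations for the natural order on `Fin 4` and the order given by `τ`. -/
noncomputable abbrev labelOps (τ : Fin 4 → ℕ) (e : Fin 4 → ZMod 2 × ZMod 2 × ZMod 2) :
    BilinearOps K MDOp (Finset (Fin 4) →₀ K) :=
  setOps (commutatorWeight (fun i : Fin 4 => (i : ℕ)) τ e)

variable {τ : Fin 4 → ℕ} {e : Fin 4 → ZMod 2 × ZMod 2 × ZMod 2}

theorem IsPureOfCard.labelOps {a b : Finset (Fin 4) →₀ K} {d d' : ℕ} (ha : IsPureOfCard a d)
    (hb : IsPureOfCard b d') (ω : MDOp) : IsPureOfCard (labelOps K τ e ω a b) (d + d') := by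
  intro S h
  rw [setOps_apply fun _ _ _ => commutatorWeight_of_not_disjoint e _ _ _] at h
  obtain ⟨R, hR, h⟩ := Finset.exists_ne_zero_of_sum_ne_zero h
  rw [← ha R (by rintro h0; simp [h0] at h), ← hb (S \ R) (by rintro h0; simp [h0] at h),
    add_comm, Finset.card_sdiff_add_card_eq_card (Finset.mem_powerset.1 hR)]

variable (K) in
/-- The coefficient of `R ∪ T` in the product of `R` and `T` when `R` comes before `T`. -/
noncomputable def pairWeight (τ : Fin 4 → ℕ) (e : Fin 4 → ZMod 2 × ZMod 2 × ZMod 2) (ω : MDOp)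
    (R T : Finset (Fin 4)) : K :=
  indicator K (ω = winnerOp τ R T) * (octonionBracket e R T : ℤ)

/-- A splitting of S contributes only if its left part has d elements and its right part has the
greatest label. For concrete S, the list L of these left parts is found by enumeration. -/
theorem labelOps_apply {a b : Finset (Fin 4) →₀ K} {d : ℕ} (ha : IsPureOfCard a d) (ω : MDOp)
    (S : Finset (Fin 4)) (L : Finset (Finset (Fin 4)))
    (hL : (S.powersetCard d).filter (fun R => R.Nonempty ∧
      height (fun i : Fin 4 => (i : ℕ)) R < height (fun i : Fin 4 => (i : ℕ)) (S \ R)) = L) :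
    labelOps K τ e ω a b S = ∑ R ∈ L, pairWeight K τ e ω R (S \ R) * (a R * b (S \ R)) := by
  rw [setOps_apply fun _ _ _ => commutatorWeight_of_not_disjoint e _ _ _]
  symm
  subst hL
  refine Finset.sum_subset_zero_on_sdiff ?_ ?_ ?_
  · intro R hR
    rw [Finset.mem_filter, Finset.mem_powersetCard] at hR
    exact Finset.mem_powerset.2 hR.1.1
  · intro R hR
    rw [Finset.mem_sdiff, Finset.mem_filter, Finset.mem_powersetCard, Finset.mem_powerset] at hR
    by_cases h0 : a R = 0
    · rw [h0, zero_mul, mul_zero]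
    have hc : ¬ (R.Nonempty ∧ height (fun i : Fin 4 => (i : ℕ)) R <
        height (fun i : Fin 4 => (i : ℕ)) (S \ R)) := fun h => hR.2 ⟨⟨hR.1, ha R h0⟩, h⟩
    rw [commutatorWeight, indicator, if_neg fun h => hc ⟨h.2.1, h.2.2.1⟩, zero_mul, zero_mul]
  · intro R hR
    rw [Finset.mem_filter] at hR
    simp only [pairWeight, commutatorWeight, Finset.disjoint_sdiff, hR.2.1, hR.2.2, true_and]

theorem labelOps_apply_pair {a b : Finset (Fin 4) →₀ K} (ha : IsPureOfCard a 1) (ω : MDOp)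
    {i j : Fin 4} (hij : i < j) :
    labelOps K τ e ω a b {i, j} = pairWeight K τ e ω {i} {j} * (a {i} * b {j}) := by
  rw [labelOps_apply ha ω {i, j} {{i}} (by decide +revert), Finset.sum_singleton,
    show ({i, j} : Finset (Fin 4)) \ {i} = {j} by decide +revert]

theorem labelOps_apply_triple_one {a b : Finset (Fin 4) →₀ K} (ha : IsPureOfCard a 1) (ω : MDOp)
    {i j k : Fin 4} (hij : i < j) (hjk : j < k) :
    labelOps K τ e ω a b {i, j, k} = pairWeight K τ e ω {i} {j, k} * (a {i} * b {j, k}) +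
      pairWeight K τ e ω {j} {i, k} * (a {j} * b {i, k}) := by
  rw [labelOps_apply ha ω {i, j, k} {{i}, {j}} (by decide +revert),
    Finset.sum_pair (by decide +revert),
    show ({i, j, k} : Finset (Fin 4)) \ {i} = {j, k} by decide +revert,
    show ({i, j, k} : Finset (Fin 4)) \ {j} = {i, k} by decide +revert]

theorem labelOps_apply_triple_two {a b : Finset (Fin 4) →₀ K} (ha : IsPureOfCard a 2) (ω : MDOp)
    {i j k : Fin 4} (hij : i < j) (hjk : j < k) :
    labelOps K τ e ω a b {i, j, k} = pairWeight K τ e ω {i, j} {k} * (a {i, j} * b {k}) := by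
  rw [labelOps_apply ha ω {i, j, k} {{i, j}} (by decide +revert), Finset.sum_singleton,
    show ({i, j, k} : Finset (Fin 4)) \ {i, j} = {k} by decide +revert]

theorem labelOps_apply_univ_one {a b : Finset (Fin 4) →₀ K} (ha : IsPureOfCard a 1) (ω : MDOp) :
    labelOps K τ e ω a b {0, 1, 2, 3} =
      pairWeight K τ e ω {0} {1, 2, 3} * (a {0} * b {1, 2, 3}) +
      (pairWeight K τ e ω {1} {0, 2, 3} * (a {1} * b {0, 2, 3}) +
        pairWeight K τ e ω {2} {0, 1, 3} * (a {2} * b {0, 1, 3})) := by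
  rw [labelOps_apply ha ω {0, 1, 2, 3} {{0}, {1}, {2}} (by decide +kernel),
    Finset.sum_insert (by decide), Finset.sum_pair (by decide),
    show ({0, 1, 2, 3} : Finset (Fin 4)) \ {0} = {1, 2, 3} by decide,
    show ({0, 1, 2, 3} : Finset (Fin 4)) \ {1} = {0, 2, 3} by decide,
    show ({0, 1, 2, 3} : Finset (Fin 4)) \ {2} = {0, 1, 3} by decide]

theorem labelOps_apply_univ_two {a b : Finset (Fin 4) →₀ K} (ha : IsPureOfCard a 2) (ω : MDOp) :
    labelOps K τ e ω a b {0, 1, 2, 3} =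
      pairWeight K τ e ω {0, 1} {2, 3} * (a {0, 1} * b {2, 3}) +
      (pairWeight K τ e ω {0, 2} {1, 3} * (a {0, 2} * b {1, 3}) +
        pairWeight K τ e ω {1, 2} {0, 3} * (a {1, 2} * b {0, 3})) := by
  rw [labelOps_apply ha ω {0, 1, 2, 3} {{0, 1}, {0, 2}, {1, 2}} (by decide +kernel),
    Finset.sum_insert (by decide), Finset.sum_pair (by decide),
    show ({0, 1, 2, 3} : Finset (Fin 4)) \ {0, 1} = {2, 3} by decide,
    show ({0, 1, 2, 3} : Finset (Fin 4)) \ {0, 2} = {1, 3} by decide,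
    show ({0, 1, 2, 3} : Finset (Fin 4)) \ {1, 2} = {0, 3} by decide]

theorem labelOps_apply_univ_three {a b : Finset (Fin 4) →₀ K} (ha : IsPureOfCard a 3) (ω : MDOp) :
    labelOps K τ e ω a b {0, 1, 2, 3} =
      pairWeight K τ e ω {0, 1, 2} {3} * (a {0, 1, 2} * b {3}) := by
  rw [labelOps_apply ha ω {0, 1, 2, 3} {{0, 1, 2}} (by decide +kernel), Finset.sum_singleton,
    show ({0, 1, 2, 3} : Finset (Fin 4)) \ {0, 1, 2} = {3} by decide]

end Evaluation

/-! ### Linear relations between the coefficients of an identity. -/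

section Trees

variable {K X : Type*} [Field K]

/-- The set of labels of a tree. -/
def OpMonomial.labels {Ω : Type*} : OpMonomial Ω (Fin 4) → Finset (Fin 4)
  | .var i => {i}
  | .app _ a b => a.labels ∪ b.labels

/-- The monomial with the given tree, whose operations are the winning ones for `τ`. -/
def treeMonomial (u : Fin 4 → X) (τ : Fin 4 → ℕ) : OpMonomial Unit (Fin 4) → OpMonomial MDOp X
  | .var i => .var (u i)
  | .app _ a b => .app (winnerOp τ a.labels b.labels) (treeMonomial u τ a) (treeMonomial u τ b)

/-- The product of the octonion brackets at the nodes of a tree. -/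
def treeSign (e : Fin 4 → ZMod 2 × ZMod 2 × ZMod 2) : OpMonomial Unit (Fin 4) → ℤ
  | .var _ => 1
  | .app _ a b => octonionBracket e a.labels b.labels * (treeSign e a * treeSign e b)

/-- The linear functional that adds up the coefficients of the given trees, with their signs. -/
noncomputable def treeSum (u : Fin 4 → X) (τ : Fin 4 → ℕ)
    (e : Fin 4 → ZMod 2 × ZMod 2 × ZMod 2) (l : List (OpMonomial Unit (Fin 4))) :
    FreeOpAlgebra K MDOp X →ₗ[K] K :=
  (l.map fun T => (treeSign e T : K) • Finsupp.lapply (treeMonomial u τ T)).sum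

/-- The 15 trees with labels `0, 1, 2, 3`, in which each right factor has the greatest label. -/
def labelledTrees : List (OpMonomial Unit (Fin 4)) :=
  [shapeA () () () 0 1 2 3, shapeB () () () 0 1 2 3, shapeB () () () 1 0 2 3,
    shapeC () () () 0 1 2 3, shapeC () () () 0 2 1 3, shapeC () () () 1 2 0 3,
    shapeD () () () 0 1 2 3, shapeD () () () 1 0 2 3, shapeD () () () 2 0 1 3,
    shapeE () () () 0 1 2 3, shapeE () () () 0 2 1 3, shapeE () () () 1 0 2 3,
    shapeE () () () 1 2 0 3, shapeE () () () 2 0 1 3, shapeE () () () 2 1 0 3]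

/-- The three trees with labels `0, 1, 2`, in which each right factor has the greatest label. -/
def labelledTriples : List (OpMonomial Unit (Fin 4)) :=
  [.app () (.app () (.var 0) (.var 1)) (.var 2), .app () (.var 0) (.app () (.var 1) (.var 2)),
    .app () (.var 1) (.app () (.var 0) (.var 2))]

/-- The substitution `labelSubst` polarizes: the coefficient at the full set is a sum over all
labellings of the leaves of m that match the variables prescribed by `u`, so repeated variables need
no separate treatment. A labelling survives if the right factor has the greatest label at every node
and the operation there is the one dictated by `τ`. The surviving labelled trees are the trees of
the list with monomial m, each weighted by its product of octonion brackets. -/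
theorem eval_labelOps_univ (u : Fin 4 → X) (τ : Fin 4 → ℕ)
    (e : Fin 4 → ZMod 2 × ZMod 2 × ZMod 2) (m : OpMonomial MDOp X) (hm : m.degree = 4) :
    m.eval (labelOps K τ e) (labelSubst K u) {0, 1, 2, 3} =
      treeSum u τ e labelledTrees (.single m 1) := by
  have h1 (x : X) := isPureOfCard_labelSubst (K := K) u x
  have h2 (ω : MDOp) (x y : X) := (h1 x).labelOps (τ := τ) (e := e) (h1 y) ω
  have h3 (ω₁ ω₂ : MDOp) (x y z : X) := (h2 ω₁ x y).labelOps (τ := τ) (e := e) (h1 z) ω₂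
  have h3' (ω₁ ω₂ : MDOp) (x y z : X) := (h1 x).labelOps (τ := τ) (e := e) (h2 ω₁ y z) ω₂
  have key (m' : OpMonomial MDOp X) :
      (Finsupp.single m (1 : K)) m' = indicator K (m = m') := by
    classical
    rw [Finsupp.single_apply, indicator]
  have l01 : (0 : Fin 4) < 1 := by decide
  have l02 : (0 : Fin 4) < 2 := by decide
  have l03 : (0 : Fin 4) < 3 := by decide
  have l12 : (1 : Fin 4) < 2 := by decide
  have l13 : (1 : Fin 4) < 3 := by decide
  have l23 : (2 : Fin 4) < 3 := by decide
  obtain ⟨ω₁, ω₂, ω₃, x, y, z, t, rfl | rfl | rfl | rfl | rfl⟩ := OpMonomial.degree_eq_four hm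
  all_goals
    simp only [treeSum, labelledTrees, List.map_cons, List.map_nil, List.sum_cons, List.sum_nil,
      LinearMap.add_apply, LinearMap.smul_apply, LinearMap.zero_apply, Finsupp.lapply_apply, key,
      smul_eq_mul]
    simp only [shapeA, shapeB, shapeC, shapeD, shapeE, treeMonomial, OpMonomial.app.injEq,
      OpMonomial.var.injEq, reduceCtorEq, false_and, and_false, indicator_false, mul_zero,
      add_zero, zero_add, indicator_and, OpMonomial.labels, treeSign, OpMonomial.eval,
        Finset.singleton_union,
      Finset.insert_union, show ({1, 0, 2} : Finset (Fin 4)) = {0, 1, 2} by decide,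
      show ({2, 1, 3} : Finset (Fin 4)) = {1, 2, 3} by decide,
      show ({1, 0, 3} : Finset (Fin 4)) = {0, 1, 3} by decide,
      show ({2, 0, 3} : Finset (Fin 4)) = {0, 2, 3} by decide]
  · simp only [labelOps_apply_univ_three (h3 _ _ _ _ _), labelOps_apply_triple_two (h2 _ _ _) _
    l01 l12,
      labelOps_apply_pair (h1 _) _ l01, labelSubst_singleton, pairWeight]
    push_cast
    ring
  · simp only [labelOps_apply_univ_three (h3' _ _ _ _ _), labelOps_apply_triple_one (h1 _) _ l01
    l12,
      labelOps_apply_pair (h1 _) _ l12, labelOps_apply_pair (h1 _) _ l02,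
        labelSubst_singleton, pairWeight]
    push_cast
    ring
  · simp only [labelOps_apply_univ_two (h2 _ _ _),
      labelOps_apply_pair (h1 _) _ l01, labelOps_apply_pair (h1 _) _ l23, labelOps_apply_pair
        (h1 _) _ l02, labelOps_apply_pair (h1 _) _ l13, labelOps_apply_pair (h1 _) _ l12,
        labelOps_apply_pair (h1 _) _ l03, labelSubst_singleton, pairWeight]
    push_cast
    ring
  · simp only [labelOps_apply_univ_one (h1 _), labelOps_apply_triple_two (h2 _ _ _) _ l12 l23,
      labelOps_apply_triple_two (h2 _ _ _) _ l02 l23, labelOps_apply_triple_two (h2 _ _ _) _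
        l01 l13,
      labelOps_apply_pair (h1 _) _ l12, labelOps_apply_pair (h1 _) _ l02, labelOps_apply_pair
        (h1 _) _ l01, labelSubst_singleton, pairWeight]
    push_cast
    ring
  · simp only [labelOps_apply_univ_one (h1 _), labelOps_apply_triple_one (h1 _) _ l12 l23,
      labelOps_apply_triple_one (h1 _) _ l02 l23, labelOps_apply_triple_one (h1 _) _ l01 l13,
      labelOps_apply_pair (h1 _) _ l23, labelOps_apply_pair (h1 _) _ l13, labelOps_apply_pair
        (h1 _) _ l03, labelSubst_singleton, pairWeight]
    push_cast
    ring

theorem eval_labelOps_triple (u : Fin 4 → X) (τ : Fin 4 → ℕ)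
    (e : Fin 4 → ZMod 2 × ZMod 2 × ZMod 2) (m : OpMonomial MDOp X) (hm : m.degree = 3) :
    m.eval (labelOps K τ e) (labelSubst K u) {0, 1, 2} =
      treeSum u τ e labelledTriples (.single m 1) := by
  have h1 (x : X) := isPureOfCard_labelSubst (K := K) u x
  have h2 (ω : MDOp) (x y : X) := (h1 x).labelOps (τ := τ) (e := e) (h1 y) ω
  have key (m' : OpMonomial MDOp X) :
      (Finsupp.single m (1 : K)) m' = indicator K (m = m') := by
    classical
    rw [Finsupp.single_apply, indicator]
  have l01 : (0 : Fin 4) < 1 := by decide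
  have l02 : (0 : Fin 4) < 2 := by decide
  have l12 : (1 : Fin 4) < 2 := by decide
  obtain ⟨ω₁, ω₂, x, y, z, rfl⟩ | ⟨ω₁, ω₂, x, y, z, rfl⟩ := OpMonomial.degree_eq_three hm
  all_goals
    simp only [treeSum, labelledTriples, List.map_cons, List.map_nil, List.sum_cons, List.sum_nil,
      LinearMap.add_apply, LinearMap.smul_apply, LinearMap.zero_apply, Finsupp.lapply_apply, key,
      smul_eq_mul]
    simp only [treeMonomial, OpMonomial.app.injEq, OpMonomial.var.injEq, reduceCtorEq,
      and_false, indicator_false, mul_zero, add_zero, zero_add, indicator_and, OpMonomial.labels,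
      treeSign, OpMonomial.eval, Finset.singleton_union]
  · simp only [labelOps_apply_triple_two (h2 _ _ _) _ l01 l12, labelOps_apply_pair (h1 _) _ l01,
      labelSubst_singleton, pairWeight]
    push_cast
    ring
  · simp only [labelOps_apply_triple_one (h1 _) _ l01 l12, labelOps_apply_pair (h1 _) _ l12,
      labelOps_apply_pair (h1 _) _ l02, labelSubst_singleton, pairWeight]
    push_cast
    ring

/-- The functional reads off the coefficient at S of the value of f in the octonion model. That
value is zero because the identity passes from the free quadrialgebra to every other one. -/
theorem treeSum_eq_zero {f : FreeOpAlgebra K MDOp X}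
    (hf : IsIdentityOf f (quadToMD (freeAltQuadOps K X))) {d : ℕ} (hd : IsHomogeneousOfDegree f d)
    (u : Fin 4 → X) {τ : Fin 4 → ℕ} (hτ : Function.Injective τ)
    (e : Fin 4 → ZMod 2 × ZMod 2 × ZMod 2) (l : List (OpMonomial Unit (Fin 4)))
    (S : Finset (Fin 4)) (hl : ∀ m : OpMonomial MDOp X, m.degree = d →
      m.eval (labelOps K τ e) (labelSubst K u) S = treeSum u τ e l (.single m 1)) :
    treeSum u τ e l f = 0 := by
  have h := polyEval_quadToMD_eq_zero hf
    (isAlternativeQuadrialgebra_octonionWeight (K := K) Fin.val_injective hτ e) (labelSubst K u)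
  rw [quadToMD_setOps hτ] at h
  have h' := DFunLike.congr_fun h S
  rw [polyEval, Finsupp.linearCombination_apply, Finsupp.sum, Finsupp.finsetSum_apply,
    Finsupp.zero_apply] at h'
  rw [← h']
  conv_lhs => rw [← Finsupp.sum_single f, Finsupp.sum, map_sum]
  refine Finset.sum_congr rfl fun m hm => ?_
  rw [Finsupp.smul_apply, hl m (hd m hm), ← map_smul, Finsupp.smul_single, smul_eq_mul, mul_one]

/-- Separates the signs, a list of integers independent of f, so that they can be supplied by
computation. -/
theorem treeSum_eq_zipWith (u : Fin 4 → X) (τ : Fin 4 → ℕ)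
    (e : Fin 4 → ZMod 2 × ZMod 2 × ZMod 2) (l : List (OpMonomial Unit (Fin 4)))
    (f : FreeOpAlgebra K MDOp X) : treeSum u τ e l f =
      (List.zipWith (fun (c : ℤ) T => (c : K) * f (treeMonomial u τ T))
        (l.map (treeSign e)) l).sum := by
  induction l with
  | nil => rfl
  | cons T l ih =>
    rw [List.map_cons, List.zipWith_cons_cons, List.sum_cons, ← ih]
    rfl

/-- The signed sum of the coefficients of a polynomial identity of degree 4 at the 15 trees. -/
theorem zipWith_labelledTrees_eq_zero {f : FreeOpAlgebra K MDOp X}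
    (hf : IsIdentityOf f (quadToMD (freeAltQuadOps K X))) (hd : IsHomogeneousOfDegree f 4)
    (u : Fin 4 → X) {τ : Fin 4 → ℕ} (hτ : Function.Injective τ)
    (e : Fin 4 → ZMod 2 × ZMod 2 × ZMod 2) (s : List ℤ)
    (hs : labelledTrees.map (treeSign e) = s) :
    (List.zipWith (fun (c : ℤ) T => (c : K) * f (treeMonomial u τ T)) s labelledTrees).sum = 0 := by
  rw [← hs, ← treeSum_eq_zipWith]
  exact treeSum_eq_zero hf hd u hτ e _ _ (eval_labelOps_univ u τ e)

/-- The signed sum of the coefficients of a polynomial identity of degree 3 at the 3 trees. -/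
theorem zipWith_labelledTriples_eq_zero {f : FreeOpAlgebra K MDOp X}
    (hf : IsIdentityOf f (quadToMD (freeAltQuadOps K X))) (hd : IsHomogeneousOfDegree f 3)
    (u : Fin 4 → X) {τ : Fin 4 → ℕ} (hτ : Function.Injective τ)
    (e : Fin 4 → ZMod 2 × ZMod 2 × ZMod 2) (s : List ℤ)
    (hs : labelledTriples.map (treeSign e) = s) :
    (List.zipWith (fun (c : ℤ) T => (c : K) * f (treeMonomial u τ T)) s
      labelledTriples).sum = 0 := by
  rw [← hs, ← treeSum_eq_zipWith]
  exact treeSum_eq_zero hf hd u hτ e _ _ (eval_labelOps_triple u τ e)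

end Trees

instance : DecidableEq MDOp := fun a b => by
  cases a <;> cases b <;> first | exact isTrue rfl | exact isFalse nofun

/-! ### Potentials: the solutions of the linear relations for one order `τ`. -/

section Potentials

variable {K X : Type*} [Field K]

/-- The numbers `p a b`, one for each ordering `(a, b, c)` of `0, 1, 2`, sum up to zero, and each
coefficient of `f` at a labelled tree is a difference of two of them. -/
structure IsPotential (f : FreeOpAlgebra K MDOp X) (u : Fin 4 → X) (τ : Fin 4 → ℕ)
    (p : Fin 4 → Fin 4 → K) : Prop where
  sum_eq : p 0 1 + p 0 2 + p 1 0 + p 1 2 + p 2 0 + p 2 1 = 0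
  a0123 : f (treeMonomial u τ (shapeA () () () 0 1 2 3)) = p 0 1 - p 1 0
  b0123 : f (treeMonomial u τ (shapeB () () () 0 1 2 3)) = p 2 1 - p 1 2
  b1023 : f (treeMonomial u τ (shapeB () () () 1 0 2 3)) = p 2 0 - p 0 2
  c0123 : f (treeMonomial u τ (shapeC () () () 0 1 2 3)) = p 2 0 - p 2 1
  c0213 : f (treeMonomial u τ (shapeC () () () 0 2 1 3)) = p 1 0 - p 1 2
  c1203 : f (treeMonomial u τ (shapeC () () () 1 2 0 3)) = p 0 1 - p 0 2
  d0123 : f (treeMonomial u τ (shapeD () () () 0 1 2 3)) = p 1 0 - p 2 0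
  d1023 : f (treeMonomial u τ (shapeD () () () 1 0 2 3)) = p 0 1 - p 2 1
  d2013 : f (treeMonomial u τ (shapeD () () () 2 0 1 3)) = p 0 2 - p 1 2
  e0123 : f (treeMonomial u τ (shapeE () () () 0 1 2 3)) = p 1 2 - p 0 1
  e0213 : f (treeMonomial u τ (shapeE () () () 0 2 1 3)) = p 2 1 - p 0 2
  e1023 : f (treeMonomial u τ (shapeE () () () 1 0 2 3)) = p 0 2 - p 1 0
  e1203 : f (treeMonomial u τ (shapeE () () () 1 2 0 3)) = p 2 0 - p 1 2
  e2013 : f (treeMonomial u τ (shapeE () () () 2 0 1 3)) = p 0 1 - p 2 0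
  e2103 : f (treeMonomial u τ (shapeE () () () 2 1 0 3)) = p 1 0 - p 2 1

/-- The 15 trees correspond to the 15 pairs of the six numbers p a b, each coefficient being the
difference over its pair. Such families of differences form a space of dimension 5, and ten choices
of octonion units suffice to cut it out of the space of dimension 15. A bracket of signs is 0, 2 or
-2, so three of them multiply to 0, 8 or -8. Only 2 and 3 have to be inverted. -/
theorem exists_isPotential [CharZero K] {f : FreeOpAlgebra K MDOp X}
    (hf : IsIdentityOf f (quadToMD (freeAltQuadOps K X))) (hd : IsHomogeneousOfDegree f 4)
    (u : Fin 4 → X) (τ : Fin 4 → ℕ) (hτ : Function.Injective τ) : ∃ p, IsPotential f u τ p := by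
  have h := zipWith_labelledTrees_eq_zero hf hd u hτ
  have h0 := h ![(0,0,1), (0,0,1), (0,0,1), (0,1,0)]
    [0, 0, 0, 0, 0, 0, 0, 0, 0, -8, -8, -8, -8, -8, -8] (by decide +kernel)
  have h1 := h ![(0,0,1), (0,0,1), (0,1,0), (0,0,1)]
    [0, 8, 8, 0, 0, 0, 8, 8, 0, 8, 0, 8, 0, 0, 0] (by decide +kernel)
  have h2 := h ![(0,0,1), (0,0,1), (0,1,0), (0,1,1)]
    [0, -8, -8, 0, 8, 8, 0, 0, 0, 0, 0, 0, 0, -8, -8] (by decide +kernel)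
  have h3 := h ![(0,0,1), (0,1,0), (0,0,1), (0,0,1)]
    [-8, -8, 0, 0, 0, 0, -8, 0, 8, 0, 8, 0, 0, 8, 0] (by decide +kernel)
  have h4 := h ![(0,0,1), (0,1,0), (0,0,1), (0,1,1)]
    [8, 8, 0, 8, 0, -8, 0, 0, 0, 0, 0, -8, -8, 0, 0] (by decide +kernel)
  have h5 := h ![(0,0,1), (0,1,0), (0,1,1), (0,0,1)]
    [0, 0, 0, -8, 8, 0, 0, 8, -8, 0, 0, 8, 0, -8, 0] (by decide +kernel)
  have h6 := h ![(0,0,1), (0,0,1), (0,1,0), (1,0,0)]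
    [0, -8, -8, 0, -8, -8, 8, 8, 0, -8, 8, -8, 8, -8, -8] (by decide +kernel)
  have h7 := h ![(0,0,1), (0,1,0), (0,0,1), (1,0,0)]
    [8, 8, 0, -8, 0, 8, -8, 0, 8, 8, -8, -8, -8, -8, 8] (by decide +kernel)
  have h8 := h ![(0,0,1), (0,1,0), (0,1,1), (1,0,0)]
    [0, 0, 0, -8, 8, -8, -8, 8, -8, 8, -8, -8, 8, 8, -8] (by decide +kernel)
  have h9 := h ![(0,0,1), (0,1,0), (1,0,0), (0,0,1)]
    [-8, 8, -8, 8, -8, 0, 8, 8, -8, -8, 8, 8, 0, -8, 0] (by decide +kernel)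
  simp only [labelledTrees, List.zipWith_cons_cons, List.zipWith_nil_left, List.sum_cons,
    List.sum_nil,
    Int.cast_ofNat, Int.cast_neg, Int.cast_zero, zero_mul, zero_add, add_zero]
    at h0 h1 h2 h3 h4 h5 h6 h7 h8 h9
  set a0123 := f (treeMonomial u τ (shapeA () () () 0 1 2 3)) with h_a0123
  set b0123 := f (treeMonomial u τ (shapeB () () () 0 1 2 3)) with h_b0123
  set b1023 := f (treeMonomial u τ (shapeB () () () 1 0 2 3)) with h_b1023
  set c0123 := f (treeMonomial u τ (shapeC () () () 0 1 2 3)) with h_c0123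
  set c0213 := f (treeMonomial u τ (shapeC () () () 0 2 1 3)) with h_c0213
  set c1203 := f (treeMonomial u τ (shapeC () () () 1 2 0 3)) with h_c1203
  set d0123 := f (treeMonomial u τ (shapeD () () () 0 1 2 3)) with h_d0123
  set d1023 := f (treeMonomial u τ (shapeD () () () 1 0 2 3)) with h_d1023
  set d2013 := f (treeMonomial u τ (shapeD () () () 2 0 1 3)) with h_d2013
  set e0123 := f (treeMonomial u τ (shapeE () () () 0 1 2 3)) with h_e0123
  set e0213 := f (treeMonomial u τ (shapeE () () () 0 2 1 3)) with h_e0213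
  set e1023 := f (treeMonomial u τ (shapeE () () () 1 0 2 3)) with h_e1023
  set e1203 := f (treeMonomial u τ (shapeE () () () 1 2 0 3)) with h_e1203
  set e2013 := f (treeMonomial u τ (shapeE () () () 2 0 1 3)) with h_e2013
  set e2103 := f (treeMonomial u τ (shapeE () () () 2 1 0 3)) with h_e2103
  -- The sum of the five differences of a value p a b with the others is 5 p a b minus the other
  -- five values, which is 6 p a b since all six have sum zero. Each entry is this sum, written in
  -- coefficients of f, divided by 6. The entries with an index 3 or with equal indices play no
  -- role.
  let p : Fin 4 → Fin 4 → K := ![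
    ![0,
      (a0123 + c1203 + d1023 - e0123 + e2013) / 6,
      (-b1023 - c1203 + d2013 - e0213 + e1023) / 6,
      0],
    ![(-a0123 + c0213 + d0123 - e1023 + e2103) / 6,
      0,
      (-b0123 - c0213 - d2013 + e0123 - e1203) / 6,
      0],
    ![(b1023 + c0123 - d0123 + e1203 - e2013) / 6,
      (b0123 - c0123 - d1023 + e0213 - e2103) / 6,
      0,
      0], 0]
  have p01 : p 0 1 = (a0123 + c1203 + d1023 - e0123 + e2013) / 6 := rfl
  have p02 : p 0 2 = (-b1023 - c1203 + d2013 - e0213 + e1023) / 6 := rfl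
  have p10 : p 1 0 = (-a0123 + c0213 + d0123 - e1023 + e2103) / 6 := rfl
  have p12 : p 1 2 = (-b0123 - c0213 - d2013 + e0123 - e1203) / 6 := rfl
  have p20 : p 2 0 = (b1023 + c0123 - d0123 + e1203 - e2013) / 6 := rfl
  have p21 : p 2 1 = (b0123 - c0123 - d1023 + e0213 - e2103) / 6 := rfl
  refine ⟨p, ?_, ?_, ?_, ?_, ?_, ?_, ?_, ?_, ?_, ?_, ?_, ?_, ?_, ?_, ?_, ?_⟩
  · rw [p01, p02, p10, p12, p20, p21]
    ring
  · rw [p01, p10]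
    linear_combination (exp := 1) (-1/36) * h0 + (-1/144) * h1 + (1/144) * h2 + (-1/36) * h3 +
      (1/36) * h4 + (1/72) * h5 + (1/72) * h6 + (-1/72) * h8 + (-1/36) * h9
  · rw [p21, p12]
    linear_combination (exp := 1) (1/144) * h1 + (-1/144) * h2 + (-1/144) * h3 + (1/144) * h4 +
      (-1/72) * h5 + (-1/72) * h6 + (1/72) * h7 + (1/72) * h8 + (1/36) * h9
  · rw [p20, p02]
    linear_combination (exp := 1) (1/36) * h0 + (1/36) * h1 + (-1/36) * h2 + (1/144) * h3 +
      (-1/144) * h4 + (1/72) * h5 + (-1/72) * h7 + (-1/72) * h8 + (-1/36) * h9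
  · rw [p20, p21]
    linear_combination (exp := 1) (-1/144) * h0 + (1/144) * h1 + (1/36) * h2 + (1/36) * h4 +
      (-1/36) * h5 + (-1/72) * h6 + (-1/72) * h7 + (1/72) * h9
  · rw [p10, p12]
    linear_combination (exp := 1) (-1/144) * h0 + (1/36) * h2 + (1/144) * h3 + (1/36) * h4 +
      (1/36) * h5 + (-1/72) * h6 + (-1/72) * h7 + (-1/72) * h9
  · rw [p01, p02]
    linear_combination (exp := 1) (1/144) * h1 + (1/36) * h2 + (-1/144) * h3 + (-1/36) * h4 +
      (-1/36) * h5 + (-1/72) * h6 + (1/72) * h7 + (1/72) * h9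
  · rw [p10, p20]
    linear_combination (exp := 1) (1/36) * h1 + (1/144) * h2 + (-1/36) * h3 + (-1/144) * h4 +
      (-1/72) * h5 + (1/72) * h6 + (-1/72) * h7 + (-1/72) * h8 + (-1/72) * h9
  · rw [p01, p21]
    linear_combination (exp := 1) (1/144) * h0 + (1/36) * h1 + (1/36) * h3 + (1/144) * h4 +
      (1/72) * h5 + (1/72) * h6 + (1/72) * h7 + (1/72) * h8 + (1/72) * h9
  · rw [p02, p12]
    linear_combination (exp := 1) (1/144) * h0 + (1/36) * h1 + (1/144) * h2 + (1/36) * h3 +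
      (-1/72) * h5 + (1/72) * h6 + (1/72) * h7 + (-1/72) * h8 + (-1/72) * h9
  · rw [p12, p01]
    linear_combination (exp := 1) (-1/36) * h0 + (1/36) * h1 + (1/36) * h2 + (1/144) * h4 +
      (-1/48) * h5 + (1/72) * h7 + (1/72) * h8
  · rw [p21, p02]
    linear_combination (exp := 1) (-1/36) * h0 + (1/144) * h2 + (1/36) * h3 + (1/36) * h4 +
      (1/48) * h5 + (1/72) * h6 + (-1/72) * h8
  · rw [p02, p10]
    linear_combination (exp := 1) (-1/144) * h0 + (1/144) * h1 + (-1/144) * h4 + (1/48) * h5 +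
      (-1/72) * h6 + (-1/72) * h7 + (-1/72) * h8
  · rw [p20, p12]
    linear_combination (exp := 1) (-1/36) * h0 + (-1/144) * h1 + (-1/36) * h3 + (-1/36) * h4 +
      (-1/48) * h5 + (1/72) * h6 + (1/72) * h8
  · rw [p01, p20]
    linear_combination (exp := 1) (-1/144) * h0 + (-1/144) * h2 + (1/144) * h3 + (-1/48) * h5 +
      (-1/72) * h6 + (-1/72) * h7 + (1/72) * h8
  · rw [p10, p21]
    linear_combination (exp := 1) (-1/36) * h0 + (-1/36) * h1 + (-1/36) * h2 + (-1/144) * h3 +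
      (1/48) * h5 + (1/72) * h7 + (-1/72) * h8

/-- The orders `τ` and `τ'` have the same winners at all nodes of a tree. -/
def TreesAgree (τ τ' : Fin 4 → ℕ) : OpMonomial Unit (Fin 4) → Prop
  | .var _ => True
  | .app _ a b => winnerOp τ a.labels b.labels = winnerOp τ' a.labels b.labels ∧
      TreesAgree τ τ' a ∧ TreesAgree τ τ' b

/-- Agreement of two orders on a tree is decidable. -/
def decidableTreesAgree (τ τ' : Fin 4 → ℕ) : (T : OpMonomial Unit (Fin 4)) →
    Decidable (TreesAgree τ τ' T)
  | .var _ => isTrue trivial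
  | .app _ a b =>
    have := decidableTreesAgree τ τ' a
    have := decidableTreesAgree τ τ' b
    inferInstanceAs (Decidable (_ ∧ _ ∧ _))

instance (τ τ' : Fin 4 → ℕ) : DecidablePred (TreesAgree τ τ') := decidableTreesAgree τ τ'

theorem TreesAgree.treeMonomial_eq {τ τ' : Fin 4 → ℕ} {T : OpMonomial Unit (Fin 4)}
    (h : TreesAgree τ τ' T) (u : Fin 4 → X) : treeMonomial u τ T = treeMonomial u τ' T := by
  induction T with
  | var i => rfl
  | app ω a b ha hb => rw [treeMonomial, treeMonomial, h.1, ha h.2.1, hb h.2.2]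

/-- Four families of trees such that the number `p 0 1` of a potential is determined by the
coefficients at the trees of each of them. -/
def determiningTrees : Fin 4 → List (OpMonomial Unit (Fin 4))
  | 0 => [shapeA () () () 0 1 2 3, shapeB () () () 0 1 2 3, shapeB () () () 1 0 2 3,
      shapeC () () () 0 1 2 3, shapeD () () () 0 1 2 3]
  | 1 => [shapeA () () () 0 1 2 3, shapeB () () () 0 1 2 3, shapeC () () () 1 2 0 3,
      shapeD () () () 2 0 1 3, shapeE () () () 2 0 1 3]
  | 2 => [shapeC () () () 0 1 2 3, shapeD () () () 1 0 2 3, shapeD () () () 2 0 1 3,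
      shapeE () () () 1 0 2 3, shapeE () () () 1 2 0 3]
  | 3 => [shapeC () () () 1 2 0 3, shapeD () () () 0 1 2 3, shapeE () () () 0 1 2 3,
      shapeE () () () 0 2 1 3, shapeE () () () 1 0 2 3]

/-- With the six numbers as vertices and the coefficients as edges, each family in
`determiningTrees` is a spanning tree of the complete graph. Its five differences and the condition
of sum zero determine the potential. Where the two orders have the same winners, both potentials
read the same coefficients of f. -/
theorem IsPotential.apply_eq_of_agree [CharZero K] {f : FreeOpAlgebra K MDOp X} {u : Fin 4 → X}
    {τ τ' : Fin 4 → ℕ} {p p' : Fin 4 → Fin 4 → K} (hp : IsPotential f u τ p)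
    (hp' : IsPotential f u τ' p') (h : ∃ n, ∀ T ∈ determiningTrees n, TreesAgree τ τ' T) :
    p 0 1 = p' 0 1 := by
  have key {T : OpMonomial Unit (Fin 4)} {r r' : K} (hT : TreesAgree τ τ' T)
      (hr : f (treeMonomial u τ T) = r) (hr' : f (treeMonomial u τ' T) = r') : r = r' := by
    rw [← hr, ← hr', hT.treeMonomial_eq]
  have hs := hp.sum_eq
  have hs' := hp'.sum_eq
  obtain ⟨n, h⟩ := h
  match n with
  | 0 =>
    simp only [determiningTrees, List.forall_mem_cons] at h
    obtain ⟨ha0123, hb0123, hb1023, hc0123, hd0123, -⟩ := h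
    linear_combination (exp := 1) 1 / 6 * (hs - hs' + 5 * key ha0123 hp.a0123 hp'.a0123 + 4 *
      key hd0123 hp.d0123 hp'.d0123 + key hb1023 hp.b1023 hp'.b1023 + 2 * key hc0123 hp.c0123
      hp'.c0123 + key hb0123 hp.b0123 hp'.b0123)
  | 1 =>
    simp only [determiningTrees, List.forall_mem_cons] at h
    obtain ⟨ha0123, hb0123, hc1203, hd2013, he2013, -⟩ := h
    linear_combination (exp := 1) 1 / 6 * (hs - hs' + key ha0123 hp.a0123 hp'.a0123 + 3 * key
      hc1203 hp.c1203 hp'.c1203 + 2 * key hd2013 hp.d2013 hp'.d2013 + key he2013 hp.e2013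
      hp'.e2013 - key hb0123 hp.b0123 hp'.b0123)
  | 2 =>
    simp only [determiningTrees, List.forall_mem_cons] at h
    obtain ⟨hc0123, hd1023, hd2013, he1023, he1203, -⟩ := h
    linear_combination (exp := 1) 1 / 6 * (hs - hs' + 5 * key hd1023 hp.d1023 hp'.d1023 - 4 *
      key hc0123 hp.c0123 hp'.c0123 + 3 * key he1203 hp.e1203 hp'.e1203 - 2 * key hd2013
      hp.d2013 hp'.d2013 + key he1023 hp.e1023 hp'.e1023)
  | 3 =>
    simp only [determiningTrees, List.forall_mem_cons] at h
    obtain ⟨hc1203, hd0123, he0123, he0213, he1023, -⟩ := h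
    linear_combination (exp := 1) 1 / 6 * (hs - hs' + 4 * key hc1203 hp.c1203 hp'.c1203 - key
      he0123 hp.e0123 hp'.e0123 - key he0213 hp.e0213 hp'.e0213 + 2 * key he1023 hp.e1023
      hp'.e1023 + key hd0123 hp.d0123 hp'.d0123)

/-- The tree with the labels changed by a permutation. -/
def OpMonomial.relabel (s : Equiv.Perm (Fin 4)) :
    OpMonomial Unit (Fin 4) → OpMonomial Unit (Fin 4)
  | .var i => .var (s i)
  | .app ω a b => .app ω (a.relabel s) (b.relabel s)

theorem OpMonomial.labels_relabel (s : Equiv.Perm (Fin 4)) (T : OpMonomial Unit (Fin 4)) :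
    (T.relabel s).labels = T.labels.image s := by
  induction T with
  | var i => simp [relabel, labels]
  | app ω a b ha hb => simp only [relabel, labels, ha, hb, Finset.image_union]

theorem winnerOp_comp (s : Equiv.Perm (Fin 4)) (τ : Fin 4 → ℕ) (R T : Finset (Fin 4)) :
    winnerOp (fun i => τ (s i)) R T = winnerOp τ (R.image s) (T.image s) := by
  simp only [winnerOp, height, Finset.sup_image, Function.comp_def]
  rfl

theorem treeMonomial_comp (s : Equiv.Perm (Fin 4)) (u : Fin 4 → X) (τ : Fin 4 → ℕ)
    (T : OpMonomial Unit (Fin 4)) :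
    treeMonomial (fun i => u (s i)) (fun i => τ (s i)) T = treeMonomial u τ (T.relabel s) := by
  induction T with
  | var i => rfl
  | app ω a b ha hb =>
    simp only [treeMonomial, OpMonomial.relabel, OpMonomial.labels_relabel, winnerOp_comp, ha, hb]

/-- Exchanging the labels 0 and 1 may put the greatest label of a node into its left factor and so
lead out of the 15 trees. The five trees used here stay among them, and their differences form a
spanning tree of the six numbers. Together with the sums being zero this determines the new
potential. `IsPotential.swap_one_two` uses the same argument. -/
theorem IsPotential.swap_zero_one [CharZero K] {f : FreeOpAlgebra K MDOp X} {x y z t : X}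
    {a b c d : ℕ} {p p' : Fin 4 → Fin 4 → K} (hp : IsPotential f ![x, y, z, t] ![a, b, c, d] p)
    (hp' : IsPotential f ![y, x, z, t] ![b, a, c, d] p') :
    p' 0 1 = p 1 0 ∧
      p' 0 2 = p 1 2 ∧
      p' 1 0 = p 0 1 ∧
      p' 1 2 = p 0 2 ∧
      p' 2 0 = p 2 1 ∧
      p' 2 1 = p 2 0 := by
  have key (T : OpMonomial Unit (Fin 4)) : treeMonomial ![y, x, z, t] ![b, a, c, d] T =
      treeMonomial ![x, y, z, t] ![a, b, c, d] (T.relabel (Equiv.swap 0 1)) := by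
    rw [← treeMonomial_comp]
    congr 1 <;> ext i <;> fin_cases i <;> rfl
  have e_b0123 := hp.b1023.symm.trans ((congrArg f (key (shapeB () () () 0 1 2 3)).symm).trans
    hp'.b0123)
  have e_b1023 := hp.b0123.symm.trans ((congrArg f (key (shapeB () () () 1 0 2 3)).symm).trans
    hp'.b1023)
  have e_c0213 := hp.c1203.symm.trans ((congrArg f (key (shapeC () () () 0 2 1 3)).symm).trans
    hp'.c0213)
  have e_c1203 := hp.c0213.symm.trans ((congrArg f (key (shapeC () () () 1 2 0 3)).symm).trans
    hp'.c1203)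
  have e_d0123 := hp.d1023.symm.trans ((congrArg f (key (shapeD () () () 0 1 2 3)).symm).trans
    hp'.d0123)
  have hs := hp.sum_eq
  have hs' := hp'.sum_eq
  refine ⟨?_, ?_, ?_, ?_, ?_, ?_⟩
  · linear_combination (exp := 1) 1 / 6 * (hs' - hs - (5 * e_c1203 - 4 * e_b1023 - 3 * e_d0123 + 2
    * e_c0213 - e_b0123))
  · linear_combination (exp := 1) 1 / 6 * (hs' - hs - (-4 * e_b1023 - e_c1203 - 3 * e_d0123 + 2 *
    e_c0213 - e_b0123))
  · linear_combination (exp := 1) 1 / 6 * (hs' - hs - (2 * e_c0213 + 3 * e_d0123 - e_b0123 + 2 *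
    e_b1023 - e_c1203))
  · linear_combination (exp := 1) 1 / 6 * (hs' - hs - (-e_b0123 - 4 * e_c0213 + 3 * e_d0123 + 2 *
    e_b1023 - e_c1203))
  · linear_combination (exp := 1) 1 / 6 * (hs' - hs - (2 * e_b1023 - e_c1203 - 3 * e_d0123 + 2 *
    e_c0213 - e_b0123))
  · linear_combination (exp := 1) 1 / 6 * (hs' - hs - (5 * e_b0123 - 4 * e_c0213 + 3 * e_d0123 + 2
    * e_b1023 - e_c1203))

theorem IsPotential.swap_one_two [CharZero K] {f : FreeOpAlgebra K MDOp X} {x y z t : X}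
    {a b c d : ℕ} {p p' : Fin 4 → Fin 4 → K} (hp : IsPotential f ![x, y, z, t] ![a, b, c, d] p)
    (hp' : IsPotential f ![x, z, y, t] ![a, c, b, d] p') :
    p' 0 1 = p 0 2 ∧
      p' 0 2 = p 0 1 ∧
      p' 1 0 = p 2 0 ∧
      p' 1 2 = p 2 1 ∧
      p' 2 0 = p 1 0 ∧
      p' 2 1 = p 1 2 := by
  have key (T : OpMonomial Unit (Fin 4)) : treeMonomial ![x, z, y, t] ![a, c, b, d] T =
      treeMonomial ![x, y, z, t] ![a, b, c, d] (T.relabel (Equiv.swap 1 2)) := by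
    rw [← treeMonomial_comp]
    congr 1 <;> ext i <;> fin_cases i <;> rfl
  have e_c0123 := hp.c0213.symm.trans ((congrArg f (key (shapeC () () () 0 1 2 3)).symm).trans
    hp'.c0123)
  have e_c0213 := hp.c0123.symm.trans ((congrArg f (key (shapeC () () () 0 2 1 3)).symm).trans
    hp'.c0213)
  have e_d1023 := hp.d2013.symm.trans ((congrArg f (key (shapeD () () () 1 0 2 3)).symm).trans
    hp'.d1023)
  have e_d2013 := hp.d1023.symm.trans ((congrArg f (key (shapeD () () () 2 0 1 3)).symm).trans
    hp'.d2013)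
  have e_e0123 := hp.e0213.symm.trans ((congrArg f (key (shapeE () () () 0 1 2 3)).symm).trans
    hp'.e0123)
  have hs := hp.sum_eq
  have hs' := hp'.sum_eq
  refine ⟨?_, ?_, ?_, ?_, ?_, ?_⟩
  · linear_combination (exp := 1) 1 / 6 * (hs' - hs - (2 * e_d1023 - 3 * e_e0123 - e_c0123 -
    e_c0213 - e_d2013))
  · linear_combination (exp := 1) 1 / 6 * (hs' - hs - (5 * e_d2013 + 3 * e_e0123 - e_c0213 + 2 *
    e_d1023 - e_c0123))
  · linear_combination (exp := 1) 1 / 6 * (hs' - hs - (5 * e_c0213 - e_d2013 + 3 * e_e0123 + 2 *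
    e_d1023 - e_c0123))
  · linear_combination (exp := 1) 1 / 6 * (hs' - hs - (-e_c0213 - e_d2013 + 3 * e_e0123 + 2 *
    e_d1023 - e_c0123))
  · linear_combination (exp := 1) 1 / 6 * (hs' - hs - (5 * e_c0123 - 4 * e_d1023 - 3 * e_e0123 -
    e_c0213 - e_d2013))
  · linear_combination (exp := 1) 1 / 6 * (hs' - hs - (-e_c0123 - 4 * e_d1023 - 3 * e_e0123 -
    e_c0213 - e_d2013))

end Potentials

/-! ### All coefficients of degree 4 in terms of four potentials. -/

section Coefficients

variable {K X : Type*} [Field K]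

/-- The position of the winning variable in `((x y) z) t`. -/
def winnerA : MDOp → MDOp → MDOp → Fin 4
  | _, _, .right => 3
  | _, .right, .left => 2
  | .right, .left, .left => 1
  | .left, .left, .left => 0

/-- The position of the winning variable in `(x (y z)) t`. -/
def winnerB : MDOp → MDOp → MDOp → Fin 4
  | _, _, .right => 3
  | .right, .right, .left => 2
  | .left, .right, .left => 1
  | _, .left, .left => 0

/-- The position of the winning variable in `(x y) (z t)`. -/
def winnerC : MDOp → MDOp → MDOp → Fin 4
  | _, .right, .right => 3
  | _, .left, .right => 2
  | .right, _, .left => 1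
  | .left, _, .left => 0

/-- The position of the winning variable in `x ((y z) t)`. -/
def winnerD : MDOp → MDOp → MDOp → Fin 4
  | _, .right, .right => 3
  | .right, .left, .right => 2
  | .left, .left, .right => 1
  | _, _, .left => 0

/-- The position of the winning variable in `x (y (z t))`. -/
def winnerE : MDOp → MDOp → MDOp → Fin 4
  | .right, .right, .right => 3
  | .left, .right, .right => 2
  | _, .left, .right => 1
  | _, _, .left => 0

theorem exists_potential_family [CharZero K] {f : FreeOpAlgebra K MDOp X}
    (hf : IsIdentityOf f (quadToMD (freeAltQuadOps K X))) (hd : IsHomogeneousOfDegree f 4) :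
    ∃ P : (Fin 4 → X) → (Fin 4 → ℕ) → Fin 4 → Fin 4 → K,
      ∀ u τ, Function.Injective τ → IsPotential f u τ (P u τ) := by
  have h (u : Fin 4 → X) (τ : Fin 4 → ℕ) :
      ∃ p, Function.Injective τ → IsPotential f u τ p := by
    by_cases hτ : Function.Injective τ
    · obtain ⟨p, hp⟩ := exists_isPotential hf hd u τ hτ
      exact ⟨p, fun _ => hp⟩
    · exact ⟨0, fun h => absurd h hτ⟩
  choose P hP using h
  exact ⟨P, hP⟩

variable {f : FreeOpAlgebra K MDOp X} {P : (Fin 4 → X) → (Fin 4 → ℕ) → Fin 4 → Fin 4 → K}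

/-- The transpositions (0 1) and (1 2) generate the permutations of the first three labels.
Composing the two swap lemmas therefore reduces the entries of a potential to its entry at (0, 1),
for permuted variables and orders. -/
theorem potential_family_perm [CharZero K]
    (hP : ∀ u τ, Function.Injective τ → IsPotential f u τ (P u τ)) (x y z t : X) {a b c d : ℕ}
    (hτ : Function.Injective ![a, b, c, d]) :
    P ![x, y, z, t] ![a, b, c, d] 1 0 = P ![y, x, z, t] ![b, a, c, d] 0 1 ∧
      P ![x, y, z, t] ![a, b, c, d] 1 2 = P ![y, z, x, t] ![b, c, a, d] 0 1 ∧
      P ![x, y, z, t] ![a, b, c, d] 2 0 = P ![z, x, y, t] ![c, a, b, d] 0 1 ∧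
      P ![x, y, z, t] ![a, b, c, d] 2 1 = P ![z, y, x, t] ![c, b, a, d] 0 1 := by
  have swap₁ {a b c d : ℕ} (h : Function.Injective ![a, b, c, d]) :
      Function.Injective ![b, a, c, d] := by
    convert h.comp (Equiv.swap (0 : Fin 4) 1).injective
    ext i
    fin_cases i <;> rfl
  have swap₂ {a b c d : ℕ} (h : Function.Injective ![a, b, c, d]) :
      Function.Injective ![a, c, b, d] := by
    convert h.comp (Equiv.swap (1 : Fin 4) 2).injective
    ext i
    fin_cases i <;> rfl
  have h := hP ![x, y, z, t] _ hτ
  have h₁ := hP ![y, x, z, t] _ (swap₁ hτ)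
  have h₂ := hP ![x, z, y, t] _ (swap₂ hτ)
  have h₁₂ := hP ![y, z, x, t] _ (swap₂ (swap₁ hτ))
  have h₂₁ := hP ![z, x, y, t] _ (swap₁ (swap₂ hτ))
  have h₁₂₁ := hP ![z, y, x, t] _ (swap₁ (swap₂ (swap₁ hτ)))
  obtain ⟨e, e', -, -, e'', -⟩ := h.swap_zero_one h₁
  obtain ⟨g, -, g', -⟩ := h₁.swap_one_two h₁₂
  obtain ⟨k, -⟩ := h₁₂.swap_zero_one h₁₂₁
  obtain ⟨-, -, l, -⟩ := h.swap_one_two h₂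
  obtain ⟨l', -⟩ := h₂.swap_zero_one h₂₁
  exact ⟨e.symm, (g.trans e').symm, (l'.trans l).symm, (k.trans (g'.trans e'')).symm⟩

/-- The orders of four labels in which the label `j` is the greatest. -/
def ordersWithGreatest : Fin 4 → List (Fin 4 → ℕ)
  | 0 => [![3, 0, 1, 2], ![3, 0, 2, 1], ![3, 1, 0, 2], ![3, 1, 2, 0],
      ![3, 2, 0, 1], ![3, 2, 1, 0]]
  | 1 => [![0, 3, 1, 2], ![0, 3, 2, 1], ![1, 3, 0, 2], ![1, 3, 2, 0],
      ![2, 3, 0, 1], ![2, 3, 1, 0]]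
  | 2 => [![0, 1, 3, 2], ![0, 2, 3, 1], ![1, 0, 3, 2], ![1, 2, 3, 0],
      ![2, 0, 3, 1], ![2, 1, 3, 0]]
  | 3 => [![0, 1, 2, 3], ![0, 2, 1, 3], ![1, 0, 2, 3], ![1, 2, 0, 3],
      ![2, 0, 1, 3], ![2, 1, 0, 3]]

/-- An order of four labels in which the label `j` is the greatest. -/
def baseOrder : Fin 4 → Fin 4 → ℕ :=
  ![![3, 0, 1, 2], ![0, 3, 1, 2], ![0, 1, 3, 2], ![0, 1, 2, 3]]

theorem baseOrder_mem (j : Fin 4) : baseOrder j ∈ ordersWithGreatest j := by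
  revert j
  decide

/-- The potentials at `(0, 1, 2)` for four orders with different greatest elements. -/
noncomputable def basePotential (P : (Fin 4 → X) → (Fin 4 → ℕ) → Fin 4 → Fin 4 → K) (j : Fin 4)
    (x y z t : X) : K :=
  P ![x, y, z, t] (baseOrder j) 0 1

theorem injective_of_mem_ordersWithGreatest {j : Fin 4} {τ : Fin 4 → ℕ}
    (hτ : τ ∈ ordersWithGreatest j) : Function.Injective τ := by
  revert j τ
  decide +kernel

/-- Any order can be changed into the base order with the same greatest label in three moves, some
possibly trivial. Each move preserves the winners on one of the four families of `determiningTrees`.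
-/
theorem exists_agree_of_mem_ordersWithGreatest (j : Fin 4) :
    ∀ τ ∈ ordersWithGreatest j, ∃ τ₁ ∈ ordersWithGreatest j, ∃ τ₂ ∈ ordersWithGreatest j,
      (∃ n, ∀ T ∈ determiningTrees n, TreesAgree τ τ₁ T) ∧
      (∃ n, ∀ T ∈ determiningTrees n, TreesAgree τ₁ τ₂ T) ∧
      ∃ n, ∀ T ∈ determiningTrees n, TreesAgree τ₂ (baseOrder j) T := by
  revert j
  decide +kernel

theorem potential_family_eq_basePotential [CharZero K]
    (hP : ∀ u τ, Function.Injective τ → IsPotential f u τ (P u τ)) (x y z t : X) {j : Fin 4}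
    {τ : Fin 4 → ℕ} (hτ : τ ∈ ordersWithGreatest j) :
    P ![x, y, z, t] τ 0 1 = basePotential P j x y z t := by
  have h {τ : Fin 4 → ℕ} (hτ : τ ∈ ordersWithGreatest j) := hP ![x, y, z, t] τ
    (injective_of_mem_ordersWithGreatest hτ)
  obtain ⟨τ₁, h₁, τ₂, h₂, e, e₁, e₂⟩ := exists_agree_of_mem_ordersWithGreatest j τ hτ
  have h₃ := hP ![x, y, z, t] (baseOrder j)
    (injective_of_mem_ordersWithGreatest (baseOrder_mem j))
  exact ((h hτ).apply_eq_of_agree (h h₁) e).trans (((h h₁).apply_eq_of_agree (h h₂) e₁).trans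
    ((h h₂).apply_eq_of_agree h₃ e₂))

/-- Any choice of operations on a planar shape with leaves x, y, z, t is dictated by some order of
the four leaves, so this coefficient is covered by a potential. The permutation applied to the
winner is its new position after the variables are permuted. The same holds for the other four
shapes. -/
theorem coeff_shapeA [CharZero K]
    (hP : ∀ u τ, Function.Injective τ → IsPotential f u τ (P u τ)) (ω₁ ω₂ ω₃ : MDOp)
    (x y z t : X) : f (shapeA ω₁ ω₂ ω₃ x y z t) =
      basePotential P (winnerA ω₁ ω₂ ω₃) x y z t -
        basePotential P (![1, 0, 2, 3] (winnerA ω₁ ω₂ ω₃)) y x z t := by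
  have key (a b c d : ℕ) {j k : Fin 4} (hj : ![a, b, c, d] ∈ ordersWithGreatest j)
      (hk : ![b, a, c, d] ∈ ordersWithGreatest k) (hτ : Function.Injective ![a, b, c, d]) :
      f (treeMonomial ![x, y, z, t] ![a, b, c, d] (shapeA () () () 0 1 2 3)) =
        basePotential P j x y z t - basePotential P k y x z t := by
    have g := potential_family_perm hP x y z t hτ
    rw [(hP ![x, y, z, t] _ hτ).a0123, potential_family_eq_basePotential hP x y z t hj,
      g.1, potential_family_eq_basePotential hP y x z t hk]
  -- In each of the eight cases, the given heights make the prescribed operations the winning ones.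
  cases ω₁ <;> cases ω₂ <;> cases ω₃
  · exact key 3 0 1 2 (by decide) (by decide) (by decide)
  · exact key 2 0 1 3 (by decide) (by decide) (by decide)
  · exact key 1 0 3 2 (by decide) (by decide) (by decide)
  · exact key 1 0 2 3 (by decide) (by decide) (by decide)
  · exact key 0 3 1 2 (by decide) (by decide) (by decide)
  · exact key 0 2 1 3 (by decide) (by decide) (by decide)
  · exact key 0 1 3 2 (by decide) (by decide) (by decide)
  · exact key 0 1 2 3 (by decide) (by decide) (by decide)

theorem coeff_shapeB [CharZero K]
    (hP : ∀ u τ, Function.Injective τ → IsPotential f u τ (P u τ)) (ω₁ ω₂ ω₃ : MDOp)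
    (x y z t : X) : f (shapeB ω₁ ω₂ ω₃ x y z t) =
      basePotential P (![2, 1, 0, 3] (winnerB ω₁ ω₂ ω₃)) z y x t -
        basePotential P (![2, 0, 1, 3] (winnerB ω₁ ω₂ ω₃)) y z x t := by
  have key (a b c d : ℕ) {j k : Fin 4} (hj : ![c, b, a, d] ∈ ordersWithGreatest j)
      (hk : ![b, c, a, d] ∈ ordersWithGreatest k) (hτ : Function.Injective ![a, b, c, d]) :
      f (treeMonomial ![x, y, z, t] ![a, b, c, d] (shapeB () () () 0 1 2 3)) =
        basePotential P j z y x t - basePotential P k y z x t := by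
    have g := potential_family_perm hP x y z t hτ
    rw [(hP ![x, y, z, t] _ hτ).b0123, g.2.2.2, potential_family_eq_basePotential hP z y x t hj,
      g.2.1, potential_family_eq_basePotential hP y z x t hk]
  cases ω₁ <;> cases ω₂ <;> cases ω₃
  · exact key 3 1 0 2 (by decide) (by decide) (by decide)
  · exact key 2 1 0 3 (by decide) (by decide) (by decide)
  · exact key 0 3 1 2 (by decide) (by decide) (by decide)
  · exact key 0 2 1 3 (by decide) (by decide) (by decide)
  · exact key 3 0 1 2 (by decide) (by decide) (by decide)
  · exact key 2 0 1 3 (by decide) (by decide) (by decide)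
  · exact key 0 1 3 2 (by decide) (by decide) (by decide)
  · exact key 0 1 2 3 (by decide) (by decide) (by decide)

theorem coeff_shapeC [CharZero K]
    (hP : ∀ u τ, Function.Injective τ → IsPotential f u τ (P u τ)) (ω₁ ω₂ ω₃ : MDOp)
    (x y z t : X) : f (shapeC ω₁ ω₂ ω₃ x y z t) =
      basePotential P (![1, 2, 0, 3] (winnerC ω₁ ω₂ ω₃)) z x y t -
        basePotential P (![2, 1, 0, 3] (winnerC ω₁ ω₂ ω₃)) z y x t := by
  have key (a b c d : ℕ) {j k : Fin 4} (hj : ![c, a, b, d] ∈ ordersWithGreatest j)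
      (hk : ![c, b, a, d] ∈ ordersWithGreatest k) (hτ : Function.Injective ![a, b, c, d]) :
      f (treeMonomial ![x, y, z, t] ![a, b, c, d] (shapeC () () () 0 1 2 3)) =
        basePotential P j z x y t - basePotential P k z y x t := by
    have g := potential_family_perm hP x y z t hτ
    rw [(hP ![x, y, z, t] _ hτ).c0123, g.2.2.1, potential_family_eq_basePotential hP z x y t hj,
      g.2.2.2, potential_family_eq_basePotential hP z y x t hk]
  cases ω₁ <;> cases ω₂ <;> cases ω₃
  · exact key 3 0 2 1 (by decide) (by decide) (by decide)
  · exact key 1 0 3 2 (by decide) (by decide) (by decide)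
  · exact key 3 0 1 2 (by decide) (by decide) (by decide)
  · exact key 1 0 2 3 (by decide) (by decide) (by decide)
  · exact key 0 3 2 1 (by decide) (by decide) (by decide)
  · exact key 0 1 3 2 (by decide) (by decide) (by decide)
  · exact key 0 3 1 2 (by decide) (by decide) (by decide)
  · exact key 0 1 2 3 (by decide) (by decide) (by decide)

theorem coeff_shapeD [CharZero K]
    (hP : ∀ u τ, Function.Injective τ → IsPotential f u τ (P u τ)) (ω₁ ω₂ ω₃ : MDOp)
    (x y z t : X) : f (shapeD ω₁ ω₂ ω₃ x y z t) =
      basePotential P (![1, 0, 2, 3] (winnerD ω₁ ω₂ ω₃)) y x z t -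
        basePotential P (![1, 2, 0, 3] (winnerD ω₁ ω₂ ω₃)) z x y t := by
  have key (a b c d : ℕ) {j k : Fin 4} (hj : ![b, a, c, d] ∈ ordersWithGreatest j)
      (hk : ![c, a, b, d] ∈ ordersWithGreatest k) (hτ : Function.Injective ![a, b, c, d]) :
      f (treeMonomial ![x, y, z, t] ![a, b, c, d] (shapeD () () () 0 1 2 3)) =
        basePotential P j y x z t - basePotential P k z x y t := by
    have g := potential_family_perm hP x y z t hτ
    rw [(hP ![x, y, z, t] _ hτ).d0123, g.1, potential_family_eq_basePotential hP y x z t hj,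
      g.2.2.1, potential_family_eq_basePotential hP z x y t hk]
  cases ω₁ <;> cases ω₂ <;> cases ω₃
  · exact key 3 2 0 1 (by decide) (by decide) (by decide)
  · exact key 0 3 1 2 (by decide) (by decide) (by decide)
  · exact key 3 1 0 2 (by decide) (by decide) (by decide)
  · exact key 0 2 1 3 (by decide) (by decide) (by decide)
  · exact key 3 0 2 1 (by decide) (by decide) (by decide)
  · exact key 0 1 3 2 (by decide) (by decide) (by decide)
  · exact key 3 0 1 2 (by decide) (by decide) (by decide)
  · exact key 0 1 2 3 (by decide) (by decide) (by decide)

theorem coeff_shapeE [CharZero K]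
    (hP : ∀ u τ, Function.Injective τ → IsPotential f u τ (P u τ)) (ω₁ ω₂ ω₃ : MDOp)
    (x y z t : X) : f (shapeE ω₁ ω₂ ω₃ x y z t) =
      basePotential P (![2, 0, 1, 3] (winnerE ω₁ ω₂ ω₃)) y z x t -
        basePotential P (winnerE ω₁ ω₂ ω₃) x y z t := by
  have key (a b c d : ℕ) {j k : Fin 4} (hj : ![b, c, a, d] ∈ ordersWithGreatest j)
      (hk : ![a, b, c, d] ∈ ordersWithGreatest k) (hτ : Function.Injective ![a, b, c, d]) :
      f (treeMonomial ![x, y, z, t] ![a, b, c, d] (shapeE () () () 0 1 2 3)) =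
        basePotential P j y z x t - basePotential P k x y z t := by
    have g := potential_family_perm hP x y z t hτ
    rw [(hP ![x, y, z, t] _ hτ).e0123, g.2.1, potential_family_eq_basePotential hP y z x t hj,
      potential_family_eq_basePotential hP x y z t hk]
  cases ω₁ <;> cases ω₂ <;> cases ω₃
  · exact key 3 2 1 0 (by decide) (by decide) (by decide)
  · exact key 0 3 2 1 (by decide) (by decide) (by decide)
  · exact key 3 0 2 1 (by decide) (by decide) (by decide)
  · exact key 0 1 3 2 (by decide) (by decide) (by decide)
  · exact key 3 2 0 1 (by decide) (by decide) (by decide)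
  · exact key 0 3 1 2 (by decide) (by decide) (by decide)
  · exact key 3 0 1 2 (by decide) (by decide) (by decide)
  · exact key 0 1 2 3 (by decide) (by decide) (by decide)

end Coefficients

/-! ### Decomposition of a polynomial of degree 4 and reindexing of sums. -/

instance : Fintype MDOp := ⟨{.left, .right}, fun ω => by cases ω <;> decide⟩

theorem MDOp.sum_univ {M : Type*} [AddCommMonoid M] (F : MDOp → M) :
    ∑ ω, F ω = F .left + F .right :=
  Finset.sum_pair (by decide)

section Decomposition

variable {K X : Type*} [Field K]

/-- The set of variables of a monomial. -/
def OpMonomial.vars {Ω X : Type*} [DecidableEq X] : OpMonomial Ω X → Finset X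
  | .var x => {x}
  | .app _ a b => a.vars ∪ b.vars

/-- The five families of monomials of degree 4. -/
def shape {Ω : Type*} (i : Fin 5) (m : (Ω × Ω × Ω) × X × X × X × X) : OpMonomial Ω X :=
  match i with
  | 0 => shapeA m.1.1 m.1.2.1 m.1.2.2 m.2.1 m.2.2.1 m.2.2.2.1 m.2.2.2.2
  | 1 => shapeB m.1.1 m.1.2.1 m.1.2.2 m.2.1 m.2.2.1 m.2.2.2.1 m.2.2.2.2
  | 2 => shapeC m.1.1 m.1.2.1 m.1.2.2 m.2.1 m.2.2.1 m.2.2.2.1 m.2.2.2.2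
  | 3 => shapeD m.1.1 m.1.2.1 m.1.2.2 m.2.1 m.2.2.1 m.2.2.2.1 m.2.2.2.2
  | 4 => shapeE m.1.1 m.1.2.1 m.1.2.2 m.2.1 m.2.2.1 m.2.2.2.1 m.2.2.2.2

theorem shape_injective {Ω : Type*} :
    Function.Injective fun q : Fin 5 × (Ω × Ω × Ω) × X × X × X × X => shape q.1 q.2 := by
  rintro ⟨i, ⟨a, b, c⟩, x, y, z, t⟩ ⟨j, ⟨a', b', c'⟩, x', y', z', t'⟩ h
  fin_cases i <;> fin_cases j <;>
    simp_all [shape, shapeA, shapeB, shapeC, shapeD, shapeE]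

theorem Finsupp.eq_sum_single_of_injective {ι M : Type*} (f : M →₀ K) {g : ι → M}
    (hg : Function.Injective g) (I : Finset ι) (hI : ∀ m ∈ f.support, ∃ i ∈ I, g i = m) :
    f = ∑ i ∈ I, f (g i) • Finsupp.single (g i) 1 := by
  classical
  simp only [Finsupp.smul_single, smul_eq_mul, mul_one]
  rw [← Finset.sum_image (f := fun m => Finsupp.single m (f m)) hg.injOn]
  conv_lhs => rw [← f.sum_single]
  refine Finset.sum_subset (fun m hm => Finset.mem_image.2 (hI m hm)) fun m _ hm => ?_
  rw [Finsupp.notMem_support_iff.1 hm, Finsupp.single_zero]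

/-- A polynomial of degree 4 as the sum of its terms. -/
theorem IsHomogeneousOfDegree.eq_sum_shape {f : FreeOpAlgebra K MDOp X}
    (hd : IsHomogeneousOfDegree f 4) : ∃ S : Finset X, f =
      ∑ ω₁, ∑ ω₂, ∑ ω₃, ∑ x ∈ S, ∑ y ∈ S, ∑ z ∈ S, ∑ t ∈ S,
        (f (shapeA ω₁ ω₂ ω₃ x y z t) • Finsupp.single (shapeA ω₁ ω₂ ω₃ x y z t) 1 +
        f (shapeB ω₁ ω₂ ω₃ x y z t) • Finsupp.single (shapeB ω₁ ω₂ ω₃ x y z t) 1 +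
        f (shapeC ω₁ ω₂ ω₃ x y z t) • Finsupp.single (shapeC ω₁ ω₂ ω₃ x y z t) 1 +
        f (shapeD ω₁ ω₂ ω₃ x y z t) • Finsupp.single (shapeD ω₁ ω₂ ω₃ x y z t) 1 +
        f (shapeE ω₁ ω₂ ω₃ x y z t) • Finsupp.single (shapeE ω₁ ω₂ ω₃ x y z t) 1) := by
  classical
  set S := f.support.biUnion OpMonomial.vars with hS
  refine ⟨S, ?_⟩
  have hI (m) (hm : m ∈ f.support) : ∃ q ∈ (Finset.univ : Finset (Fin 5)) ×ˢ
      ((Finset.univ : Finset (MDOp × MDOp × MDOp)) ×ˢ S ×ˢ S ×ˢ S ×ˢ S), shape q.1 q.2 = m := by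
    have hv {x} (hx : x ∈ m.vars) : x ∈ S := Finset.mem_biUnion.2 ⟨m, hm, hx⟩
    obtain ⟨ω₁, ω₂, ω₃, x, y, z, t, h⟩ := OpMonomial.degree_eq_four (hd m hm)
    have key (i : Fin 5) (h : m = shape i ((ω₁, ω₂, ω₃), x, y, z, t)) :
        ∃ q ∈ (Finset.univ : Finset (Fin 5)) ×ˢ
          ((Finset.univ : Finset (MDOp × MDOp × MDOp)) ×ˢ S ×ˢ S ×ˢ S ×ˢ S), shape q.1 q.2 = m := by
      refine ⟨⟨i, (ω₁, ω₂, ω₃), x, y, z, t⟩, ?_, h.symm⟩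
      simp only [Finset.mem_product, Finset.mem_univ, true_and]
      refine ⟨hv ?_, hv ?_, hv ?_, hv ?_⟩ <;> rw [h] <;> fin_cases i <;>
        simp [shape, shapeA, shapeB, shapeC, shapeD, shapeE, OpMonomial.vars]
    obtain h | h | h | h | h := h
    exacts [key 0 h, key 1 h, key 2 h, key 3 h, key 4 h]
  conv_lhs => rw [Finsupp.eq_sum_single_of_injective f shape_injective _ hI]
  rw [Finset.sum_product, Fin.sum_univ_five, ← Finset.sum_add_distrib, ← Finset.sum_add_distrib,
    ← Finset.sum_add_distrib, ← Finset.sum_add_distrib, Finset.sum_product,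
    ← Finset.univ_product_univ, Finset.sum_product]
  refine Finset.sum_congr rfl fun ω₁ _ => ?_
  rw [← Finset.univ_product_univ, Finset.sum_product]
  refine Finset.sum_congr rfl fun ω₂ _ => Finset.sum_congr rfl fun ω₃ _ => ?_
  rw [Finset.sum_product]
  refine Finset.sum_congr rfl fun x _ => ?_
  rw [Finset.sum_product]
  refine Finset.sum_congr rfl fun y _ => ?_
  rw [Finset.sum_product]
  rfl

theorem freeOps_single (ω : MDOp) (a b : OpMonomial MDOp X) :
    freeOps K MDOp X ω (.single a 1) (.single b 1) = .single (.app ω a b) 1 := by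
  simp [freeOps, Finsupp.lmapDomain_apply, Finsupp.mapDomain_single]

end Decomposition

section Sums

variable {K X M : Type*} [Field K] [AddCommGroup M] [Module K M]

theorem sum_swap_left (S : Finset X) (F : X → X → X → M) :
    ∑ x ∈ S, ∑ y ∈ S, ∑ z ∈ S, F x y z = ∑ x ∈ S, ∑ y ∈ S, ∑ z ∈ S, F y x z :=
  Finset.sum_comm

theorem sum_swap_right (S : Finset X) (F : X → X → X → M) :
    ∑ x ∈ S, ∑ y ∈ S, ∑ z ∈ S, F x y z = ∑ x ∈ S, ∑ y ∈ S, ∑ z ∈ S, F x z y :=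
  Finset.sum_congr rfl fun _ _ => Finset.sum_comm

theorem sum_rotate_left (S : Finset X) (F : X → X → X → M) :
    ∑ x ∈ S, ∑ y ∈ S, ∑ z ∈ S, F x y z = ∑ x ∈ S, ∑ y ∈ S, ∑ z ∈ S, F y z x :=
  ((sum_swap_left S _).trans (sum_swap_right S _)).symm

theorem sum_rotate_right (S : Finset X) (F : X → X → X → M) :
    ∑ x ∈ S, ∑ y ∈ S, ∑ z ∈ S, F x y z = ∑ x ∈ S, ∑ y ∈ S, ∑ z ∈ S, F z x y :=
  ((sum_swap_right S _).trans (sum_swap_left S _)).symm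

theorem sum_reverse (S : Finset X) (F : X → X → X → M) :
    ∑ x ∈ S, ∑ y ∈ S, ∑ z ∈ S, F x y z = ∑ x ∈ S, ∑ y ∈ S, ∑ z ∈ S, F z y x :=
  (sum_swap_left S _).trans (sum_rotate_left S _)

/-- Summation variables are renamed term by term so that every potential has the arguments x, y, z,
t in this order and the permutations move to the monomials. The terms with a common potential can
then be collected. -/
theorem sum_reindex (S : Finset X) (a a' b b' c c' d d' e e' : X → X → X → X → K)
    (A B C D E : X → X → X → X → M) :
    ∑ x ∈ S, ∑ y ∈ S, ∑ z ∈ S, ∑ t ∈ S,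
      ((a x y z t - a' y x z t) • A x y z t + (b z y x t - b' y z x t) • B x y z t +
        (c z x y t - c' z y x t) • C x y z t + (d y x z t - d' z x y t) • D x y z t +
        (e y z x t - e' x y z t) • E x y z t) =
    ∑ x ∈ S, ∑ y ∈ S, ∑ z ∈ S, ∑ t ∈ S,
      ((a x y z t • A x y z t - a' x y z t • A y x z t) +
        (b x y z t • B z y x t - b' x y z t • B z x y t) +
        (c x y z t • C y z x t - c' x y z t • C z y x t) +
        (d x y z t • D y x z t - d' x y z t • D y z x t) +
        (e x y z t • E z x y t - e' x y z t • E x y z t)) := by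
  simp only [sub_smul, Finset.sum_add_distrib, Finset.sum_sub_distrib]
  exact congrArg₂ _ (congrArg₂ _ (congrArg₂ _ (congrArg₂ _
    (congrArg₂ _ rfl (sum_swap_left S _))
    (congrArg₂ _ (sum_reverse S _) (sum_rotate_right S _)))
    (congrArg₂ _ (sum_rotate_left S _) (sum_reverse S _)))
    (congrArg₂ _ (sum_swap_left S _) (sum_rotate_left S _)))
    (congrArg₂ _ (sum_rotate_right S _) rfl)

end Sums

/-! ### Part (3): no identities of degree 3. -/

section Triples

variable {K X : Type*} [Field K]

/-- Three choices of octonion units give three independent relations between the coefficients at the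
three trees. The fourth label does not occur in them, so its unit is an arbitrary filler. -/
theorem treeMonomial_triple_eq_zero [CharZero K] {f : FreeOpAlgebra K MDOp X}
    (hf : IsIdentityOf f (quadToMD (freeAltQuadOps K X))) (hd : IsHomogeneousOfDegree f 3)
    (u : Fin 4 → X) {τ : Fin 4 → ℕ} (hτ : Function.Injective τ) :
    f (treeMonomial u τ (.app () (.app () (.var 0) (.var 1)) (.var 2))) = 0 ∧
      f (treeMonomial u τ (.app () (.var 0) (.app () (.var 1) (.var 2)))) = 0 := by
  have h := zipWith_labelledTriples_eq_zero hf hd u hτ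
  have h₁ := h ![(0, 0, 1), (0, 0, 1), (0, 1, 0), 0] [0, -4, -4] (by decide +kernel)
  have h₂ := h ![(0, 0, 1), (0, 1, 0), (0, 0, 1), 0] [4, 4, 0] (by decide +kernel)
  have h₃ := h ![(0, 0, 1), (0, 1, 0), (1, 0, 0), 0] [-4, 4, -4] (by decide +kernel)
  simp only [labelledTriples, List.zipWith_cons_cons, List.zipWith_nil_left, List.sum_cons,
    List.sum_nil, Int.cast_ofNat, Int.cast_neg, Int.cast_zero, zero_mul, zero_add, add_zero]
    at h₁ h₂ h₃
  constructor
  · linear_combination (exp := 1) 1 / 12 * (h₁ + 2 * h₂ - h₃)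
  · linear_combination (exp := 1) 1 / 12 * (h₂ + h₃ - h₁)

theorem eq_zero_of_isIdentityOf_of_degree_three [CharZero K] {f : FreeOpAlgebra K MDOp X}
    (hf : IsIdentityOf f (quadToMD (freeAltQuadOps K X))) (hd : IsHomogeneousOfDegree f 3) :
    f = 0 := by
  rw [← Finsupp.support_eq_empty, Finset.eq_empty_iff_forall_notMem]
  intro m hm
  have h (u : Fin 4 → X) (τ : Fin 4 → ℕ) (hτ : Function.Injective τ) :=
    treeMonomial_triple_eq_zero hf hd u hτ
  refine Finsupp.mem_support_iff.1 hm ?_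
  obtain ⟨ω₁, ω₂, x, y, z, rfl⟩ | ⟨ω₁, ω₂, x, y, z, rfl⟩ := OpMonomial.degree_eq_three (hd m hm)
  -- The order dictates the two operations. Label 3 is unused; its variable z and its height 3 are
  -- fillers, the height only keeping the order injective.
  · cases ω₁ <;> cases ω₂
    · exact (h ![x, y, z, z] ![2, 0, 1, 3] (by decide)).1
    · exact (h ![x, y, z, z] ![1, 0, 2, 3] (by decide)).1
    · exact (h ![x, y, z, z] ![0, 2, 1, 3] (by decide)).1
    · exact (h ![x, y, z, z] ![0, 1, 2, 3] (by decide)).1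
  · cases ω₁ <;> cases ω₂
    · exact (h ![x, y, z, z] ![2, 1, 0, 3] (by decide)).2
    · exact (h ![x, y, z, z] ![0, 2, 1, 3] (by decide)).2
    · exact (h ![x, y, z, z] ![2, 0, 1, 3] (by decide)).2
    · exact (h ![x, y, z, z] ![0, 1, 2, 3] (by decide)).2

end Triples

/-! ### Part (2): identities of degree 4 follow from MD_1, ..., MD_4. -/

section Conclusion

variable {K X : Type*} [Field K]

/-- Collecting by j leaves the ten signed planar monomial shapes obtained from Sagle's identity with
t rightmost, where the brackets not containing t are expanded as commutators. The operations run
over all choices for which the j-th variable wins the second race. This is MD_j. -/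
theorem sum_shapes_eq_mdRel (L : Fin 4 → K) (x y z t : X) :
    ∑ ω₁, ∑ ω₂, ∑ ω₃,
      ((L (winnerA ω₁ ω₂ ω₃) • Finsupp.single (shapeA ω₁ ω₂ ω₃ x y z t) (1 : K) -
          L (![1, 0, 2, 3] (winnerA ω₁ ω₂ ω₃)) • .single (shapeA ω₁ ω₂ ω₃ y x z t) 1) +
        (L (![2, 1, 0, 3] (winnerB ω₁ ω₂ ω₃)) • .single (shapeB ω₁ ω₂ ω₃ z y x t) 1 -
          L (![2, 0, 1, 3] (winnerB ω₁ ω₂ ω₃)) • .single (shapeB ω₁ ω₂ ω₃ z x y t) 1) +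
        (L (![1, 2, 0, 3] (winnerC ω₁ ω₂ ω₃)) • .single (shapeC ω₁ ω₂ ω₃ y z x t) 1 -
          L (![2, 1, 0, 3] (winnerC ω₁ ω₂ ω₃)) • .single (shapeC ω₁ ω₂ ω₃ z y x t) 1) +
        (L (![1, 0, 2, 3] (winnerD ω₁ ω₂ ω₃)) • .single (shapeD ω₁ ω₂ ω₃ y x z t) 1 -
          L (![1, 2, 0, 3] (winnerD ω₁ ω₂ ω₃)) • .single (shapeD ω₁ ω₂ ω₃ y z x t) 1) +
        (L (![2, 0, 1, 3] (winnerE ω₁ ω₂ ω₃)) • .single (shapeE ω₁ ω₂ ω₃ z x y t) 1 -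
          L (winnerE ω₁ ω₂ ω₃) • .single (shapeE ω₁ ω₂ ω₃ x y z t) 1)) =
    ∑ j, L j • mdRel (freeOps K MDOp X) j (.single (.var x) 1) (.single (.var y) 1)
      (.single (.var z) 1) (.single (.var t) 1) := by
  simp only [MDOp.sum_univ, Fin.sum_univ_four, mdRel, md1, md2, md3, md4, freeOps_single, winnerA,
    winnerB, winnerC, winnerD, winnerE, shapeA, shapeB, shapeC, shapeD, shapeE, smul_add, smul_sub,
    Matrix.cons_val]
  abel

theorem mdRel_mem_mdConsequences (j : Fin 4) (x y z t : FreeOpAlgebra K MDOp X) :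
    mdRel (freeOps K MDOp X) j x y z t ∈ mdConsequences K X :=
  Submodule.mem_sInf.2 fun _ hI => hI.1 ⟨j, x, y, z, t, rfl⟩

theorem mem_mdConsequences_of_isIdentityOf [CharZero K] {f : FreeOpAlgebra K MDOp X}
    (hf : IsIdentityOf f (quadToMD (freeAltQuadOps K X))) (hd : IsHomogeneousOfDegree f 4) :
    f ∈ mdConsequences K X := by
  obtain ⟨P, hP⟩ := exists_potential_family hf hd
  obtain ⟨S, hS⟩ := hd.eq_sum_shape
  simp only [coeff_shapeA hP, coeff_shapeB hP, coeff_shapeC hP, coeff_shapeD hP,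
    coeff_shapeE hP] at hS
  have key (ω₁ ω₂ ω₃ : MDOp) := sum_reindex S
    (basePotential P (winnerA ω₁ ω₂ ω₃))
    (basePotential P (![1, 0, 2, 3] (winnerA ω₁ ω₂ ω₃)))
    (basePotential P (![2, 1, 0, 3] (winnerB ω₁ ω₂ ω₃)))
    (basePotential P (![2, 0, 1, 3] (winnerB ω₁ ω₂ ω₃)))
    (basePotential P (![1, 2, 0, 3] (winnerC ω₁ ω₂ ω₃)))
    (basePotential P (![2, 1, 0, 3] (winnerC ω₁ ω₂ ω₃)))
    (basePotential P (![1, 0, 2, 3] (winnerD ω₁ ω₂ ω₃)))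
    (basePotential P (![1, 2, 0, 3] (winnerD ω₁ ω₂ ω₃)))
    (basePotential P (![2, 0, 1, 3] (winnerE ω₁ ω₂ ω₃)))
    (basePotential P (winnerE ω₁ ω₂ ω₃))
    (fun x y z t => Finsupp.single (shapeA ω₁ ω₂ ω₃ x y z t) (1 : K))
    (fun x y z t => Finsupp.single (shapeB ω₁ ω₂ ω₃ x y z t) (1 : K))
    (fun x y z t => Finsupp.single (shapeC ω₁ ω₂ ω₃ x y z t) (1 : K))
    (fun x y z t => Finsupp.single (shapeD ω₁ ω₂ ω₃ x y z t) (1 : K))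
    (fun x y z t => Finsupp.single (shapeE ω₁ ω₂ ω₃ x y z t) (1 : K))
  replace hS := hS.trans (Finset.sum_congr rfl fun ω₁ _ => Finset.sum_congr rfl fun ω₂ _ =>
    Finset.sum_congr rfl fun ω₃ _ => key ω₁ ω₂ ω₃)
  -- The sums over operations move inside the sums over variables, so that for fixed x, y, z, t they
  -- form the combination of MD_1, ..., MD_4 with the four potentials as coefficients.
  simp only [Finset.sum_comm (s := (Finset.univ : Finset MDOp)) (t := S)] at hS
  rw [hS]
  refine Submodule.sum_mem _ fun x _ => Submodule.sum_mem _ fun y _ => Submodule.sum_mem _ fun z _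
    =>
    Submodule.sum_mem _ fun t _ => ?_
  rw [sum_shapes_eq_mdRel (fun j => basePotential P j x y z t)]
  exact Submodule.sum_mem _ fun j _ => Submodule.smul_mem _ _ (mdRel_mem_mdConsequences j _ _ _ _)

end Conclusion

theorem mainTheorem4 (K : Type*) [Field K] :
    (∀ (A : Type*) [AddCommGroup A] [Module K A] (μ : BilinearOps K QuadOp A),
      IsAlternativeQuadrialgebra μ → IsMDendriform (quadToMD μ)) ∧
    (CharZero K → ∀ (X : Type*) (f : FreeOpAlgebra K MDOp X),
      IsIdentityOf f (quadToMD (freeAltQuadOps K X)) →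
        (IsHomogeneousOfDegree f 4 → f ∈ mdConsequences K X) ∧
        (IsHomogeneousOfDegree f 3 → f = 0)) := by
  refine ⟨fun A _ _ μ h => h.isMDendriform_quadToMD, fun _ X f hf => ⟨?_, ?_⟩⟩
  · exact mem_mdConsequences_of_isIdentityOf hf
  · exact eq_zero_of_isIdentityOf_of_degree_three hf
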